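/- Let $m, n \ge 2$ be integers and let $G = C_{mn} \oplus C_{mn}$, where $C_k$ denotes a cyclic group with $k$ elements. Sequences over an abelian group $H$ are elements of the (multiplicatively written) free abelian monoid $\mathcal F(H)$ with basis $H$, i.e. finite sequences up to order; $|T|$ denotes the length and $\sigma(T)$ the sum of a sequence $T$, and a homomorphism is applied to a sequence term by term. A minimal zero-sum sequence is a nonempty sequence with sum $0$ none of whose nonempty proper subsequences has sum $0$. A pair $(e_1,e_2)$ of nonzero elements of $H$ is a basis of $H$ if $H = \langle e_1\rangle \oplus \langle e_2 \rangle$. Suppose that $C_n \oplus C_n$ has Property B, i.e. every minimal zero-sum sequence over $C_n \oplus C_n$ of length $2n-1$ contains an element with multiplicity $n-1$. Let $S$ be a minimal zero-sum sequence over $G$ of length $|S| = 2mn-1$, and let $\varphi \colon G \to G$ be multiplication by $m$. Then there exist sequences $W_0, \ldots, W_{2m-2}$ over $G$ with $$S = W_0 \cdot \ldots \cdot W_{2m-2}, \qquad |W_i| > 0 \ \text{ and } \ \sigma(W_i) \in \operatorname{Ker}(\varphi) \ \text{ for all } i \in [0,2m-2],$$ and a basis $(e_1, e_2)$ of $\varphi(G)$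 such that $$\varphi(W_0) = e_1^{n-1} \prod_{\nu=1}^n (x_\nu e_1 + e_2)$$ with integers $x_1, \ldots, x_n \in [0,n-1]$, $x_1 + \cdots + x_n \equiv 1 \pmod n$, and such that for every $i \in [1, 2m-2]$ either $\varphi(W_i) = e_1^n$ or $$\varphi(W_i) = \prod_{\nu=1}^n (c_{i,\nu} e_1 + e_2)$$ with integers $c_{i,1}, \ldots, c_{i,n} \in [0,n-1]$, $c_{i,1} + \cdots + c_{i,n} \equiv 0 \pmod n$. In particular, there are $\ell \in [1, 2m-1]$ and further integers $x_{n+1}, \ldots, x_{2mn-\ell n}$ such that $$\varphi(S) = e_1^{\ell n - 1} \prod_{\nu=1}^{2mn-\ell n} (x_\nu e_1 + e_2)$$ and $x_\nu \in [0,n-1]$ for all $\nu \in [1, 2mn - \ell n]$. -/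

import Mathlib

/-! Sequences over an abelian group `G` are elements of the free abelian monoid on `G`, i.e.
multisets: the product of sequences is `+`, the empty sequence is `0`, `S₁ ∣ S` is `S₁ ≤ S`,
the length is `Multiset.card`, the sum is `Multiset.sum`, and the multiplicity is
`Multiset.count`. -/

namespace ZeroSum

/-- No nonempty subsequence has sum zero. -/
def ZeroSumFree {G : Type*} [AddCommGroup G] (S : Multiset G) : Prop :=
  ∀ T ≤ S, T ≠ 0 → T.sum ≠ 0

/-- Minimal zero-sum sequences: nonempty, of sum zero, and every nonempty proper subsequence
is zero-sum free. -/
def IsMinimalZeroSum {G : Type*} [AddCommGroup G] (S : Multiset G) : Prop :=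
  S ≠ 0 ∧ S.sum = 0 ∧
    ∀ T ≤ S, 1 ≤ Multiset.card T → Multiset.card T < Multiset.card S → ZeroSumFree T

/-- `C_n ⊕ C_n` has Property B: every minimal zero-sum sequence of length `2n - 1` contains an
element with multiplicity `n - 1`. -/
def PropertyB (n : ℕ) : Prop :=
  ∀ S : Multiset (ZMod n × ZMod n), IsMinimalZeroSum S → Multiset.card S = 2 * n - 1 →
    ∃ g, S.count g = n - 1

/-- `(e₁, e₂)` is a basis of the abelian group `H`: it is independent and
`H = ⟨e₁⟩ ⊕ ⟨e₂⟩`. -/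
structure IsBasisPair {H : Type*} [AddCommGroup H] (e₁ e₂ : H) : Prop where
  ne_zero_left : e₁ ≠ 0
  ne_zero_right : e₂ ≠ 0
  independent : ∀ a b : ℤ, a • e₁ + b • e₂ = 0 → a • e₁ = 0 ∧ b • e₂ = 0
  isCompl : IsCompl (AddSubgroup.zmultiples e₁) (AddSubgroup.zmultiples e₂)

/-- `(W_0, …, W_{2m-2})` is a product decomposition of `S` with respect to the endomorphism
`φ`: its product is `S`, and each `W_i` is nonempty with sum in the kernel of `φ`. -/
structure IsProductDecomposition {G : Type*} [AddCommGroup G] (m : ℕ) (φ : G →+ G)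
    (S : Multiset G) (W : Fin (2 * m - 2 + 1) → Multiset G) : Prop where
  prod_eq : S = ∑ i, W i
  sum_mem_ker : ∀ i, (W i).sum ∈ φ.ker
  card_pos : ∀ i, 0 < Multiset.card (W i)

/-- The sequence `∏_{ν=1}^{k} (x_ν e₁ + e₂)`. -/
def affineSeq {H : Type*} [AddCommGroup H] (e₁ e₂ : H) (k : ℕ) (x : ℕ → ℕ) : Multiset H :=
  (Finset.Icc 1 k).val.map fun ν => x ν • e₁ + e₂

end ZeroSum

namespace ZeroSum

open Multiset

/-! ### Sub-multisets of sums and of images -/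

section MultisetLemmas

variable {α β : Type*}

/-! Let `T` be the image of `S` modulo `n`. As `φ` is multiplication by `m`, the group `φ(G)` is a
copy of `C_n ⊕ C_n` in which `φ(S)` corresponds to `T`. The heart of the theorem is that for some
basis `(e, f)` every term of `T` is `e` or lies on the line `f + ⟨e⟩` (`IsGood`). Then `T` splits
into a zero-sum part of length `2n - 1` and `2m - 2` zero-sum blocks of length `n`. In each of them
the number of terms different from `e` is a multiple of `n`, which forces the stated shapes.

Two facts about `T` are used. A group ring computation bounds the Davenport constant of `C_p ⊕ C_p`
and the length forcing a short zero-sum subsequence; both bounds extend multiplicatively to every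
modulus (`davenportBound_and_etaBound`). They imply that `T` has no zero-sum subsequence shorter
than `n` (`noShort_level`). Hence its zero-sum subsequences of length `2n - 1` are minimal, and
Property B gives each an element of multiplicity `n - 1`. These two facts make `T` tame (`IsTame`).

A tame zero-sum sequence of length `kq - 1` is good or exotic, that is, of the form `e₁^A e₂^B (e₁ +
e₂) (κ(e₂ - e₁))^C` with `κ` a unit different from `±1` (`isGood_or_isExotic`). This is shown for
length `3q - 1` by comparing decompositions into a long part and a block, and then extended block by
block.

The exotic case is excluded by climbing the levels `N ∣ mn` (`not_isExotic_level`). If the image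
modulo `N` is exotic, then each minimal zero-sum sequence of length `2Np - 1` inside the image
modulo `Np` has an element of multiplicity `Np - 1` (`ExoticData.exists_count`). So the image modulo
`Np` is tame, without any appeal to Property B there; it cannot be good, hence it is exotic too. At
the top level this contradicts `|S| = 2mn - 1`, since an exotic sequence modulo `q` has at least `3q
- 1` terms. The multiplicity statement rests on linear functionals obtained from the group ring
(`exists_functionals`): they take a constant value on all possible replacements of a block, and they
satisfy one linear identity. -/

theorem exists_le_card_eq {S : Multiset α} {k : ℕ} (h : k ≤ card S) : ∃ T ≤ S, card T = k := by
  have : (powersetCard k S) ≠ 0 := by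
    rw [← card_pos, card_powersetCard]; exact Nat.choose_pos h
  obtain ⟨T, hT⟩ := exists_mem_of_ne_zero this
  exact ⟨T, (mem_powersetCard.1 hT).1, (mem_powersetCard.1 hT).2⟩

theorem exists_le_of_le_map {f : α → β} {S : Multiset α} {T : Multiset β} (h : T ≤ S.map f) :
    ∃ T' ≤ S, T'.map f = T := by
  classical
  induction S using Multiset.induction_on generalizing T with
  | empty => exact ⟨0, le_rfl, by simpa using h.antisymm (Multiset.zero_le _) ▸ rfl⟩
  | cons a S ih =>
    rw [map_cons] at h
    by_cases ha : f a ∈ T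
    · have h1 : T.erase (f a) ≤ S.map f := by
        simpa using Multiset.erase_le_erase (f a) h
      obtain ⟨T', hT', e⟩ := ih h1
      exact ⟨a ::ₘ T', (cons_le_cons_iff a).2 hT', by rw [map_cons, e, cons_erase ha]⟩
    · obtain ⟨T', hT', e⟩ := ih ((le_cons_of_notMem ha).1 h)
      exact ⟨T', hT'.trans (le_cons_self _ _), e⟩

theorem le_of_le_add_of_notMem_left [DecidableEq α] {A B C : Multiset α} (h : A ≤ B + C)
    (hB : ∀ a ∈ A, a ∉ B) : A ≤ C := by
  rw [le_iff_count] at h ⊢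
  intro a
  by_cases ha : a ∈ A
  · have := h a
    rw [count_add, count_eq_zero.2 (hB a ha)] at this
    omega
  · rw [count_eq_zero.2 ha]; exact Nat.zero_le _

theorem le_of_le_add_of_notMem_right [DecidableEq α] {A B C : Multiset α} (h : A ≤ B + C)
    (hC : ∀ a ∈ A, a ∉ C) : A ≤ B :=
  le_of_le_add_of_notMem_left (by rwa [add_comm] at h) hC

end MultisetLemmas

/-! ### Products of `1 - X^x` in the group ring over `ZMod p` -/

section GroupRing

open AddMonoidAlgebra

variable (p : ℕ) [Fact p.Prime] {A : Type*} [AddCommGroup A]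

/-- The product of the factors `1 - X^x` of the group ring, taken over the terms `x` of a
sequence. -/
noncomputable def diffProd (S : Multiset A) : AddMonoidAlgebra (ZMod p) A :=
  (S.map fun x => 1 - single x 1).prod

theorem diffProd_zero : diffProd p (0 : Multiset A) = 1 := by simp [diffProd]

theorem diffProd_cons (x : A) (S : Multiset A) :
    diffProd p (x ::ₘ S) = (1 - single x 1) * diffProd p S := by simp [diffProd]

theorem coeff_one_sub_single_mul (x a : A) (P : AddMonoidAlgebra (ZMod p) A) :
    ((1 - single x 1) * P).coeff a = P.coeff a - P.coeff (a - x) := by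
  rw [sub_mul, one_mul]
  rw [AddMonoidAlgebra.coeff_sub, Finsupp.sub_apply]
  congr 1
  rw [coeff_single_mul_eq_mul_coeff (a - x), one_mul]
  intro m' _
  rw [eq_sub_iff_add_eq, add_comm]

/-- Expanding the product, the coefficient at `a` counts the subsequences of sum `a` with sign
`(-1)^|T|`. -/
theorem exists_sum_eq_of_coeff_diffProd_ne_zero (S : Multiset A) (a : A)
    (h : (diffProd p S).coeff a ≠ 0) : ∃ T ≤ S, T.sum = a := by
  classical
  induction S using Multiset.induction_on generalizing a with
  | empty =>
    refine ⟨0, le_rfl, ?_⟩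
    rw [diffProd_zero, one_def, coeff_single, Finsupp.single_apply] at h
    simpa using h
  | cons x S ih =>
    rw [diffProd_cons, coeff_one_sub_single_mul] at h
    by_cases h1 : (diffProd p S).coeff a = 0
    · have h2 : (diffProd p S).coeff (a - x) ≠ 0 := by
        intro h2; simp [h1, h2] at h
      obtain ⟨T, hT, e⟩ := ih _ h2
      exact ⟨x ::ₘ T, (cons_le_cons_iff x).2 hT, by simp [e]⟩
    · obtain ⟨T, hT, e⟩ := ih _ h1
      exact ⟨T, hT.trans (le_cons_self _ _), e⟩

theorem ZeroSumFree.mono {S T : Multiset A} (h : ZeroSumFree S) (hT : T ≤ S) : ZeroSumFree T :=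
  fun U hU => h U (hU.trans hT)

/-- Only the empty subsequence contributes to this coefficient. -/
theorem coeff_diffProd_zero {S : Multiset A} (h : ZeroSumFree S) :
    (diffProd p S).coeff 0 = 1 := by
  classical
  induction S using Multiset.induction_on with
  | empty => simp [diffProd_zero, one_def]
  | cons x S ih =>
    rw [diffProd_cons, coeff_one_sub_single_mul, ih (h.mono (le_cons_self _ _))]
    have : (diffProd p S).coeff (0 - x) = 0 := by
      by_contra h1
      obtain ⟨T, hT, e⟩ := exists_sum_eq_of_coeff_diffProd_ne_zero p S _ h1
      exact h (x ::ₘ T) ((cons_le_cons_iff x).2 hT) (by simp) (by simp [e])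
    rw [this, sub_zero]

theorem single_mul_one_sub (x y : A) :
    (1 - single (x + y) 1 : AddMonoidAlgebra (ZMod p) A) =
      (1 - single x 1) + single x 1 * (1 - single y 1) := by
  rw [mul_sub, single_mul_single]; simp

theorem one_sub_single_nsmul_mem {J : Ideal (AddMonoidAlgebra (ZMod p) A)} {x : A}
    (h : 1 - single x 1 ∈ J) (k : ℕ) : 1 - single (k • x) 1 ∈ J := by
  induction k with
  | zero => simp [one_def]
  | succ k ih =>
    rw [succ_nsmul, single_mul_one_sub]
    exact J.add_mem ih (J.mul_mem_left _ h)

theorem diffProd_mem_pow {J : Ideal (AddMonoidAlgebra (ZMod p) A)}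
    (h : ∀ x : A, 1 - single x 1 ∈ J) (S : Multiset A) : diffProd p S ∈ J ^ card S := by
  induction S using Multiset.induction_on with
  | empty => simp
  | cons x S ih =>
    rw [diffProd_cons, card_cons, pow_succ']
    exact Ideal.mul_mem_mul (h x) ih

/-- Frobenius in characteristic `p`: `(1 - X^x)^p = 1 - X^(px)`. -/
theorem span_one_sub_single_pow {x : A} (hx : p • x = 0) :
    Ideal.span {(1 - single x 1 : AddMonoidAlgebra (ZMod p) A)} ^ p = ⊥ := by
  have : CharP (AddMonoidAlgebra (ZMod p) A) p :=
    charP_of_injective_algebraMap (algebraMap (ZMod p) _).injective p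
  rw [Ideal.span_singleton_pow, sub_pow_char, single_pow, hx]
  simp [one_def]

/-- In each term `I^i J^(n-i)` of the binomial expansion, one exponent reaches its nilpotency bound.
-/
theorem sup_pow_eq_bot {R : Type*} [CommRing R] {I J : Ideal R} {k l n : ℕ} (hI : I ^ k = ⊥)
    (hJ : J ^ l = ⊥) (h : k + l ≤ n + 1) : (I ⊔ J) ^ n = ⊥ := by
  rw [← Ideal.add_eq_sup, add_pow]
  refine Finset.sum_eq_zero fun i hi => ?_
  rw [Finset.mem_range] at hi
  rcases le_total k i with h1 | h1
  · have : I ^ i = 0 := le_bot_iff.1 ((Ideal.pow_le_pow_right h1).trans hI.le)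
    rw [this, zero_mul, zero_mul]
  · by_cases h2 : l ≤ n - i
    · have : J ^ (n - i) = 0 := le_bot_iff.1 ((Ideal.pow_le_pow_right h2).trans hJ.le)
      rw [this, mul_zero, zero_mul]
    · have : I ^ i = 0 := le_bot_iff.1 ((Ideal.pow_le_pow_right (by omega)).trans hI.le)
      rw [this, zero_mul, zero_mul]

/-- Every `1 - X^x` lies in the ideal generated by `1 - X^c₁` and `1 - X^c₂`. Both generators have
vanishing `p`-th power, so the ideal is nilpotent of exponent at most `2p - 1`. -/
theorem diffProd_eq_zero_of_two_generators {c₁ c₂ : A} (h₁ : p • c₁ = 0) (h₂ : p • c₂ = 0)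
    (hc : ∀ x : A, ∃ k l : ℕ, x = k • c₁ + l • c₂) {S : Multiset A}
    (h : 2 * p - 1 ≤ card S) : diffProd p S = 0 := by
  have hJ : ∀ x : A, 1 - single x 1 ∈
      Ideal.span {(1 - single c₁ 1 : AddMonoidAlgebra (ZMod p) A)} ⊔ Ideal.span {1 - single c₂ 1} := by
    intro x
    obtain ⟨k, l, rfl⟩ := hc x
    rw [single_mul_one_sub]
    exact Ideal.add_mem _
      (one_sub_single_nsmul_mem p (Ideal.mem_sup_left (Ideal.mem_span_singleton_self _)) _)
      (Ideal.mul_mem_left _ _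
        (one_sub_single_nsmul_mem p (Ideal.mem_sup_right (Ideal.mem_span_singleton_self _)) _))
  have h1 := diffProd_mem_pow p hJ S
  rwa [sup_pow_eq_bot (span_one_sub_single_pow p h₁) (span_one_sub_single_pow p h₂) (by omega),
    Ideal.mem_bot] at h1

theorem diffProd_eq_zero_of_three_generators {c₁ c₂ c₃ : A} (h₁ : p • c₁ = 0) (h₂ : p • c₂ = 0)
    (h₃ : p • c₃ = 0) (hc : ∀ x : A, ∃ k l i : ℕ, x = k • c₁ + l • c₂ + i • c₃)
    {S : Multiset A} (h : 3 * p - 2 ≤ card S) : diffProd p S = 0 := by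
  have hJ : ∀ x : A, 1 - single x 1 ∈
      (Ideal.span {(1 - single c₁ 1 : AddMonoidAlgebra (ZMod p) A)} ⊔ Ideal.span {1 - single c₂ 1}) ⊔
        Ideal.span {1 - single c₃ 1} := by
    intro x
    obtain ⟨k, l, i, rfl⟩ := hc x
    rw [single_mul_one_sub, single_mul_one_sub]
    exact Ideal.add_mem _ (Ideal.mem_sup_left <| Ideal.add_mem _
      (one_sub_single_nsmul_mem p (Ideal.mem_sup_left (Ideal.mem_span_singleton_self _)) _)
      (Ideal.mul_mem_left _ _
        (one_sub_single_nsmul_mem p (Ideal.mem_sup_right (Ideal.mem_span_singleton_self _)) _)))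
      (Ideal.mul_mem_left _ _
        (one_sub_single_nsmul_mem p (Ideal.mem_sup_right (Ideal.mem_span_singleton_self _)) _))
  have h1 := diffProd_mem_pow p hJ S
  have hp := (Fact.out : p.Prime).one_lt
  rwa [sup_pow_eq_bot (sup_pow_eq_bot (n := 2 * p - 1) (span_one_sub_single_pow p h₁)
    (span_one_sub_single_pow p h₂) (by omega)) (span_one_sub_single_pow p h₃) (by omega),
    Ideal.mem_bot] at h1

end GroupRing

/-! ### Davenport constant and short zero-sum subsequences for prime modulus -/

section Davenport

/-- Every sequence of length `2q - 1` has a nonempty zero-sum subsequence. -/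
def DavenportBound (q : ℕ) : Prop :=
  ∀ S : Multiset (ZMod q × ZMod q), 2 * q - 1 ≤ card S → ∃ T ≤ S, T ≠ 0 ∧ T.sum = 0

/-- Every sequence of length `3q - 2` has a nonempty zero-sum subsequence of length at most
`q`. -/
def EtaBound (q : ℕ) : Prop :=
  ∀ S : Multiset (ZMod q × ZMod q), 3 * q - 2 ≤ card S →
    ∃ T ≤ S, T ≠ 0 ∧ T.sum = 0 ∧ card T ≤ q

theorem not_zeroSumFree {A : Type*} [AddCommGroup A] {S : Multiset A} (h : ¬ ZeroSumFree S) :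
    ∃ T ≤ S, T ≠ 0 ∧ T.sum = 0 := by
  simp only [ZeroSumFree, not_forall, not_not] at h
  obtain ⟨T, h1, h2, h3⟩ := h
  exact ⟨T, h1, h2, h3⟩

theorem davenportBound_prime (p : ℕ) (hp : p.Prime) : DavenportBound p := by
  intro S hS
  have : Fact p.Prime := ⟨hp⟩
  apply not_zeroSumFree
  intro h
  have h1 := coeff_diffProd_zero p h
  rw [diffProd_eq_zero_of_two_generators p (c₁ := ((1, 0) : ZMod p × ZMod p)) (c₂ := (0, 1))
    (by simp) (by simp) (fun x => ⟨x.1.val, x.2.val, by ext <;> simp⟩) hS] at h1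
  simp at h1

theorem sub_one_cons_split {q : ℕ} (hD : DavenportBound q) (hq : 0 < q)
    {S : Multiset (ZMod q × ZMod q)} (hc : card S = 2 * q) :
    ∃ T ≤ S, T ≠ 0 ∧ T.sum = 0 ∧ T ≠ S := by
  obtain ⟨T, hT, hTc⟩ := exists_le_card_eq (S := S) (k := 2 * q - 1) (by omega)
  obtain ⟨U, hU, h0, hs⟩ := hD T hTc.ge
  refine ⟨U, hU.trans hT, h0, hs, ?_⟩
  rintro rfl
  have := card_le_card hU
  omega

/-- Appending a third coordinate `1` to each term moves the problem to `C_p³`, where a zero-sum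
subsequence automatically has length divisible by `p`. -/
theorem etaBound_prime (p : ℕ) (hp : p.Prime) : EtaBound p := by
  classical
  intro S hS
  have : Fact p.Prime := ⟨hp⟩
  -- Cutting down to exactly `3p - 2` terms leaves only the lengths `p` and `2p`.
  obtain ⟨S', hS', hc⟩ := exists_le_card_eq hS
  have h : ¬ ZeroSumFree (S'.map fun x => (x, (1 : ZMod p))) := by
    intro h
    have h1 := coeff_diffProd_zero p h
    rw [diffProd_eq_zero_of_three_generators p
      (c₁ := (((1, 0), 0) : (ZMod p × ZMod p) × ZMod p)) (c₂ := ((0, 1), 0)) (c₃ := ((0, 0), 1))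
      (by simp) (by simp) (by simp)
      (fun x => ⟨x.1.1.val, x.1.2.val, x.2.val, by ext <;> simp⟩) (by simp [hc])] at h1
    simp at h1
  obtain ⟨T, hT, hT0, hTs⟩ := not_zeroSumFree h
  obtain ⟨U, hU, rfl⟩ := exists_le_of_le_map hT
  have hU0 : U ≠ 0 := by rintro rfl; simp at hT0
  have hsum : U.sum = 0 := by
    have := congrArg Prod.fst hTs
    rw [← AddMonoidHom.coe_fst, map_multiset_sum] at this
    simpa using this
  have hcard : p ∣ card U := by
    have := congrArg Prod.snd hTs
    rw [← AddMonoidHom.coe_snd, map_multiset_sum] at this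
    rw [← ZMod.natCast_eq_zero_iff]
    simpa using this
  obtain ⟨k, hk⟩ := hcard
  have h2 := card_le_card hU
  have hp2 := hp.two_le
  have hk0 : k ≠ 0 := by rintro rfl; simp at hk; exact hU0 hk
  have hk3 : k < 3 := by
    by_contra h3
    have : p * 3 ≤ p * k := Nat.mul_le_mul_left p (by omega)
    omega
  have hk' : k = 1 ∨ k = 2 := by omega
  rcases hk' with rfl | rfl
  · exact ⟨U, hU.trans hS', hU0, hsum, by omega⟩
  -- Length `2p` exceeds the Davenport bound, so `U` splits into two zero-sum parts, one of which
  -- has length at most `p`.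
  · obtain ⟨X, hX, hX0, hXs, hne⟩ := sub_one_cons_split (davenportBound_prime p hp) hp.pos
      (show card U = 2 * p by omega)
    by_cases hXc : card X ≤ p
    · exact ⟨X, hX.trans (hU.trans hS'), hX0, hXs, hXc⟩
    · refine ⟨U - X, (Multiset.sub_le_self _ _).trans (hU.trans hS'), ?_, ?_, ?_⟩
      · intro h0
        exact hne (le_antisymm hX (tsub_eq_zero_iff_le.1 h0))
      · have := congrArg Multiset.sum (Multiset.sub_add_cancel hX)
        rw [Multiset.sum_add, hXs, hsum, add_zero] at this
        exact this
      · rw [card_sub hX]; omega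

end Davenport

end ZeroSum

/-! ### Levels `N ∣ Q`, multiplicativity of the bounds, absence of short zero-sums -/

namespace ZeroSum

open Multiset

/-- Reduction modulo a divisor `N` of `Q`, in both coordinates. -/
def level {N Q : ℕ} (h : N ∣ Q) : ZMod Q × ZMod Q →+ ZMod N × ZMod N :=
  ((ZMod.castHom h (ZMod N)).prodMap (ZMod.castHom h (ZMod N))).toAddMonoidHom

theorem level_apply {N Q : ℕ} (h : N ∣ Q) (x : ZMod Q × ZMod Q) :
    level h x = (ZMod.castHom h (ZMod N) x.1, ZMod.castHom h (ZMod N) x.2) := rfl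

theorem level_level {L N Q : ℕ} (h : L ∣ N) (h' : N ∣ Q) (x : ZMod Q × ZMod Q) :
    level h (level h' x) = level (h.trans h') x := by
  have key : ∀ y : ZMod Q, ZMod.castHom h (ZMod L) (ZMod.castHom h' (ZMod N) y) =
      ZMod.castHom (h.trans h') (ZMod L) y := fun y => by
    obtain ⟨k, rfl⟩ := ZMod.intCast_surjective y
    simp only [map_intCast]
  ext
  · exact key x.1
  · exact key x.2

theorem level_eq_zero_iff {N M Q : ℕ} (h : Q = N * M) (hQ : Q ≠ 0) (x : ZMod Q × ZMod Q) :
    level (Dvd.intro M h.symm) x = 0 ↔ ∃ y : ZMod Q × ZMod Q, x = N • y := by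
  have key : ∀ z : ZMod Q, ZMod.castHom (Dvd.intro M h.symm) (ZMod N) z = 0 ↔
      ∃ y : ZMod Q, z = N • y := fun z => by
    constructor
    · intro hz
      have : NeZero Q := ⟨hQ⟩
      rw [← ZMod.natCast_zmod_val z, map_natCast, ZMod.natCast_eq_zero_iff] at hz
      obtain ⟨k, hk⟩ := hz
      exact ⟨k, by rw [← ZMod.natCast_zmod_val z, hk]; push_cast; simp [nsmul_eq_mul]⟩
    · rintro ⟨y, rfl⟩
      rw [_root_.map_nsmul, nsmul_eq_mul, ZMod.natCast_self, zero_mul]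
  rw [level_apply, Prod.mk_eq_zero, key, key]
  constructor
  · rintro ⟨⟨a, ha⟩, ⟨b, hb⟩⟩
    exact ⟨(a, b), Prod.ext ha hb⟩
  · rintro ⟨y, rfl⟩
    exact ⟨⟨y.1, by simp⟩, ⟨y.2, by simp⟩⟩

/-- The embedding `x ↦ N x` of the group of level `M` into the group of level `Q = N M`. -/
def embed {N M Q : ℕ} (h : Q = N * M) : ZMod M × ZMod M →+ ZMod Q × ZMod Q :=
  let f : ZMod M →+ ZMod Q := ZMod.lift M
    ⟨(AddMonoidHom.mulLeft (N : ZMod Q)).comp (Int.castAddHom (ZMod Q)), by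
      have : ((N * M : ℕ) : ZMod Q) = 0 := by rw [← h]; exact ZMod.natCast_self Q
      simpa using this⟩
  f.prodMap f

theorem embed_intCast {N M Q : ℕ} (h : Q = N * M) (a b : ℤ) :
    embed h ((a : ZMod M), (b : ZMod M)) = ((N : ZMod Q) * a, (N : ZMod Q) * b) := by
  simp [embed]

theorem exists_intCast_pair {M : ℕ} (x : ZMod M × ZMod M) :
    ∃ a b : ℤ, x = ((a : ZMod M), (b : ZMod M)) := by
  obtain ⟨a, ha⟩ := ZMod.intCast_surjective x.1
  obtain ⟨b, hb⟩ := ZMod.intCast_surjective x.2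
  exact ⟨a, b, by ext <;> simp [ha, hb]⟩

theorem embed_level {N M Q : ℕ} (h : Q = N * M) (x : ZMod Q × ZMod Q) :
    embed h (level (Dvd.intro_left N h.symm) x) = N • x := by
  obtain ⟨a, b, rfl⟩ := exists_intCast_pair x
  have : level (Dvd.intro_left N h.symm) ((a : ZMod Q), (b : ZMod Q)) =
      ((a : ZMod M), (b : ZMod M)) := by simp [level_apply]
  rw [this, embed_intCast]
  ext <;> simp

theorem embed_injective {N M Q : ℕ} (h : Q = N * M) (hN : N ≠ 0) :
    Function.Injective (embed h) := by
  rw [injective_iff_map_eq_zero]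
  intro x hx
  obtain ⟨a, b, rfl⟩ := exists_intCast_pair x
  rw [embed_intCast, Prod.mk_eq_zero] at hx
  have key : ∀ c : ℤ, (N : ZMod Q) * c = 0 → (c : ZMod M) = 0 := fun c hc => by
    have h1 : ((N * c : ℤ) : ZMod Q) = 0 := by push_cast; exact hc
    rw [ZMod.intCast_zmod_eq_zero_iff_dvd, h] at h1
    push_cast at h1
    rw [ZMod.intCast_zmod_eq_zero_iff_dvd]
    exact (mul_dvd_mul_iff_left (by exact_mod_cast hN)).1 h1
  rw [Prod.mk_eq_zero]
  exact ⟨key a hx.1, key b hx.2⟩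

theorem exists_embed_eq {N M Q : ℕ} (h : Q = N * M) (hQ : Q ≠ 0) {x : ZMod Q × ZMod Q}
    (hx : level (Dvd.intro M h.symm) x = 0) : ∃ y, embed h y = x := by
  obtain ⟨y, rfl⟩ := (level_eq_zero_iff h hQ x).1 hx
  exact ⟨_, embed_level h y⟩

/-- Each extraction needs `3N - 2` available terms and consumes at most `N` of them, whence the
threshold `(k + 2)N - 2` for `k` blocks. -/
theorem exists_blocks {N : ℕ} (hη : EtaBound N) {G : Type*} [AddCommGroup G]
    (π : G →+ ZMod N × ZMod N) (k : ℕ) (S : Multiset G) (hS : (k + 2) * N ≤ card S + 2) :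
    ∃ Bs : Multiset (Multiset G), card Bs = k ∧ Bs.join ≤ S ∧
      ∀ B ∈ Bs, B ≠ 0 ∧ π B.sum = 0 ∧ card B ≤ N := by
  classical
  induction k generalizing S with
  | zero => exact ⟨0, by simp⟩
  | succ k ih =>
    obtain ⟨T, hT, hT0, hTs, hTc⟩ := hη (S.map π) (by
      rw [card_map]
      have : (k + 1 + 2) * N = k * N + 3 * N := by ring
      omega)
    obtain ⟨B, hB, rfl⟩ := exists_le_of_le_map hT
    rw [card_map] at hTc
    have h1 := Multiset.sub_add_cancel hB
    have hc := card_sub hB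
    have hcB := card_le_card hB
    obtain ⟨Bs, h2, h3, h4⟩ := ih (S - B) (by
      have : (k + 1 + 2) * N = (k + 2) * N + N := by ring
      omega)
    refine ⟨B ::ₘ Bs, by simp [h2], ?_, ?_⟩
    · rw [join_cons, ← h1, add_comm]
      gcongr
    · intro C hC
      rcases mem_cons.1 hC with rfl | hC
      · refine ⟨by rintro rfl; simp at hT0, ?_, hTc⟩
        rw [map_multiset_sum]; exact hTs
      · exact h4 C hC

theorem card_join_le {G : Type*} {Bs : Multiset (Multiset G)} {N : ℕ}
    (h : ∀ B ∈ Bs, card B ≤ N) : card Bs.join ≤ card Bs * N := by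
  rw [card_join]
  have := Multiset.sum_le_card_nsmul (Bs.map card) N (by
    intro x hx
    obtain ⟨B, hB, rfl⟩ := mem_map.1 hx
    exact h B hB)
  simpa using this

theorem join_mono {G : Type*} {Bs Cs : Multiset (Multiset G)} (h : Bs ≤ Cs) :
    Bs.join ≤ Cs.join := by
  obtain ⟨Ds, rfl⟩ := Multiset.le_iff_exists_add.1 h
  rw [join_add]
  exact Multiset.le_add_right _ _

theorem join_ne_zero {G : Type*} {Bs : Multiset (Multiset G)} (h : Bs ≠ 0)
    (h' : ∀ B ∈ Bs, B ≠ 0) : Bs.join ≠ 0 := by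
  obtain ⟨B, hB⟩ := exists_mem_of_ne_zero h
  obtain ⟨x, hx⟩ := exists_mem_of_ne_zero (h' B hB)
  intro h0
  have : x ∈ Bs.join := mem_join.2 ⟨B, hB, hx⟩
  simp [h0] at this

theorem exists_preimages {N M Q : ℕ} (h : Q = N * M) (hQ : Q ≠ 0)
    (Bs : Multiset (Multiset (ZMod Q × ZMod Q)))
    (hB : ∀ B ∈ Bs, level (Dvd.intro M h.symm) B.sum = 0) :
    ∃ f : Multiset (ZMod Q × ZMod Q) → ZMod M × ZMod M, ∀ B ∈ Bs, embed h (f B) = B.sum := by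
  have : ∀ B, ∃ y, B ∈ Bs → embed h y = B.sum := fun B => by
    by_cases hBs : B ∈ Bs
    · obtain ⟨y, hy⟩ := exists_embed_eq h hQ (hB B hBs)
      exact ⟨y, fun _ => hy⟩
    · exact ⟨0, fun h' => absurd h' hBs⟩
  choose f hf using this
  exact ⟨f, hf⟩

theorem sum_join_eq_embed {N M Q : ℕ} (h : Q = N * M)
    {f : Multiset (ZMod Q × ZMod Q) → ZMod M × ZMod M}
    {Bs : Multiset (Multiset (ZMod Q × ZMod Q))} (hf : ∀ B ∈ Bs, embed h (f B) = B.sum) :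
    Bs.join.sum = embed h (Bs.map f).sum := by
  rw [sum_join, map_multiset_sum, Multiset.map_map]
  exact congrArg _ (map_congr rfl fun B hB => (hf B hB).symm)

/-- The block sums lie in the multiples of `N`, a copy of the group of level `M`, so the Davenport
bound of level `M` applies to the blocks as if they were terms. -/
theorem exists_zeroSum_blocks {N M Q : ℕ} (hD : DavenportBound M) (h : Q = N * M) (hQ : Q ≠ 0)
    (Bs : Multiset (Multiset (ZMod Q × ZMod Q)))
    (hB : ∀ B ∈ Bs, level (Dvd.intro M h.symm) B.sum = 0) (hc : 2 * M - 1 ≤ card Bs) :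
    ∃ Cs ≤ Bs, Cs ≠ 0 ∧ Cs.join.sum = 0 := by
  obtain ⟨f, hf⟩ := exists_preimages h hQ Bs hB
  obtain ⟨T, hT, hT0, hTs⟩ := hD (Bs.map f) (by simpa using hc)
  obtain ⟨Cs, hCs, rfl⟩ := exists_le_of_le_map hT
  refine ⟨Cs, hCs, by rintro rfl; simp at hT0, ?_⟩
  rw [sum_join_eq_embed h fun B hB => hf B (mem_of_le hCs hB), hTs, _root_.map_zero]

/-- Short extractions give all blocks but one. The remaining terms are just enough for the Davenport
bound at level `N` to supply the last, and with `2M - 1` blocks some of them sum to zero. -/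
theorem DavenportBound.mul {N M : ℕ} (hN : 0 < N) (hM : 0 < M) (hη : EtaBound N)
    (hD : DavenportBound N) (hD' : DavenportBound M) : DavenportBound (N * M) := by
  classical
  intro S hS
  have hQ : N * M ≠ 0 := (Nat.mul_pos hN hM).ne'
  obtain ⟨M, rfl⟩ : ∃ k, M = k + 1 := ⟨M - 1, by omega⟩
  have e : N * (M + 1) = N * M + N := by ring
  obtain ⟨Bs, h1, h2, h3⟩ := exists_blocks hη
    (level (Dvd.intro (M + 1) rfl : N ∣ N * (M + 1))) (2 * M) S (by
      have : (2 * M + 2) * N = 2 * (N * (M + 1)) := by ring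
      omega)
  have h4 := card_join_le fun B hB => (h3 B hB).2.2
  have h5 := Multiset.sub_add_cancel h2
  have h6 := card_sub h2
  rw [h1] at h4
  obtain ⟨T, hT, hT0, hTs⟩ := hD ((S - Bs.join).map
    (level (Dvd.intro (M + 1) rfl : N ∣ N * (M + 1)))) (by
      rw [card_map]
      have : 2 * M * N = 2 * (N * M) := by ring
      omega)
  obtain ⟨B, hB, rfl⟩ := exists_le_of_le_map hT
  obtain ⟨Cs, hCs, hCs0, hCsum⟩ := exists_zeroSum_blocks hD' rfl hQ (B ::ₘ Bs) (by
    intro C hC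
    rcases mem_cons.1 hC with rfl | hC
    · rw [map_multiset_sum]; exact hTs
    · exact (h3 C hC).2.1) (by simp [h1]; omega)
  refine ⟨Cs.join, (join_mono hCs).trans ?_, join_ne_zero hCs0 ?_, hCsum⟩
  · rw [join_cons, ← h5]
    gcongr
  · intro C hC
    rcases mem_cons.1 (mem_of_le hCs hC) with rfl | hC
    · rintro rfl; simp at hT0
    · exact (h3 C hC).1

/-- All `3M - 2` blocks have length at most `N`, and at most `M` of them are combined. -/
theorem EtaBound.mul {N M : ℕ} (hN : 0 < N) (hM : 0 < M) (hη : EtaBound N)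
    (hη' : EtaBound M) : EtaBound (N * M) := by
  classical
  intro S hS
  have hQ : N * M ≠ 0 := (Nat.mul_pos hN hM).ne'
  obtain ⟨Bs, h1, h2, h3⟩ := exists_blocks hη
    (level (Dvd.intro M rfl : N ∣ N * M)) (3 * M - 2) S (by
      have : 3 * M - 2 + 2 = 3 * M := by omega
      rw [this]
      have : (3 * M) * N = 3 * (N * M) := by ring
      omega)
  obtain ⟨f, hf⟩ := exists_preimages rfl hQ Bs fun B hB => (h3 B hB).2.1
  obtain ⟨T, hT, hT0, hTs, hTc⟩ := hη' (Bs.map f) (by simp [h1])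
  obtain ⟨Cs, hCs, rfl⟩ := exists_le_of_le_map hT
  rw [card_map] at hTc
  refine ⟨Cs.join, (join_mono hCs).trans h2, join_ne_zero (by rintro rfl; simp at hT0) ?_, ?_, ?_⟩
  · exact fun B hB => (h3 B (mem_of_le hCs hB)).1
  · rw [sum_join_eq_embed rfl fun B hB => hf B (mem_of_le hCs hB), hTs, _root_.map_zero]
  · calc _ ≤ card Cs * N := card_join_le fun B hB => (h3 B (mem_of_le hCs hB)).2.2
      _ ≤ M * N := by gcongr
      _ = N * M := mul_comm _ _

theorem davenportBound_and_etaBound (q : ℕ) (hq : 0 < q) : DavenportBound q ∧ EtaBound q := by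
  induction q using Nat.recOnMul with
  | zero => omega
  | one =>
    have h1 : ∀ S : Multiset (ZMod 1 × ZMod 1), S.sum = 0 := fun S => Subsingleton.elim _ _
    constructor
    · intro S hS
      exact ⟨S, le_rfl, by rintro rfl; simp at hS, h1 S⟩
    · intro S hS
      obtain ⟨T, hT, hc⟩ := exists_le_card_eq (S := S) (k := 1) (by omega)
      exact ⟨T, hT, by rintro rfl; simp at hc, h1 T, hc.le⟩
  | prime p hp => exact ⟨davenportBound_prime p hp, etaBound_prime p hp⟩
  | mul a b iha ihb =>
    have ha : 0 < a := Nat.pos_of_mul_pos_right hq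
    have hb : 0 < b := Nat.pos_of_mul_pos_left hq
    obtain ⟨a1, a2⟩ := iha ha
    obtain ⟨b1, b2⟩ := ihb hb
    exact ⟨DavenportBound.mul ha hb a2 a1 b1, EtaBound.mul ha hb a2 b2⟩

/-- All nonempty zero-sum subsequences have length at least `q`. -/
def NoShort {G : Type*} [AddCommGroup G] (q : ℕ) (T : Multiset G) : Prop :=
  ∀ Y ≤ T, Y ≠ 0 → Y.sum = 0 → q ≤ card Y

theorem IsMinimalZeroSum.ne_zero_of_lt {G : Type*} [AddCommGroup G] {S T : Multiset G}
    (h : IsMinimalZeroSum S) (hT : T ≤ S) (h0 : T ≠ 0) (hc : card T < card S) : T.sum ≠ 0 :=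
  h.2.2 T hT (card_pos.2 h0) hc T le_rfl h0

/-- A subsequence `Y` of fewer than `N` terms with zero image would be an unusually cheap block.
Completing it to `2M - 1` blocks would still leave a term of `S` unused, and a zero-sum combination
of blocks would contradict minimality. -/
theorem noShort_level {N M Q : ℕ} (h : Q = N * M) (hQ : Q ≠ 0)
    {S : Multiset (ZMod Q × ZMod Q)} (hS : IsMinimalZeroSum S) (hc : card S = 2 * Q - 1) :
    NoShort N (S.map (level (Dvd.intro M h.symm))) := by
  classical
  have hN : 0 < N := Nat.pos_of_ne_zero (by rintro rfl; simp [h] at hQ)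
  have hM : 0 < M := Nat.pos_of_ne_zero (by rintro rfl; simp [h] at hQ)
  obtain ⟨hD, hη⟩ := davenportBound_and_etaBound N hN
  obtain ⟨hD', -⟩ := davenportBound_and_etaBound M hM
  intro Y' hY' hY0' hYs
  obtain ⟨Y, hY, rfl⟩ := exists_le_of_le_map hY'
  rw [card_map]
  rw [← map_multiset_sum] at hYs
  have hY0 : Y ≠ 0 := by rintro rfl; simp at hY0'
  by_contra hlt
  rw [not_le] at hlt
  have hYc := card_sub hY
  have hYa := Multiset.sub_add_cancel hY
  have hcY := card_le_card hY
  rcases Nat.lt_or_ge M 2 with hM1 | hM2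
  · obtain rfl : M = 1 := by omega
    rw [mul_one] at h
    subst h
    have h1 : ∀ x : ZMod Q × ZMod Q, level (Dvd.intro 1 (mul_one Q)) x = x := fun x => by
      obtain ⟨a, b, rfl⟩ := exists_intCast_pair x
      simp [level_apply]
    refine hS.ne_zero_of_lt hY hY0 (by omega) ?_
    rw [← h1 Y.sum]; exact hYs
  obtain ⟨k, rfl⟩ : ∃ k, M = k + 2 := ⟨M - 2, by omega⟩
  obtain ⟨Bs, h1, h2, h3⟩ := exists_blocks hη (level (Dvd.intro (k + 2) h.symm)) (2 * k + 1)
    (S - Y) (by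
      have : (2 * k + 1 + 2) * N + N = 2 * Q := by rw [h]; ring
      omega)
  have h4 := card_join_le fun B hB => (h3 B hB).2.2
  have h5 := Multiset.sub_add_cancel h2
  have h6 := card_sub h2
  have h7 := card_le_card h2
  rw [h1] at h4
  -- One term more than the `2N - 1` needed for the last block: this spare term makes the final
  -- subsequence proper.
  have hbig : 2 * N ≤ card (S - Y - Bs.join) := by
    have : (2 * k + 1) * N + 2 * N + N = 2 * Q := by rw [h]; ring
    omega
  obtain ⟨R, hR, hRc⟩ := exists_le_card_eq (S := S - Y - Bs.join) (k := 2 * N - 1) (by omega)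
  obtain ⟨T, hT, hT0, hTs⟩ := hD (R.map (level (Dvd.intro (k + 2) h.symm))) (by simp [hRc])
  obtain ⟨B, hB, rfl⟩ := exists_le_of_le_map hT
  have hBc := card_le_card hB
  obtain ⟨Cs, hCs, hCs0, hCsum⟩ := exists_zeroSum_blocks hD' h hQ (Y ::ₘ B ::ₘ Bs) (by
    intro C hC
    rcases mem_cons.1 hC with rfl | hC
    · exact hYs
    rcases mem_cons.1 hC with rfl | hC
    · rw [map_multiset_sum]; exact hTs
    · exact (h3 C hC).2.1) (by simp [h1]; omega)
  have hle : (Y ::ₘ B ::ₘ Bs).join ≤ S := by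
    rw [join_cons, join_cons, ← hYa, add_comm Y]
    gcongr
    rw [← h5]
    gcongr
    exact hB.trans hR
  have hlt' : card (Y ::ₘ B ::ₘ Bs).join < card S := by
    rw [join_cons, join_cons, card_add, card_add]
    omega
  refine hS.ne_zero_of_lt ((join_mono hCs).trans hle) (join_ne_zero hCs0 ?_)
    ((card_le_card (join_mono hCs)).trans_lt hlt') hCsum
  intro C hC
  rcases mem_cons.1 (mem_of_le hCs hC) with rfl | hC
  · exact hY0
  rcases mem_cons.1 hC with rfl | hC
  · rintro rfl; simp at hT0
  · exact (h3 C hC).1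

end ZeroSum

/-! ### Linear functionals attached to zero-sum free sequences of maximal length -/

namespace ZeroSum

open Multiset hiding map_add map_nsmul map_zero

theorem zeroSumFree_map {ι G : Type*} [AddCommGroup G] {x : ι → G} {s : Finset ι}
    (h : ∀ t ⊆ s, t.Nonempty → ∑ i ∈ t, x i ≠ 0) : ZeroSumFree (s.val.map x) := by
  intro T hT hT0 hTs
  obtain ⟨t, ht, rfl⟩ := exists_le_of_le_map hT
  let t' : Finset ι := ⟨t, Multiset.nodup_of_le ht s.nodup⟩
  refine h t' (Finset.val_le_iff.1 ht) ?_ hTs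
  rw [Finset.nonempty_iff_ne_empty]
  rintro h0
  have : t = 0 := congrArg Finset.val h0
  simp [this] at hT0

theorem zeroSumFree_cons_map {ι G : Type*} [AddCommGroup G] {x : ι → G} {s : Finset ι} {y : G}
    (h : ∀ t ⊆ s, t.Nonempty → ∑ i ∈ t, x i ≠ 0) (h' : ∀ t ⊆ s, y + ∑ i ∈ t, x i ≠ 0) :
    ZeroSumFree (y ::ₘ s.val.map x) := by
  classical
  intro T hT hT0 hTs
  by_cases hy : y ∈ T
  · have h1 : T.erase y ≤ s.val.map x := by simpa using Multiset.erase_le_erase y hT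
    obtain ⟨t, ht, e⟩ := exists_le_of_le_map h1
    let t' : Finset ι := ⟨t, Multiset.nodup_of_le ht s.nodup⟩
    refine h' t' (Finset.val_le_iff.1 ht) ?_
    rw [← cons_erase hy, sum_cons, ← e] at hTs
    exact hTs
  · exact zeroSumFree_map h T ((le_cons_of_notMem hy).1 hT) hT0 hTs

section Functionals

variable {ι : Type*} [DecidableEq ι]

/-- Multiplying the coefficient at each `a` by `ψ a` is a derivation of the group ring. The formula
is its Leibniz rule on the product, the derivative of `1 - X^x` being `-ψ(x) X^x`. -/
theorem coeff_diffProd_derivation (p : ℕ) [Fact p.Prime] {A : Type*} [AddCommGroup A]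
    (ψ : A →+ ZMod p) (x : ι → A) (s : Finset ι) (a : A) :
    ψ a * (diffProd p (s.val.map x)).coeff a =
      -∑ i ∈ s, ψ (x i) * (diffProd p ((s.erase i).val.map x)).coeff (a - x i) := by
  induction s using Finset.induction_on generalizing a with
  | empty =>
    classical
    simp only [Finset.empty_val, Multiset.map_zero, diffProd_zero, Finset.sum_empty, neg_zero,
      AddMonoidAlgebra.one_def, AddMonoidAlgebra.coeff_single, Finsupp.single_apply]
    split_ifs with h
    · simp [← h]
    · simp
  | insert j s hj ih =>
    have e : ∀ i ∈ s, (diffProd p (((insert j s).erase i).val.map x)).coeff (a - x i) =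
        (diffProd p ((s.erase i).val.map x)).coeff (a - x i) -
          (diffProd p ((s.erase i).val.map x)).coeff (a - x j - x i) := fun i hi => by
      have hij : j ≠ i := by rintro rfl; exact hj hi
      rw [Finset.erase_insert_of_ne hij, Finset.insert_val_of_notMem
        (by simp [hj]), map_cons, diffProd_cons, coeff_one_sub_single_mul, sub_right_comm]
    rw [Finset.sum_insert hj, Finset.erase_insert hj,
      Finset.sum_congr rfl fun i hi => by rw [e i hi],
      Finset.insert_val_of_notMem hj, map_cons, diffProd_cons, coeff_one_sub_single_mul]
    simp only [mul_sub, Finset.sum_sub_distrib]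
    have h1 := ih a
    have h2 := ih (a - x j)
    rw [map_sub] at h2
    linear_combination h1 - h2

/-- Omitting one of the `2p - 2` factors leaves a product whose coefficients form an affine function
with value `1` at `0`; `lam i` is its linear part. It equals `1` at every `y` that can replace `x i`
without destroying zero-sum freeness. The identity is the Leibniz rule applied to the full product,
whose coefficients are all `1`. -/
theorem exists_functionals_prime (p : ℕ) (hp : p.Prime) [Fintype ι] (hι : Fintype.card ι = 2 * p - 2)
    (x : ι → ZMod p × ZMod p)
    (hx : ∀ t : Finset ι, t.Nonempty → ∑ i ∈ t, x i ≠ 0) :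
    ∃ lam : ι → (ZMod p × ZMod p →+ ZMod p),
      (∀ i y, (∀ t : Finset ι, i ∉ t → y + ∑ j ∈ t, x j ≠ 0) → lam i y = 1) ∧
      ∀ z, ∑ i, lam i z • x i = -z := by
  have : Fact p.Prime := ⟨hp⟩
  have hp2 := hp.two_le
  have vanish : ∀ S : Multiset (ZMod p × ZMod p), 2 * p - 1 ≤ card S → diffProd p S = 0 :=
    fun S hS => diffProd_eq_zero_of_two_generators p (c₁ := ((1, 0) : ZMod p × ZMod p))
      (c₂ := (0, 1)) (by simp) (by simp) (fun x => ⟨x.1.val, x.2.val, by ext <;> simp⟩) hS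
  let P : ι → Multiset (ZMod p × ZMod p) := fun i => (Finset.univ.erase i).val.map x
  have hP : ∀ i, card (P i) = 2 * p - 3 := fun i => by
    simp only [P, card_map, Finset.card_val, Finset.card_erase_of_mem (Finset.mem_univ i),
      Finset.card_univ, hι]
    omega
  -- One more factor `1 - X^a` kills the product, so its coefficients are invariant under
  -- translation by `a`.
  have const : ∀ S : Multiset (ZMod p × ZMod p), card S = 2 * p - 2 → ∀ a,
      (diffProd p S).coeff a = (diffProd p S).coeff 0 := fun S hS a => by
    have := vanish (a ::ₘ S) (by rw [card_cons]; omega)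
    rw [diffProd_cons] at this
    have := congrArg (fun f => f.coeff a) this
    simp only [coeff_one_sub_single_mul, sub_self] at this
    simpa [sub_eq_zero] using this
  have g0 : ∀ i, (diffProd p (P i)).coeff 0 = 1 := fun i =>
    coeff_diffProd_zero p (zeroSumFree_map fun t _ ht => hx t ht)
  -- Two more factors kill the product of `2p - 3` factors, so its coefficient function has
  -- vanishing second differences.
  let lam : ι → (ZMod p × ZMod p →+ ZMod p) := fun i =>
    AddMonoidHom.mk' (fun a => (diffProd p (P i)).coeff a - 1) (by
      intro y z
      have := vanish (y ::ₘ z ::ₘ P i) (by rw [card_cons, card_cons, hP]; omega)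
      rw [diffProd_cons, diffProd_cons] at this
      have := congrArg (fun f => f.coeff (y + z)) this
      simp only [coeff_one_sub_single_mul, add_sub_cancel_left, add_sub_cancel_right, sub_self, g0]
        at this
      have h0 : (0 : AddMonoidAlgebra (ZMod p) (ZMod p × ZMod p)).coeff (y + z) = 0 := by simp
      rw [h0] at this
      linear_combination this)
  have hlam : ∀ i a, lam i a = (diffProd p (P i)).coeff a - 1 := fun i a => rfl
  refine ⟨lam, ?_, ?_⟩
  · intro i y hy
    have h1 : ZeroSumFree (y ::ₘ P i) := zeroSumFree_cons_map (fun t _ ht => hx t ht)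
      fun t ht => hy t fun hi => by simpa using ht hi
    have h2 := const (y ::ₘ P i) (by rw [card_cons, hP]; omega) y
    rw [coeff_diffProd_zero p h1, diffProd_cons, coeff_one_sub_single_mul, sub_self, g0] at h2
    rw [hlam, h2]
  · have huniv : ∀ a, (diffProd p (Finset.univ.val.map x)).coeff a = 1 := fun a => by
      rw [const _ (by simp [hι]) a]
      exact coeff_diffProd_zero p (zeroSumFree_map fun t _ ht => hx t ht)
    have h1 : ∀ i, lam i (x i) = 1 := fun i => by
      have h3 := huniv (x i)
      have : (Finset.univ : Finset ι).val.map x = x i ::ₘ P i := by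
        rw [← map_cons, ← Finset.insert_val_of_notMem (Finset.notMem_erase i _),
          Finset.insert_erase (Finset.mem_univ i)]
      rw [this, diffProd_cons, coeff_one_sub_single_mul, sub_self, g0] at h3
      rw [hlam, h3]
    have key : ∀ (ψ : ZMod p × ZMod p →+ ZMod p) (z), ψ (∑ i, lam i z • x i) = ψ (-z) := by
      intro ψ z
      have h2 := coeff_diffProd_derivation p ψ x Finset.univ z
      rw [huniv, mul_one] at h2
      rw [map_neg, h2, neg_neg, map_sum]
      refine Finset.sum_congr rfl fun i _ => ?_
      have h3 : (diffProd p (P i)).coeff (z - x i) = lam i z := by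
        have := hlam i (z - x i)
        rw [map_sub, h1] at this
        linear_combination -this
      have h4 : lam i z • x i = (lam i z).val • x i := by
        rw [← Nat.cast_smul_eq_nsmul (ZMod p), ZMod.natCast_zmod_val]
      change _ = ψ (x i) * (diffProd p (P i)).coeff (z - x i)
      rw [h3, h4, _root_.map_nsmul, nsmul_eq_mul, ZMod.natCast_zmod_val, mul_comm]
    intro z
    ext
    · exact key (AddMonoidHom.fst _ _) z
    · exact key (AddMonoidHom.snd _ _) z

end Functionals

theorem smul_embed {N M Q : ℕ} (h : Q = N * M) (c : ZMod Q) (x : ZMod M × ZMod M) :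
    c • embed h x = embed h (ZMod.castHom (Dvd.intro_left N h.symm) (ZMod M) c • x) := by
  obtain ⟨a, b, rfl⟩ := exists_intCast_pair x
  obtain ⟨c, rfl⟩ := ZMod.intCast_surjective c
  rw [embed_intCast, map_intCast, Prod.smul_mk, Prod.smul_mk, smul_eq_mul, smul_eq_mul, smul_eq_mul,
    smul_eq_mul, ← Int.cast_mul, ← Int.cast_mul, embed_intCast]
  ext <;> push_cast <;> ring

theorem level_surjective {N Q : ℕ} (h : N ∣ Q) : Function.Surjective (level h) := by
  intro x
  obtain ⟨a, b, rfl⟩ := exists_intCast_pair x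
  exact ⟨((a : ZMod Q), (b : ZMod Q)), by simp [level_apply]⟩

theorem mul_eq_zero_iff_castHom {N M Q : ℕ} (h : Q = N * M) (hN : N ≠ 0) (c : ZMod Q) :
    (N : ZMod Q) * c = 0 ↔ ZMod.castHom (Dvd.intro_left N h.symm) (ZMod M) c = 0 := by
  obtain ⟨c, rfl⟩ := ZMod.intCast_surjective c
  rw [map_intCast, ZMod.intCast_zmod_eq_zero_iff_dvd]
  have : (N : ZMod Q) * (c : ZMod Q) = ((N * c : ℤ) : ZMod Q) := by push_cast; rfl
  rw [this, ZMod.intCast_zmod_eq_zero_iff_dvd, h]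
  push_cast
  exact mul_dvd_mul_iff_left (by exact_mod_cast hN)

/-- The linear functionals attached to a grouping of a minimal zero-sum sequence `W` into a
remainder `L` and `2p - 2` blocks `B i` whose sums vanish at level `N`. -/
theorem exists_functionals {N p Q : ℕ} (h : Q = N * p) (hN : N ≠ 0) (hp : p.Prime) {ι : Type*}
    [DecidableEq ι] [Fintype ι] (hι : Fintype.card ι = 2 * p - 2)
    {W L : Multiset (ZMod Q × ZMod Q)} {B : ι → Multiset (ZMod Q × ZMod Q)}
    (hW : IsMinimalZeroSum W) (hWB : W = L + ∑ i, B i) (hL : L ≠ 0) (hB0 : ∀ i, B i ≠ 0)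
    (hB : ∀ i, level (Dvd.intro p h.symm) (B i).sum = 0) :
    ∃ lam : ι → (ZMod Q × ZMod Q →ₗ[ZMod Q] ZMod Q),
      (∀ i, ∀ Ω ≤ L + B i, Ω ≠ 0 → Ω ≠ L + B i → level (Dvd.intro p h.symm) Ω.sum = 0 →
        lam i Ω.sum = N) ∧
      ∀ w, ∑ i, lam i w • (B i).sum = -(N • w) := by
  have hQ : Q ≠ 0 := by rw [h]; exact mul_ne_zero hN hp.ne_zero
  have hdvd : p ∣ Q := Dvd.intro_left N h.symm
  choose x hx using fun i => exists_embed_eq h hQ (hB i)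
  have hsum : ∀ t : Finset ι, embed h (∑ i ∈ t, x i) = (∑ i ∈ t, B i).sum := fun t => by
    rw [map_sum, Multiset.sum_sum]
    exact Finset.sum_congr rfl fun i _ => hx i
  have hfree : ∀ t : Finset ι, t.Nonempty → ∑ i ∈ t, x i ≠ 0 := fun t ht h0 => by
    have hle : ∑ i ∈ t, B i ≤ ∑ i, B i := Finset.sum_le_sum_of_subset (Finset.subset_univ t)
    have h1 := hsum t
    rw [h0, _root_.map_zero] at h1
    refine hW.ne_zero_of_lt (hle.trans ?_) ?_ ?_ h1.symm
    · rw [hWB]; exact Multiset.le_add_left _ _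
    · obtain ⟨i, hi⟩ := ht
      intro h2
      have := Finset.single_le_sum (f := B) (fun _ _ => Multiset.zero_le _) hi
      rw [h2] at this
      exact hB0 i (Multiset.le_zero.1 this)
    · have := card_le_card hle
      have := card_pos.2 hL
      rw [hWB, card_add]
      omega
  obtain ⟨mu, hmu, hid⟩ := exists_functionals_prime p hp hι x hfree
  have : NeZero p := ⟨hp.ne_zero⟩
  -- The lift from `ZMod p` to `ZMod Q` is arbitrary; only its values multiplied by `N` are
  -- determined.
  let lam : ι → (ZMod Q × ZMod Q →ₗ[ZMod Q] ZMod Q) := fun i =>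
    ((mu i (1, 0)).val : ZMod Q) • LinearMap.fst (ZMod Q) (ZMod Q) (ZMod Q) +
      ((mu i (0, 1)).val : ZMod Q) • LinearMap.snd (ZMod Q) (ZMod Q) (ZMod Q)
  have hlam : ∀ i w, ZMod.castHom hdvd (ZMod p) (lam i w) = mu i (level hdvd w) := fun i w => by
    have h1 : level hdvd w = (level hdvd w).1.val • (1, 0) + (level hdvd w).2.val • (0, 1) := by
      ext <;> simp
    rw [h1, map_add, _root_.map_nsmul, _root_.map_nsmul]
    simp only [lam, LinearMap.add_apply, LinearMap.smul_apply, LinearMap.fst_apply,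
      LinearMap.snd_apply, smul_eq_mul, map_add, map_mul, map_natCast, nsmul_eq_mul,
      ZMod.natCast_zmod_val, level_apply]
    ring
  refine ⟨lam, ?_, ?_⟩
  · intro i Ω hΩ hΩ0 hΩne hΩs
    obtain ⟨u, hu⟩ := exists_embed_eq h hQ hΩs
    obtain ⟨w, rfl⟩ := level_surjective hdvd u
    -- `Ω` may replace `B i`: together with other blocks it still forms a proper nonempty
    -- subsequence of the minimal sequence `W`.
    have h1 : mu i (level hdvd w) = 1 := by
      refine hmu i _ fun t hit h0 => ?_
      have h2 : (Ω + ∑ j ∈ t, B j).sum = 0 := by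
        rw [sum_add, ← hsum t, ← hu, ← map_add, h0, _root_.map_zero]
      have hle : B i + ∑ j ∈ t, B j ≤ ∑ j, B j := by
        rw [← Finset.sum_insert hit]
        exact Finset.sum_le_sum_of_subset (Finset.subset_univ _)
      refine hW.ne_zero_of_lt (T := Ω + ∑ j ∈ t, B j) ?_ ?_ ?_ h2
      · rw [hWB]
        calc _ ≤ L + B i + ∑ j ∈ t, B j := by gcongr
          _ ≤ _ := by rw [add_assoc]; gcongr
      · intro h3
        exact hΩ0 (Multiset.le_zero.1 (h3 ▸ Multiset.le_add_right _ _))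
      · have h3 := card_lt_card (lt_of_le_of_ne hΩ hΩne)
        have h4 := card_le_card hle
        rw [card_add] at *
        rw [hWB, card_add]
        omega
    rw [← hlam] at h1
    rw [← hu, embed_level, map_nsmul, nsmul_eq_mul]
    have h2 := (mul_eq_zero_iff_castHom h hN (lam i w - 1)).2 (by rw [map_sub, h1, map_one, sub_self])
    linear_combination h2
  · intro w
    have h1 := congrArg (embed h) (hid (level hdvd w))
    rw [map_neg, embed_level, map_sum] at h1
    rw [← h1]
    refine Finset.sum_congr rfl fun i _ => ?_
    rw [← hx, smul_embed, hlam]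

end ZeroSum

/-! ### Multiples with small residue -/

namespace ZeroSum

open Multiset hiding map_add map_nsmul map_zero

theorem add_le_of_mul_le_pred {q μ r σ j : ℕ} (hμ : 2 ≤ μ) (hq : 2 * μ + 2 ≤ q)
    (hσ : σ + r ≤ 2 * μ) (hrj : r ≤ j) (hj : (j - r) * μ ≤ q - 1) : j + σ ≤ q := by
  by_contra hlt
  have h1 : q - 2 * μ + 1 ≤ j - r := by omega
  have h2 := (Nat.mul_le_mul_right μ h1).trans hj
  obtain ⟨e, rfl⟩ : ∃ e, q = 2 * μ + 2 + e := ⟨q - (2 * μ + 2), by omega⟩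
  have : 2 * μ + 2 + e - 2 * μ + 1 = e + 3 := by omega
  rw [this] at h2
  have h3 : (e + 3) * μ = e * μ + 3 * μ := by ring
  have h4 : e * 1 ≤ e * μ := Nat.mul_le_mul_left e (by omega)
  omega

/-- The walk `j ↦ jμ` moves in steps of `μ ≤ σ` and cannot jump over a window `[cq, cq + σ)`. Either
`rμ` already lies in one, or `j` is the first index past the next multiple of `q`. Up to there the
walk covers at most `q - 1 ≤ κμ`, so it makes at most `κ` steps. -/
theorem exists_small_residue_pos {q κ μ r σ : ℕ} (hμ : 2 ≤ μ) (hq : 2 * μ < q)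
    (hκ : q ∣ κ * μ + 1) (hr : 1 ≤ r) (hσ : μ ≤ σ) (hσr : σ + r ≤ 2 * μ) :
    ∃ j c, r ≤ j ∧ j ≤ r + κ ∧ j + σ ≤ q ∧ c * q ≤ j * μ ∧ j * μ < c * q + σ := by
  have hκ1 : q ≤ κ * μ + 1 := Nat.le_of_dvd (by omega) hκ
  by_cases h0 : r * μ % q < σ
  · refine ⟨r, r * μ / q, le_rfl, by omega, by omega, ?_, ?_⟩
    · exact Nat.div_mul_le_self _ _
    · have := Nat.div_add_mod (r * μ) q
      rw [mul_comm] at this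
      omega
  set c := r * μ / q + 1 with hc
  have hdm := Nat.div_add_mod (r * μ) q
  have hml := Nat.mod_lt (r * μ) (show q > 0 by omega)
  have hcq : c * q = q * (r * μ / q) + q := by rw [hc]; ring
  -- The general estimate for `j + σ ≤ q` needs `q ≥ 2μ + 2`. For `q = 2μ + 1` two steps cover `q -
  -- 1`, and `j` is written down explicitly according to the parity of `r`.
  rcases Nat.lt_or_ge q (2 * μ + 2) with hq1 | hq2
  · obtain rfl : q = 2 * μ + 1 := by omega
    have hκ2 : 2 ≤ κ := by
      by_contra h
      have : κ = 0 ∨ κ = 1 := by omega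
      rcases this with rfl | rfl <;> simp at hκ1 <;> omega
    rcases Nat.even_or_odd' r with ⟨i, rfl | rfl⟩
    · refine ⟨2 * i + 1, i, by omega, by omega, by omega, ?_, ?_⟩ <;> nlinarith
    · rcases Nat.eq_zero_or_pos i with rfl | hi
      · rw [mul_zero, zero_add, one_mul, Nat.mod_eq_of_lt (by omega)] at h0
        refine ⟨3, 1, by omega, by omega, by omega, ?_, ?_⟩ <;> omega
      · refine ⟨2 * i + 1, i, by omega, by omega, by omega, ?_, ?_⟩ <;> nlinarith
  · have hd := Nat.div_add_mod (c * q + μ - 1) μ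
    have hm := Nat.mod_lt (c * q + μ - 1) (show μ > 0 by omega)
    set j := (c * q + μ - 1) / μ with hj
    rw [mul_comm] at hd
    have h1 : c * q ≤ j * μ := by omega
    have h2 : j * μ < c * q + μ := by omega
    have h3 : r ≤ j := by
      by_contra h
      have : j * μ ≤ r * μ := Nat.mul_le_mul_right μ (by omega)
      omega
    have h4 : (j - r) * μ ≤ q - 1 := by
      rw [Nat.sub_mul]; omega
    have h5 : j - r ≤ κ := by
      have : (j - r) * μ ≤ κ * μ := by omega
      exact Nat.le_of_mul_le_mul_right this (by omega)
    exact ⟨j, c, h3, by omega, add_le_of_mul_le_pred hμ hq2 hσr h3 h4, h1, by omega⟩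

/-- Mirror image of `exists_small_residue_pos`: the windows end at the multiples of `q`, and `j` is
the last index not exceeding the next multiple. The alternative with `r = 1` treats a single large
value `σ`, for which the first index past `q - σ` works. -/
theorem exists_small_residue_neg {q κ μ r σ : ℕ} (hμ : 2 ≤ μ) (hq : 2 * μ < q)
    (hκ2 : 2 ≤ κ) (hκ : κ * μ ≡ 1 [MOD q]) (hr : 1 ≤ r) (hσ : μ ≤ σ)
    (h : σ + r ≤ 2 * μ ∨ r = 1 ∧ σ + 2 ≤ q) :
    ∃ j c, r ≤ j ∧ j ≤ r + κ ∧ j + σ ≤ q ∧ j * μ ≤ c * q ∧ c * q < j * μ + σ := by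
  have hκ1 : q + 1 ≤ κ * μ := by
    have h1 : 2 * 2 ≤ κ * μ := Nat.mul_le_mul hκ2 hμ
    have h2 := (Nat.modEq_iff_dvd' (by omega)).1 hκ.symm
    have := Nat.le_of_dvd (by omega) h2
    omega
  rcases h with hσr | ⟨rfl, hσq⟩
  · rcases Nat.lt_or_ge q (2 * μ + 2) with hq1 | hq2
    · obtain rfl : q = 2 * μ + 1 := by omega
      rcases Nat.even_or_odd' r with ⟨i, rfl | rfl⟩
      · refine ⟨2 * i, i, by omega, by omega, by omega, ?_, ?_⟩
        · nlinarith
        · have : 2 * i * μ = i * (2 * μ) := by ring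
          rw [Nat.mul_add, this]; omega
      · refine ⟨2 * i + 1 + 1, i + 1, by omega, by omega, by omega, ?_, ?_⟩
        · nlinarith
        · have : (2 * i + 1 + 1) * μ = (i + 1) * (2 * μ) := by ring
          rw [Nat.mul_add, this]; omega
    · set c := (r * μ + q - 1) / q with hc
      have hdm := Nat.div_add_mod (r * μ + q - 1) q
      have hml := Nat.mod_lt (r * μ + q - 1) (show q > 0 by omega)
      rw [mul_comm, ← hc] at hdm
      have hd := Nat.div_add_mod (c * q) μ
      have hm := Nat.mod_lt (c * q) (show μ > 0 by omega)
      set j := (c * q) / μ with hj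
      rw [mul_comm] at hd
      have h3 : r ≤ j := by
        by_contra h
        have : (j + 1) * μ ≤ r * μ := Nat.mul_le_mul_right μ (by omega)
        have e : (j + 1) * μ = j * μ + μ := by ring
        omega
      have h4 : (j - r) * μ ≤ q - 1 := by
        rw [Nat.sub_mul]; omega
      have h5 : j - r ≤ κ := by
        have : (j - r) * μ ≤ κ * μ := by omega
        exact Nat.le_of_mul_le_mul_right this (by omega)
      exact ⟨j, c, h3, by omega, add_le_of_mul_le_pred hμ hq2 hσr h3 h4, by omega, by omega⟩
  · have hd := Nat.div_add_mod (q - σ) μ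
    have hm := Nat.mod_lt (q - σ) (show μ > 0 by omega)
    set i := (q - σ) / μ with hi
    rw [mul_comm] at hd
    have e : (i + 1) * μ = i * μ + μ := by ring
    refine ⟨i + 1, 1, Nat.le_add_left 1 i, ?_, ?_, by omega, by omega⟩
    · have : i * μ ≤ κ * μ := by omega
      have := Nat.le_of_mul_le_mul_right this (by omega)
      omega
    · have : i * 2 ≤ i * μ := Nat.mul_le_mul_left i hμ
      omega

/-- A sub-multiset of `X` that is minimal subject to having sum at least `μ`. -/
theorem exists_minimal_sum_ge {X : Multiset ℕ} {μ : ℕ} (hX : ∀ x ∈ X, 1 ≤ x) (hμ : 1 ≤ μ)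
    (h : μ ≤ X.sum) :
    ∃ Y ≤ X, μ ≤ Y.sum ∧ (card Y = 1 ∨ (1 ≤ card Y ∧ Y.sum + card Y ≤ 2 * μ)) := by
  induction X using Multiset.strongInductionOn with
  | ih X ih =>
  by_cases hm : ∃ x ∈ X, μ ≤ (X.erase x).sum
  · obtain ⟨x, hx, hxs⟩ := hm
    obtain ⟨Y, hY, h1⟩ := ih (X.erase x) (erase_lt.2 hx)
      (fun y hy => hX y (mem_of_mem_erase hy)) hxs
    exact ⟨Y, hY.trans (erase_le _ _), h1⟩
  · push Not at hm
    refine ⟨X, le_rfl, h, ?_⟩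
    have hX0 : X ≠ 0 := by rintro rfl; simp at h; omega
    have hX1 := card_pos.2 hX0
    by_cases h1 : card X = 1
    · exact Or.inl h1
    right
    refine ⟨hX1, ?_⟩
    obtain ⟨x, hx, hmin⟩ : ∃ x ∈ X, ∀ y ∈ X, x ≤ y := by
      obtain ⟨x, hx, h⟩ := X.toFinset.exists_min_image id
        (by rw [Finset.nonempty_iff_ne_empty, Ne, Multiset.toFinset_eq_empty]; exact hX0)
      exact ⟨x, by simpa using hx, fun y hy => h y (by simpa using hy)⟩
    have h2 := hm x hx
    have h3 : x + (X.erase x).sum = X.sum := sum_erase hx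
    have h4 := card_nsmul_le_sum (s := X.erase x) (a := x)
      (fun y hy => hmin y (mem_of_mem_erase hy))
    rw [card_erase_of_mem hx, smul_eq_mul, Nat.pred_eq_sub_one] at h4
    obtain ⟨k, hk⟩ : ∃ k, card X = k + 2 := ⟨card X - 2, by omega⟩
    obtain ⟨y, rfl⟩ : ∃ y, x = y + 1 := ⟨x - 1, by have := hX x hx; omega⟩
    rw [hk] at h4 ⊢
    have e : (k + 2 - 1) * (y + 1) = k * y + k + y + 1 := by
      rw [show k + 2 - 1 = k + 1 by omega]; ring
    have := Nat.zero_le (k * y)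
    omega

/-- The arithmetic core: exceptional values `X` whose sum is at least `min(ν, q - ν)` always
produce a short zero-sum subsequence. -/
theorem exists_residue_lt_sum {q κ ν : ℕ} (hκ : 2 ≤ κ) (hκq : κ + 2 ≤ q) (hν : ν < q)
    (hκν : q ∣ κ * ν + 1) {X : Multiset ℕ} (hX : ∀ x ∈ X, 1 ≤ x) (hXq : ∀ x ∈ X, x < q)
    (hsum : min ν (q - ν) ≤ X.sum) :
    ∃ Y ≤ X, ∃ j, 1 ≤ j ∧ card Y ≤ j ∧ j ≤ card Y + κ ∧ j + Y.sum ≤ q ∧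
      j * ν % q < Y.sum := by
  -- As `ν` is the inverse of `-κ` and `κ` is not `0` or `±1`, neither is `ν`; hence `min ν (q - ν)`
  -- is at least `2`. Also `2ν ≠ q`, because `ν` is prime to `q`.
  have hν1 : ν ≠ 0 := by
    rintro rfl
    have := Nat.le_of_dvd (by omega) hκν
    omega
  have hν2 : ν ≠ 1 := by
    rintro rfl
    have := Nat.le_of_dvd (by omega) hκν
    omega
  have hν3 : ν + 1 ≠ q := by
    intro h
    have h1 : κ * q = κ * ν + κ := by rw [← h]; ring
    have h2 : q ∣ κ * q - (κ * ν + 1) := Nat.dvd_sub (Dvd.intro_left _ rfl) hκν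
    rw [h1] at h2
    have := Nat.le_of_dvd (by omega) h2
    omega
  have hν4 : 2 * ν ≠ q := by
    intro h
    have h1 : ν ∣ κ * ν + 1 := (Dvd.intro_left 2 h).trans hκν
    have h2 : ν ∣ 1 := (Nat.dvd_add_right (Dvd.intro_left κ rfl)).1 h1
    exact hν2 (Nat.dvd_one.1 h2)
  obtain ⟨Y, hY, hYs, hYc⟩ := exists_minimal_sum_ge hX (by omega) hsum
  rcases Nat.lt_or_ge (2 * ν) q with hA | hB
  · rw [min_eq_left (by omega)] at hYs hYc
    have main : Y.sum + card Y ≤ 2 * ν → 1 ≤ card Y → ∃ j, 1 ≤ j ∧ card Y ≤ j ∧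
        j ≤ card Y + κ ∧ j + Y.sum ≤ q ∧ j * ν % q < Y.sum := fun h1 h2 => by
      obtain ⟨j, c, a1, a2, a3, a4, a5⟩ := exists_small_residue_pos (κ := κ) (by omega) hA hκν h2
        hYs h1
      refine ⟨j, by omega, a1, a2, a3, ?_⟩
      have e : j * ν = (j * ν - c * q) + q * c := by rw [mul_comm q c]; omega
      rw [e, Nat.add_mul_mod_self_left, Nat.mod_eq_of_lt (by omega)]
      omega
    rcases hYc with h1 | ⟨h1, h2⟩
    · by_cases hs : Y.sum = ν
      · exact ⟨Y, hY, main (by omega) (by omega)⟩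
      · refine ⟨Y, hY, 1, le_rfl, by omega, by omega, ?_, ?_⟩
        · obtain ⟨y, rfl⟩ := card_eq_one.1 h1
          have := hXq y (mem_of_le hY (mem_singleton_self y))
          simp; omega
        · rw [one_mul, Nat.mod_eq_of_lt hν]; omega
    · exact ⟨Y, hY, main h2 h1⟩
  · rw [min_eq_right (by omega)] at hYs
    obtain ⟨μ, hμ⟩ : ∃ μ, μ = q - ν := ⟨_, rfl⟩
    rw [← hμ] at hYs hYc hsum
    rw [min_eq_right (by omega)] at hYc
    have hκμ : κ * μ ≡ 1 [MOD q] := by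
      have h1 : κ * μ + κ * ν = κ * q := by rw [← mul_add, hμ, Nat.sub_add_cancel hν.le]
      obtain ⟨d, hd⟩ := hκν
      have h2 : κ * μ + q * d = 1 + q * κ := by rw [mul_comm q κ, ← hd]; omega
      have h3 : (κ * μ + q * d) % q = (1 + q * κ) % q := by rw [h2]
      rwa [Nat.add_mul_mod_self_left, Nat.add_mul_mod_self_left] at h3
    have key : ∀ j c, 1 ≤ j → j * μ ≤ c * q → c * q < j * μ + Y.sum → j + Y.sum ≤ q →
        j * ν % q < Y.sum := fun j c _ a1 a2 a3 => by
      have h1 : j * μ + j * ν = j * q := by rw [← mul_add, hμ, Nat.sub_add_cancel hν.le]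
      have hcj : c ≤ j := by
        by_contra hlt
        have : (j + 1) * q ≤ c * q := Nat.mul_le_mul_right q (by omega)
        have e : (j + 1) * q = j * q + q := by ring
        have : j * μ ≤ j * q := Nat.mul_le_mul_left j (by omega)
        omega
      have e2 : (j - c) * q + c * q = j * q := by rw [← add_mul, Nat.sub_add_cancel hcj]
      have e : j * ν = (c * q - j * μ) + q * (j - c) := by rw [mul_comm q (j - c)]; omega
      rw [e, Nat.add_mul_mod_self_left, Nat.mod_eq_of_lt (by omega)]
      omega
    rcases hYc with h1 | ⟨h1, h2⟩
    · obtain ⟨y, rfl⟩ := card_eq_one.1 h1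
      have hy := hXq y (mem_of_le hY (mem_singleton_self y))
      by_cases hy2 : y + 2 ≤ q
      · obtain ⟨j, c, a1, a2, a3, a4, a5⟩ := exists_small_residue_neg (r := 1) (σ := y)
          (by omega) (by omega) hκ hκμ le_rfl (by simpa using hYs) (Or.inr ⟨rfl, hy2⟩)
        refine ⟨_, hY, j, a1, by simpa using a1, by simpa using a2, by simpa using a3,
          key j c a1 a4 (by simpa using a5) (by simpa using a3)⟩
      · refine ⟨_, hY, 1, le_rfl, by simp, by simp, by simp; omega, ?_⟩
        rw [one_mul, Nat.mod_eq_of_lt hν]; simp; omega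
    · obtain ⟨j, c, a1, a2, a3, a4, a5⟩ := exists_small_residue_neg (by omega) (by omega) hκ hκμ h1
        hYs (Or.inl h2)
      exact ⟨Y, hY, j, by omega, a1, a2, a3, key j c (by omega) a4 a5 a3⟩

end ZeroSum

/-! ### Bases of the plane and sequences with an element of multiplicity `q - 1` -/

namespace ZeroSum

open Multiset hiding map_add map_nsmul map_zero

variable {q : ℕ}

/-- `(e, f)` is a basis of the plane over `ZMod q`, with coordinate functionals `α` and `β`. -/
structure Coord (e f : ZMod q × ZMod q) (α β : ZMod q × ZMod q →ₗ[ZMod q] ZMod q) : Prop where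
  fst_left : α e = 1
  fst_right : α f = 0
  snd_left : β e = 0
  snd_right : β f = 1
  eq_comb : ∀ v, v = α v • e + β v • f

namespace Coord

variable {e f : ZMod q × ZMod q} {α β : ZMod q × ZMod q →ₗ[ZMod q] ZMod q}

theorem swap (h : Coord e f α β) : Coord f e β α :=
  ⟨h.snd_right, h.snd_left, h.fst_right, h.fst_left, fun v => by
    rw [add_comm]; exact h.eq_comb v⟩

theorem ext (h : Coord e f α β) {v w : ZMod q × ZMod q} (h1 : α v = α w) (h2 : β v = β w) :
    v = w := by
  rw [h.eq_comb v, h.eq_comb w, h1, h2]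

theorem eq_zero (h : Coord e f α β) {v : ZMod q × ZMod q} (h1 : α v = 0) (h2 : β v = 0) :
    v = 0 := h.ext (by rw [h1, map_zero]) (by rw [h2, map_zero])

/-- Replacing `f` while keeping `e` only rescales `β`, so the family of lines parallel to `e` is
unchanged. -/
theorem change (h : Coord e f α β) {f' : ZMod q × ZMod q} {b : ZMod q} (hb : b * β f' = 1) :
    Coord e f' (α - (b * α f') • β) (b • β) where
  fst_left := by simp [h.fst_left, h.snd_left]
  fst_right := by
    simp only [LinearMap.sub_apply, LinearMap.smul_apply, smul_eq_mul]
    linear_combination (-α f') * hb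
  snd_left := by simp [h.snd_left]
  snd_right := by simpa using hb
  eq_comb v := by
    apply h.ext
    · simp only [LinearMap.sub_apply, LinearMap.smul_apply, smul_eq_mul, map_add, map_smul,
        h.fst_left]
      ring
    · simp only [LinearMap.sub_apply, LinearMap.smul_apply, smul_eq_mul, map_add, map_smul,
        h.snd_left]
      linear_combination (-β v) * hb

theorem change_one (h : Coord e f α β) {f' : ZMod q × ZMod q} (hb : β f' = 1) :
    Coord e f' (α - α f' • β) β := by
  simpa using h.change (b := 1) (f' := f') (by simpa using hb)

end Coord

theorem map_sum_multiset (β : ZMod q × ZMod q →ₗ[ZMod q] ZMod q) (S : Multiset (ZMod q × ZMod q)) :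
    β S.sum = (S.map β).sum := map_multiset_sum β S

theorem apply_nsmul (β : ZMod q × ZMod q →ₗ[ZMod q] ZMod q) (k : ℕ) (v : ZMod q × ZMod q) :
    β (k • v) = k * β v := by rw [map_nsmul, nsmul_eq_mul]

theorem sum_map_eq_card {A : Type*} (β : A → ZMod q) (c : ZMod q)
    (S : Multiset A) (h : ∀ v ∈ S, β v = c) : (S.map β).sum = card S * c := by
  rw [map_congr rfl h, map_const', sum_replicate, nsmul_eq_mul]

theorem NoShort.mono {G : Type*} [AddCommGroup G] {S T : Multiset G} (h : NoShort q T)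
    (hS : S ≤ T) : NoShort q S := fun Y hY => h Y (hY.trans hS)

theorem sum_sub_eq_zero {G : Type*} [AddCommGroup G] [DecidableEq G] {S T : Multiset G} (h : T ≤ S)
    (hT : T.sum = 0) (hS : S.sum = 0) : (S - T).sum = 0 := by
  have := congrArg Multiset.sum (Multiset.sub_add_cancel h)
  rw [Multiset.sum_add, hT, hS, add_zero] at this
  exact this

theorem NoShort.le_card_sub {G : Type*} [AddCommGroup G] {S T : Multiset G} (h : NoShort q S)
    (hS : S.sum = 0) (hT : T ≤ S) (hTs : T.sum = 0) (hne : T ≠ S) : card T + q ≤ card S := by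
  classical
  have h1 := h (S - T) (Multiset.sub_le_self _ _)
    (fun h0 => hne (le_antisymm hT (tsub_eq_zero_iff_le.1 h0))) (sum_sub_eq_zero hT hTs hS)
  rw [card_sub hT] at h1
  have := card_le_card hT
  have : card T ≠ card S := fun h2 => hne (eq_of_le_of_card_le hT h2.ge)
  omega

theorem NoShort.isMinimalZeroSum {G : Type*} [AddCommGroup G] {W : Multiset G} (hq : 0 < q)
    (h : NoShort q W) (hs : W.sum = 0) (hc : card W = 2 * q - 1) : IsMinimalZeroSum W := by
  refine ⟨by rintro rfl; simp at hc; omega, hs, fun T hT _ hlt U hU hU0 hUs => ?_⟩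
  have h1 := h U (hU.trans hT) hU0 hUs
  have h2 := h.le_card_sub hs (hU.trans hT) hUs (by
    rintro rfl
    have := card_le_card hU
    omega)
  omega

theorem isUnit_of_forall_mul_ne_zero (hq : 0 < q) {c : ZMod q}
    (h : ∀ k : ℕ, 0 < k → k < q → (k : ZMod q) * c ≠ 0) : IsUnit c := by
  have : NeZero q := ⟨hq.ne'⟩
  have : Fintype (ZMod q) := ZMod.fintype q
  rw [isUnit_iff_mem_nonZeroDivisors_of_finite, mem_nonZeroDivisors_iff_right]
  intro x hx
  by_contra hx0
  refine h x.val (Nat.pos_of_ne_zero fun h0 => hx0 ((ZMod.val_eq_zero x).1 h0)) (ZMod.val_lt x) ?_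
  rw [ZMod.natCast_zmod_val, hx]

/-- The gcd of the coordinates of an element of order `q` is a unit modulo `q`, since anything
killing the gcd kills the element. Bézout then provides a second vector with determinant `1`. -/
theorem exists_coord_of_forall_nsmul_ne_zero (hq : 0 < q) {e : ZMod q × ZMod q}
    (h : ∀ k : ℕ, 0 < k → k < q → k • e ≠ 0) :
    ∃ f α β, Coord e f α β := by
  have : NeZero q := ⟨hq.ne'⟩
  obtain ⟨u, v, huv⟩ : ∃ u v : ZMod q, e.1 * u + e.2 * v = 1 := by
    set a := e.1.val with ha
    set b := e.2.val with hb
    have h1 : (Int.gcd a b : ZMod q) = e.1 * Int.gcdA a b + e.2 * Int.gcdB a b := by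
      have := congrArg (Int.cast : ℤ → ZMod q) (Int.gcd_eq_gcd_ab a b)
      push_cast at this
      rw [this, ha, hb, ZMod.natCast_zmod_val, ZMod.natCast_zmod_val]
    have h2 : IsUnit (Int.gcd a b : ZMod q) := by
      apply isUnit_of_forall_mul_ne_zero hq
      intro k hk hkq h0
      refine h k hk hkq ?_
      have key : ∀ c : ZMod q, Int.gcd a b ∣ c.val → (k : ZMod q) * c = 0 := fun c hc => by
        obtain ⟨d, hd⟩ := hc
        rw [← ZMod.natCast_zmod_val c, hd]
        push_cast
        rw [← mul_assoc, h0, zero_mul]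
      ext
      · simpa using key e.1 (by rw [Int.gcd_natCast_natCast]; exact Nat.gcd_dvd_left a b)
      · simpa using key e.2 (by rw [Int.gcd_natCast_natCast]; exact Nat.gcd_dvd_right a b)
    obtain ⟨c, hc⟩ := h2.exists_right_inv
    exact ⟨Int.gcdA a b * c, Int.gcdB a b * c, by rw [← hc, h1]; ring⟩
  refine ⟨(-v, u), u • LinearMap.fst _ _ _ + v • LinearMap.snd _ _ _,
    e.1 • LinearMap.snd _ _ _ - e.2 • LinearMap.fst _ _ _, ?_, ?_, ?_, ?_, ?_⟩
  · simp; linear_combination huv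
  · simp; ring
  · simp; ring
  · simp; linear_combination huv
  · intro w
    ext
    · simp; linear_combination (-w.1) * huv
    · simp; linear_combination (-w.2) * huv

section CyclicExtremal

variable {A : Type*} [AddCommGroup A]

/-- The set of sums of all subsequences, the empty one included. -/
def subsetSums [DecidableEq A] (S : Multiset A) : Finset A := (S.powerset.map Multiset.sum).toFinset

theorem mem_subsetSums [DecidableEq A] {S : Multiset A} {a : A} :
    a ∈ subsetSums S ↔ ∃ T ≤ S, T.sum = a := by
  simp [subsetSums]

/-- If no new sum appeared, the set of sums would be stable under translation by `x`. Since it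
contains `0`, the element `-x` would be a sum, contrary to zero-sum freeness. -/
theorem card_subsetSums_lt [DecidableEq A] {S : Multiset A} {x : A} (h : ZeroSumFree (x ::ₘ S)) :
    (subsetSums S).card < (subsetSums (x ::ₘ S)).card := by
  apply Finset.card_lt_card
  refine ⟨fun a ha => ?_, fun hsub => ?_⟩
  · obtain ⟨T, hT, rfl⟩ := mem_subsetSums.1 ha
    exact mem_subsetSums.2 ⟨T, hT.trans (le_cons_self _ _), rfl⟩
  · have himg : (subsetSums S).image (x + ·) ⊆ subsetSums S := by
      intro b hb
      obtain ⟨a, ha, rfl⟩ := Finset.mem_image.1 hb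
      obtain ⟨T, hT, rfl⟩ := mem_subsetSums.1 ha
      exact hsub (mem_subsetSums.2 ⟨x ::ₘ T, (cons_le_cons_iff x).2 hT, by simp⟩)
    have heq := Finset.eq_of_subset_of_card_le himg
      (by rw [Finset.card_image_of_injective _ (add_right_injective x)])
    have h0 : (0 : A) ∈ (subsetSums S).image (x + ·) := by
      rw [heq]; exact mem_subsetSums.2 ⟨0, Multiset.zero_le _, rfl⟩
    obtain ⟨a, ha, hxa⟩ := Finset.mem_image.1 h0
    obtain ⟨T, hT, rfl⟩ := mem_subsetSums.1 ha
    exact h (x ::ₘ T) ((cons_le_cons_iff x).2 hT) (by simp) (by simpa using hxa)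

theorem card_add_two_le_subsetSums [DecidableEq A] {r s : A} (hrs : r ≠ s) (S : Multiset A)
    (h : ZeroSumFree (r ::ₘ s ::ₘ S)) : card S + 4 ≤ (subsetSums (r ::ₘ s ::ₘ S)).card := by
  induction S using Multiset.induction_on with
  | empty =>
    have h2 := h
    have hr : r ≠ 0 := fun h0 => h {r} (by simp) (by simp) (by simpa using h0)
    have hs : s ≠ 0 := fun h0 => h {s} (by simp) (by simp) (by simpa using h0)
    have hrs0 : r + s ≠ 0 := fun h0 => h {r, s} le_rfl (by simp) (by simpa using h0)
    have hsub : ({0, r, s, r + s} : Finset A) ⊆ subsetSums (r ::ₘ s ::ₘ 0) := by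
      intro a ha
      simp only [Finset.mem_insert, Finset.mem_singleton] at ha
      rw [mem_subsetSums]
      rcases ha with rfl | rfl | rfl | rfl
      · exact ⟨0, Multiset.zero_le _, rfl⟩
      · exact ⟨{a}, by simp, by simp⟩
      · exact ⟨{a}, by simp, by simp⟩
      · exact ⟨_, le_rfl, by simp⟩
    have h4 : ({0, r, s, r + s} : Finset A).card = 4 := by
      rw [Finset.card_insert_of_notMem, Finset.card_insert_of_notMem, Finset.card_pair]
      · simpa using hr
      · simp [hrs, hs]
      · simp [hr.symm, hs.symm, hrs0.symm]
    have := Finset.card_le_card hsub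
    simpa [h4] using this
  | cons x S ih =>
    have e : r ::ₘ s ::ₘ x ::ₘ S = x ::ₘ r ::ₘ s ::ₘ S := by
      rw [cons_swap s x, cons_swap r x]
    rw [e] at h ⊢
    have h1 := ih (h.mono (le_cons_self _ _))
    have h2 := card_subsetSums_lt h
    rw [card_cons]
    omega

/-- Two distinct terms already give four sums and each further term adds at least one. This is one
more than fits into the group. -/
theorem eq_of_zeroSumFree [Fintype A] {S : Multiset A} (h : ZeroSumFree S)
    (hc : Fintype.card A ≤ card S + 1) {r s : A} (hr : r ∈ S) (hs : s ∈ S) : r = s := by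
  classical
  by_contra hrs
  obtain ⟨S, rfl⟩ := exists_cons_of_mem hr
  have hs' : s ∈ S := (mem_cons.1 hs).resolve_left (Ne.symm hrs)
  obtain ⟨S, rfl⟩ := exists_cons_of_mem hs'
  have h1 := card_add_two_le_subsetSums hrs S h
  have h2 := Finset.card_le_univ (subsetSums (r ::ₘ s ::ₘ S))
  simp only [card_cons] at hc
  omega

end CyclicExtremal

/-- A zero-sum sequence of length `2q - 1` without short zero-sum subsequences and with an element
`e` of multiplicity `q - 1` is `e^{q-1}` times a sequence on a line `f + ⟨e⟩`. -/
theorem exists_coord_of_replicate_le (hq : 2 ≤ q) {W : Multiset (ZMod q × ZMod q)}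
    (hns : NoShort q W) (hs : W.sum = 0) (hc : card W = 2 * q - 1) {e : ZMod q × ZMod q}
    (he : q - 1 ≤ W.count e) :
    ∃ F f α β, W = replicate (q - 1) e + F ∧ card F = q ∧ Coord e f α β ∧ f ∈ F ∧
      ∀ v ∈ F, β v = 1 := by
  have : NeZero q := ⟨by omega⟩
  have hle : replicate (q - 1) e ≤ W := le_count_iff_replicate_le.1 he
  obtain ⟨F, rfl⟩ := Multiset.le_iff_exists_add.1 hle
  have hF : card F = q := by rw [card_add, card_replicate] at hc; omega
  obtain ⟨f₀, α, β, hco⟩ := exists_coord_of_forall_nsmul_ne_zero (e := e) (by omega) (by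
    intro k hk hkq h0
    have := hns (replicate k e) ((replicate_le_replicate e).2 (by omega) |>.trans hle)
      (by rw [← card_pos]; simpa using hk) (by simpa using h0)
    rw [card_replicate] at this
    omega)
  -- If `β R.sum = 0`, copies of `e` complete `R` to a proper zero-sum subsequence. It and its
  -- complement both have at least `q` terms, too many for `2q - 1`.
  have hproper : ∀ R ≤ F, R ≠ 0 → R ≠ F → β R.sum ≠ 0 := by
    intro R hR hR0 hRF hβ
    set k := (-(α R.sum)).val with hk
    have hkq : k ≤ q - 1 := by have := ZMod.val_lt (-(α R.sum)); omega
    have hzero : (replicate k e + R).sum = 0 := by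
      apply hco.eq_zero
      · rw [sum_add, sum_replicate, map_add, map_nsmul, hco.fst_left, hk, nsmul_eq_mul,
          ZMod.natCast_zmod_val]
        ring
      · rw [sum_add, sum_replicate, map_add, map_nsmul, hco.snd_left, hβ]
        simp
    have hRc : card R ≠ card F := fun h2 => hRF (eq_of_le_of_card_le hR h2.ge)
    have hle' : replicate k e + R ≤ replicate (q - 1) e + F :=
      add_le_add ((replicate_le_replicate e).2 hkq) hR
    have h1 := hns _ hle' (by
      intro h0; exact hR0 (Multiset.le_zero.1 (h0 ▸ Multiset.le_add_left _ _))) hzero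
    have h2 := hns.le_card_sub hs hle' hzero (by
      intro h0
      have h3 := congrArg card h0
      have := card_le_card hR
      simp only [card_add, card_replicate] at h3
      omega)
    omega
  have hβsum : (F.map β).sum = 0 := by
    have := congrArg β hs
    rw [sum_add, map_add, sum_replicate, map_nsmul, hco.snd_left, map_sum_multiset] at this
    simpa using this
  have hfree : ∀ f' ∈ F, ZeroSumFree ((F.erase f').map β) := by
    intro f' hf' T hT hT0 hTs
    obtain ⟨R, hR, rfl⟩ := exists_le_of_le_map hT
    refine hproper R (hR.trans (erase_le _ _)) (by rintro rfl; simp at hT0) ?_ ?_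
    · rintro rfl
      have := card_le_card hR
      rw [card_erase_of_mem hf', Nat.pred_eq_sub_one] at this
      omega
    · rw [map_sum_multiset, hTs]
  obtain ⟨f, hf⟩ := exists_mem_of_ne_zero (show F ≠ 0 by rintro rfl; simp at hF; omega)
  -- The `β`-values of `F` without one term are zero-sum free of length `q - 1` in a group of order
  -- `q`, hence constant. The total sum being `0`, the omitted term has the same value.
  have hconst : ∀ f' ∈ F, ∀ v ∈ F.erase f', β v = β f' := by
    intro f' hf' v hv
    have h1 : ∀ x ∈ F.erase f', β x = β v := fun x hx =>
      eq_of_zeroSumFree (hfree f' hf') (by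
        rw [ZMod.card, card_map, card_erase_of_mem hf', Nat.pred_eq_sub_one]; omega)
        (mem_map_of_mem _ hx) (mem_map_of_mem _ hv)
    have h2 := sum_map_eq_card β (β v) _ h1
    rw [← cons_erase hf', map_cons, sum_cons, h2, card_erase_of_mem hf', hF,
      Nat.pred_eq_sub_one, Nat.cast_sub (by omega)] at hβsum
    simp at hβsum
    linear_combination -hβsum
  have hconst' : ∀ v ∈ F, β v = β f := by
    intro v hv
    rw [← cons_erase hf] at hv
    rcases mem_cons.1 hv with rfl | hv
    · rfl
    · exact hconst f hf v hv
  have hunit : IsUnit (β f) := by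
    apply isUnit_of_forall_mul_ne_zero (by omega)
    intro k hk hkq
    obtain ⟨R, hR, hRc⟩ := exists_le_card_eq (S := F) (k := k) (by omega)
    have := hproper R hR (by rintro rfl; simp at hRc; omega) (by rintro rfl; omega)
    rwa [map_sum_multiset, sum_map_eq_card β (β f) R fun v hv => hconst' v (mem_of_le hR hv),
      hRc] at this
  obtain ⟨b, hb⟩ := hunit.exists_left_inv
  exact ⟨F, f, _, _, rfl, hF, hco.change hb, hf, fun v hv => by
    rw [LinearMap.smul_apply, hconst' v hv, smul_eq_mul, hb]⟩

/-- A large total of `α`-values on the line would allow a short zero-sum subsequence. Some terms `R`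
with `α`-total `σ` are taken, filled up with `e₂` to `j` terms on the line, and balanced by `i`
copies of `κ(e₂ - e₁)` with `i ≡ jν`, where `ν = -1/κ`, and by copies of `e₁`. The length is `q - σ
+ i`, and `exists_residue_lt_sum` provides `i < σ`. -/
theorem val_sum_lt_of_noShort {e₁ e₂ : ZMod q × ZMod q}
    {α β : ZMod q × ZMod q →ₗ[ZMod q] ZMod q} (hco : Coord e₁ e₂ α β) {κ : ℕ} (hκ : 2 ≤ κ)
    (hκq : κ + 2 ≤ q) (hκu : IsUnit (κ : ZMod q)) {F : Multiset (ZMod q × ZMod q)}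
    (hF : ∀ v ∈ F, β v = 1) (he₂ : κ ≤ F.count e₂)
    (hns : NoShort q (replicate (q - 1) e₁ + F + replicate q (κ • (e₂ - e₁)))) :
    (F.map fun v => (α v).val).sum < q := by
  have : NeZero q := ⟨by omega⟩
  by_contra hge
  rw [not_lt] at hge
  obtain ⟨b, hb⟩ := hκu.exists_right_inv
  set ν := (-b).val with hν
  have hνb : (ν : ZMod q) = -b := ZMod.natCast_zmod_val _
  have hκν : q ∣ κ * ν + 1 := by
    rw [← ZMod.natCast_eq_zero_iff]
    push_cast
    rw [hνb]
    linear_combination -hb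
  have hνq : ν < q := ZMod.val_lt _
  have hfilt : F.filter (fun v => α v = 0) + F.filter (fun v => ¬ α v = 0) = F :=
    filter_add_not _ _
  have hzero : ((F.filter (fun v => α v = 0)).map fun v => (α v).val).sum = 0 := by
    apply Multiset.sum_eq_zero
    intro x hx
    obtain ⟨v, hv, rfl⟩ := mem_map.1 hx
    rw [(mem_filter.1 hv).2, ZMod.val_zero]
  have hsumX : ((F.filter (fun v => ¬ α v = 0)).map fun v => (α v).val).sum =
      (F.map fun v => (α v).val).sum := by
    conv_rhs => rw [← hfilt, Multiset.map_add, sum_add, hzero, zero_add]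
  obtain ⟨Y, hY, j, hj1, hYj, hjY, hjq, hlt⟩ := exists_residue_lt_sum hκ hκq hνq hκν
    (X := (F.filter (fun v => ¬ α v = 0)).map fun v => (α v).val)
    (by
      intro x hx
      obtain ⟨v, hv, rfl⟩ := mem_map.1 hx
      exact Nat.pos_of_ne_zero fun h0 => (mem_filter.1 hv).2 ((ZMod.val_eq_zero _).1 h0))
    (by
      intro x hx
      obtain ⟨v, hv, rfl⟩ := mem_map.1 hx
      exact ZMod.val_lt _)
    (by rw [hsumX]; omega)
  obtain ⟨R, hR, rfl⟩ := exists_le_of_le_map hY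
  rw [card_map] at hYj hjY
  set σ := (R.map fun v => (α v).val).sum with hσ
  have hσα : α R.sum = (σ : ZMod q) := by
    rw [map_sum_multiset, hσ, Nat.cast_multiset_sum, Multiset.map_map]
    exact congrArg _ (map_congr rfl fun v _ => by simp)
  have hRβ : β R.sum = (card R : ZMod q) := by
    rw [map_sum_multiset, sum_map_eq_card β 1 R, mul_one]
    exact fun v hv => hF v (mem_of_mem_filter (mem_of_le hR hv))
  set i := j * ν % q with hi
  have hiκ : (i : ZMod q) * κ = -j := by
    rw [hi, ZMod.natCast_mod]
    push_cast
    rw [hνb]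
    linear_combination (-(j : ZMod q)) * hb
  have hiq : i < q := Nat.mod_lt _ (by omega)
  have hle : replicate (j - card R) e₂ + R ≤ F := by
    rw [← hfilt]
    refine add_le_add ?_ hR
    rw [← le_count_iff_replicate_le, count_filter_of_pos (p := fun v => α v = 0) hco.fst_right]
    omega
  -- The bounds `j ≤ |R| + κ` and `j + σ ≤ q` guarantee enough copies of `e₂` and a nonnegative
  -- number of copies of `e₁`.
  have hle' : replicate (q - j - σ) e₁ + (replicate (j - card R) e₂ + R) +
      replicate i (κ • (e₂ - e₁)) ≤ replicate (q - 1) e₁ + F + replicate q (κ • (e₂ - e₁)) :=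
    add_le_add (add_le_add ((replicate_le_replicate _).2 (by omega)) hle)
      ((replicate_le_replicate _).2 (by omega))
  have hcard : card (replicate (q - j - σ) e₁ + (replicate (j - card R) e₂ + R) +
      replicate i (κ • (e₂ - e₁))) = q - j - σ + (j - card R + card R) + i := by
    simp only [card_add, card_replicate]
  have hcastR : ((j - card R : ℕ) : ZMod q) = j - card R := Nat.cast_sub hYj
  have hcastq : ((q - j - σ : ℕ) : ZMod q) = -j - σ := by
    rw [Nat.cast_sub (by omega), Nat.cast_sub (by omega), ZMod.natCast_self]; ring
  have h1 := hns _ hle' (by rw [← card_pos, hcard]; omega) (by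
    apply hco.eq_zero
    · simp only [sum_add, sum_replicate, map_add, apply_nsmul, map_sub, hco.fst_left, hco.fst_right,
        hσα, hcastq]
      linear_combination -hiκ
    · simp only [sum_add, sum_replicate, map_add, apply_nsmul, map_sub, hco.snd_left, hco.snd_right,
        hRβ, hcastR]
      linear_combination hiκ)
  rw [hcard] at h1
  omega

end ZeroSum

/-! ### Tame sequences of length `3q - 1`: decompositions and constant blocks -/

namespace ZeroSum

open Multiset hiding map_add map_nsmul map_zero

variable {q : ℕ}

/-- `T` has no zero-sum subsequence of length less than `q`, and every zero-sum subsequence of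
length `2q - 1` has an element of multiplicity at least `q - 1`. -/
structure IsTame (q : ℕ) (T : Multiset (ZMod q × ZMod q)) : Prop where
  noShort : NoShort q T
  exists_base : ∀ W ≤ T, W.sum = 0 → card W = 2 * q - 1 → ∃ e, q - 1 ≤ W.count e

theorem IsTame.mono {S T : Multiset (ZMod q × ZMod q)} (h : IsTame q T) (hS : S ≤ T) :
    IsTame q S :=
  ⟨h.noShort.mono hS, fun W hW => h.exists_base W (hW.trans hS)⟩

/-- All terms are equal to `e` or lie on the line `f + ⟨e⟩`, for a basis `(e, f)`. -/
def IsGood (T : Multiset (ZMod q × ZMod q)) : Prop :=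
  ∃ e f α β, Coord e f α β ∧ ∀ v ∈ T, v = e ∨ β v = 1

/-- The exceptional sequences `e₁^A e₂^B (e₁ + e₂) (κ(e₂ - e₁))^C`. -/
def IsExotic (T : Multiset (ZMod q × ZMod q)) : Prop :=
  ∃ e₁ e₂ α β, Coord e₁ e₂ α β ∧ ∃ κ A B C : ℕ, 2 ≤ κ ∧ κ + 2 ≤ q ∧ IsUnit (κ : ZMod q) ∧
    q ∣ A + 1 ∧ q ∣ B + 1 ∧ q ∣ C ∧ 0 < C ∧
    T = replicate A e₁ + replicate B e₂ + {e₁ + e₂} + replicate C (κ • (e₂ - e₁))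

/-- A decomposition of `Z` into `e^{q-1} F`, with `F` on the line `f + ⟨e⟩`, and a zero-sum block
`Y` of length `q`. -/
structure Rep (Z : Multiset (ZMod q × ZMod q)) (e f : ZMod q × ZMod q)
    (α β : ZMod q × ZMod q →ₗ[ZMod q] ZMod q) (F Y : Multiset (ZMod q × ZMod q)) : Prop where
  coord : Coord e f α β
  eq_add : Z = replicate (q - 1) e + F + Y
  snd_eq_one : ∀ v ∈ F, β v = 1
  card_left : card F = q
  card_right : card Y = q
  sum_left : (replicate (q - 1) e + F).sum = 0
  sum_right : Y.sum = 0

theorem nsmul_plane (v : ZMod q × ZMod q) : q • v = 0 := by ext <;> simp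

theorem pred_nsmul_plane (hq : 0 < q) (v : ZMod q × ZMod q) : (q - 1) • v = -v := by
  apply eq_neg_of_add_eq_zero_left
  rw [← succ_nsmul, Nat.sub_add_cancel hq, nsmul_plane]

theorem eq_replicate_of_replicate_le (hq : 0 < q) {Y : Multiset (ZMod q × ZMod q)}
    {u : ZMod q × ZMod q} (hc : card Y = q) (hs : Y.sum = 0) (h : replicate (q - 1) u ≤ Y) :
    Y = replicate q u := by
  obtain ⟨D, rfl⟩ := Multiset.le_iff_exists_add.1 h
  rw [card_add, card_replicate] at hc
  obtain ⟨y, rfl⟩ := card_eq_one.1 (show card D = 1 by omega)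
  rw [sum_add, sum_replicate, sum_singleton, pred_nsmul_plane hq, neg_add_eq_zero] at hs
  rw [← hs, add_comm, singleton_add, ← replicate_succ, Nat.sub_add_cancel hq]

theorem sum_eq_left (hq : 0 < q) {F : Multiset (ZMod q × ZMod q)} {e : ZMod q × ZMod q}
    (h : (replicate (q - 1) e + F).sum = 0) : F.sum = e := by
  rw [sum_add, sum_replicate, pred_nsmul_plane hq, neg_add_eq_zero] at h
  exact h.symm

theorem add_le_of_disjoint {α : Type*} [DecidableEq α] {A B Z : Multiset α} (hA : A ≤ Z)
    (hB : B ≤ Z) (h : ∀ a ∈ A, a ∉ B) : A + B ≤ Z := by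
  rw [le_iff_count] at *
  intro a
  rw [count_add]
  by_cases ha : a ∈ A
  · rw [count_eq_zero.2 (h a ha), add_zero]; exact hA a
  · rw [count_eq_zero.2 ha, zero_add]; exact hB a

namespace Rep

variable {Z F Y : Multiset (ZMod q × ZMod q)} {e f : ZMod q × ZMod q}
  {α β : ZMod q × ZMod q →ₗ[ZMod q] ZMod q}

theorem left_le (h : Rep Z e f α β F Y) : replicate (q - 1) e ≤ Z := by
  rw [h.eq_add, add_assoc]; exact Multiset.le_add_right _ _

theorem left_mem (hq : 2 ≤ q) (h : Rep Z e f α β F Y) : e ∈ Z :=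
  mem_of_le h.left_le (mem_replicate.2 ⟨by omega, rfl⟩)

theorem sum_F (hq : 2 ≤ q) (h : Rep Z e f α β F Y) : F.sum = e :=
  sum_eq_left (by omega) h.sum_left

/-- A term with `β z = 0` is a multiple of `e`, and copies of `e` complete it to a zero-sum
subsequence of length at most `q`. Equality, which is forced, means `z = e`. -/
theorem eq_left (hq : 2 ≤ q) (h : Rep Z e f α β F Y) (hns : NoShort q Z) {z : ZMod q × ZMod q}
    (hz : z ∈ Z) (hβ : β z = 0) : z = e := by
  have : NeZero q := ⟨by omega⟩
  have : Fact (1 < q) := ⟨by omega⟩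
  rw [h.eq_add, mem_add, mem_add] at hz
  rcases hz with (hz | hz) | hz
  · exact eq_of_mem_replicate hz
  · rw [h.snd_eq_one z hz] at hβ
    exact absurd hβ one_ne_zero
  · set k := (-(α z)).val with hk
    have hkq : k < q := ZMod.val_lt _
    have h1 := hns (replicate k e + {z}) (by
      rw [h.eq_add, add_assoc]
      exact add_le_add ((replicate_le_replicate e).2 (by omega))
        ((singleton_le.2 hz).trans (Multiset.le_add_left _ _)))
      (by rw [← card_pos]; simp)
      (by
        apply h.coord.eq_zero
        · rw [sum_add, sum_replicate, sum_singleton, map_add, apply_nsmul, h.coord.fst_left, hk,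
            ZMod.natCast_zmod_val]
          ring
        · rw [sum_add, sum_replicate, sum_singleton, map_add, apply_nsmul, h.coord.snd_left, hβ]
          ring)
    rw [card_add, card_replicate, card_singleton] at h1
    have h2 : (k : ZMod q) = -1 := by
      have : k + 1 = q := by omega
      have := congrArg (Nat.cast : ℕ → ZMod q) this
      rw [ZMod.natCast_self] at this
      push_cast at this
      linear_combination this
    rw [hk, ZMod.natCast_zmod_val] at h2
    apply h.coord.ext
    · rw [h.coord.fst_left]; linear_combination -h2
    · rw [h.coord.snd_left, hβ]

theorem ne_left_of_snd (h : Rep Z e f α β F Y) {v : ZMod q × ZMod q} (hv : β v ≠ 0) : v ≠ e := by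
  rintro rfl; exact hv h.coord.snd_left

end Rep

theorem exists_rep_of_le (hq : 2 ≤ q) {Z W : Multiset (ZMod q × ZMod q)} (hZ : IsTame q Z)
    (hZs : Z.sum = 0) (hZc : card Z = 3 * q - 1) (hW : W ≤ Z) (hWs : W.sum = 0)
    (hWc : card W = 2 * q - 1) :
    ∃ e f α β F, Rep Z e f α β F (Z - W) ∧ W = replicate (q - 1) e + F := by
  obtain ⟨e, he⟩ := hZ.exists_base W hW hWs hWc
  obtain ⟨F, f, α, β, rfl, hF, hco, -, hβ⟩ :=
    exists_coord_of_replicate_le hq (hZ.noShort.mono hW) hWs hWc he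
  refine ⟨e, f, α, β, F, ⟨hco, ?_, hβ, hF, ?_, hWs, sum_sub_eq_zero hW hWs hZs⟩, rfl⟩
  · rw [add_comm, Multiset.sub_add_cancel hW]
  · rw [card_sub hW]; omega

/-- The block is chosen among the `3q - 2` terms other than the given copy of `z`, so that `z` stays
in the long part. -/
theorem exists_rep (hq : 2 ≤ q) {Z : Multiset (ZMod q × ZMod q)} (hZ : IsTame q Z)
    (hZs : Z.sum = 0) (hZc : card Z = 3 * q - 1) {z : ZMod q × ZMod q} (hz : z ∈ Z) :
    ∃ e f α β F Y, Rep Z e f α β F Y ∧ z ∈ replicate (q - 1) e + F := by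
  obtain ⟨-, hη⟩ := davenportBound_and_etaBound q (by omega)
  obtain ⟨Y, hY, hY0, hYs, hYc⟩ := hη (Z.erase z) (by
    rw [card_erase_of_mem hz, Nat.pred_eq_sub_one]; omega)
  have hYZ := hY.trans (erase_le z Z)
  have hYc' := hZ.noShort Y hYZ hY0 hYs
  obtain ⟨e, f, α, β, F, hR, hW⟩ := exists_rep_of_le hq hZ hZs hZc (W := Z - Y)
    (Multiset.sub_le_self _ _) (sum_sub_eq_zero hYZ hYs hZs) (by rw [card_sub hYZ]; omega)
  refine ⟨e, f, α, β, F, _, hR, ?_⟩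
  rw [← hW]
  have : Z = z ::ₘ (Z.erase z - Y) + Y := by
    rw [cons_add, Multiset.sub_add_cancel hY, cons_erase hz]
  rw [this, Multiset.add_sub_cancel_right]
  exact mem_cons_self _ _

/-- A decomposition whose block is constant and off the line. -/
def HasConstantBlock (Z : Multiset (ZMod q × ZMod q)) : Prop :=
  ∃ e f α β F g, Rep Z e f α β F (replicate q g) ∧ β g ≠ 0 ∧ β g ≠ 1

/-- Comparison of two decompositions of the same sequence. -/
theorem Rep.compare (hq : 2 ≤ q) {Z F Y F' Y' : Multiset (ZMod q × ZMod q)}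
    {e f e' f' g : ZMod q × ZMod q} {α β α' β' : ZMod q × ZMod q →ₗ[ZMod q] ZMod q}
    (hns : NoShort q Z) (h : Rep Z e f α β F Y) (h' : Rep Z e' f' α' β' F' Y')
    (hg : g ∈ replicate (q - 1) e' + F') (hg0 : β g ≠ 0) (hg1 : β g ≠ 1) :
    (β e' = 1 ∧ ∃ α₁, Coord e e' α₁ β ∧ g ∈ F' ∧ (∀ v ∈ F', α₁ v = α₁ g) ∧ β' e * α₁ g = 1 ∧
      (α₁ g ≠ 1 → Y' = replicate q e)) ∨
    (β e' ≠ 0 ∧ β e' ≠ 1 ∧ Y = replicate q e') := by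
  have : NeZero q := ⟨by omega⟩
  have : Fact (1 < q) := ⟨by omega⟩
  by_cases h0 : β e' = 0
  -- Here `e' = e` and `β'` is proportional to `β`, so `F'` lies on the parallel line through `g`
  -- and avoids `F`. Thus `F'` is the block `Y`, but `F'` has sum `e` while `Y` has sum `0`.
  · exfalso
    obtain rfl := h.eq_left hq hns (h'.left_mem hq) h0
    have hgF : g ∈ F' := by
      rcases mem_add.1 hg with hg | hg
      · exact absurd (eq_of_mem_replicate hg) (h.ne_left_of_snd hg0)
      · exact hg
    have hβ' : ∀ v, β' v = β v * β' f := fun v => by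
      conv_lhs => rw [h.coord.eq_comb v]
      simp [h'.coord.snd_left]
    have hx : β g * β' f = 1 := by rw [← hβ', h'.snd_eq_one g hgF]
    have hall : ∀ v ∈ F', β v = β g := fun v hv => by
      have h1 : β v * β' f = 1 := by rw [← hβ', h'.snd_eq_one v hv]
      linear_combination β g * h1 - β v * hx
    have hFY : F' ≤ Y := by
      have h1 : replicate (q - 1) e' + F' ≤ replicate (q - 1) e' + (F + Y) := by
        rw [← add_assoc, ← h.eq_add, h'.eq_add]; exact Multiset.le_add_right _ _
      refine le_of_le_add_of_notMem_left ((Multiset.add_le_add_iff_left).1 h1) fun v hv hvF => ?_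
      exact hg1 (by rw [← hall v hv, h.snd_eq_one v hvF])
    have hFY' : F' = Y := eq_of_le_of_card_le hFY (by rw [h.card_right, h'.card_left])
    have h2 := h'.sum_F hq
    rw [hFY', h.sum_right] at h2
    have := h.coord.fst_left
    rw [← h2, map_zero] at this
    exact zero_ne_one this
  by_cases h1 : β e' = 1
  · left
    refine ⟨h1, _, h.coord.change_one h1, ?_⟩
    have hco := h.coord.change_one h1
    set α₁ := α - α e' • β with hα₁
    have hgF : g ∈ F' := by
      rcases mem_add.1 hg with hg | hg
      · rw [eq_of_mem_replicate hg] at hg1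
        exact absurd h1 hg1
      · exact hg
    have hβ' : ∀ v, β' v = α₁ v * β' e := fun v => by
      conv_lhs => rw [hco.eq_comb v]
      simp [h'.coord.snd_left]
    have hx : α₁ g * β' e = 1 := by rw [← hβ', h'.snd_eq_one g hgF]
    have hall : ∀ v ∈ F', α₁ v = α₁ g := fun v hv => by
      have h1 : α₁ v * β' e = 1 := by rw [← hβ', h'.snd_eq_one v hv]
      linear_combination α₁ g * h1 - α₁ v * hx
    refine ⟨hgF, hall, by rw [mul_comm]; exact hx, fun hne => ?_⟩
    apply eq_replicate_of_replicate_le (by omega) h'.card_right h'.sum_right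
    have h2 : replicate (q - 1) e ≤ replicate (q - 1) e' + F' + Y' := by
      rw [← h'.eq_add]; exact h.left_le
    refine le_of_le_add_of_notMem_left h2 fun v hv hv' => ?_
    rw [eq_of_mem_replicate hv] at hv'
    rcases mem_add.1 hv' with hv' | hv'
    · have := eq_of_mem_replicate hv'
      rw [← this, h.coord.snd_left] at h1
      exact zero_ne_one h1
    · exact hne (by rw [← hall e hv', hco.fst_left])
  · right
    refine ⟨h0, h1, ?_⟩
    -- Being neither `e` nor on the line, all `q - 1` copies of `e'` lie in `Y`, and the zero sum
    -- fixes its last term.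
    apply eq_replicate_of_replicate_le (by omega) h.card_right h.sum_right
    have h2 : replicate (q - 1) e' ≤ replicate (q - 1) e + F + Y := by
      rw [← h.eq_add]; exact h'.left_le
    refine le_of_le_add_of_notMem_left h2 fun v hv hv' => ?_
    rw [eq_of_mem_replicate hv] at hv'
    rcases mem_add.1 hv' with hv' | hv'
    · exact h.ne_left_of_snd h0 (eq_of_mem_replicate hv')
    · exact h1 (h.snd_eq_one e' hv')

/-- A decomposition with `g` in its long part is compared with the given one. Every outcome except a
base `e'` on the line with `α₁ g = 1` produces a constant block off the line. -/
theorem Rep.exists_second (hq : 2 ≤ q) {Z F Y : Multiset (ZMod q × ZMod q)}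
    {e f g : ZMod q × ZMod q} {α β : ZMod q × ZMod q →ₗ[ZMod q] ZMod q} (hZ : IsTame q Z)
    (hZs : Z.sum = 0) (hZc : card Z = 3 * q - 1) (hno : ¬ HasConstantBlock Z)
    (h : Rep Z e f α β F Y) (hg : g ∈ Z) (hg0 : β g ≠ 0) (hg1 : β g ≠ 1) :
    ∃ e' α₁ F' Y', Coord e e' α₁ β ∧ Rep Z e' e β α₁ F' Y' ∧ α₁ g = 1 := by
  obtain ⟨e', f', α', β', F', Y', h', hgW⟩ := exists_rep hq hZ hZs hZc hg
  rcases h.compare hq hZ.noShort h' hgW hg0 hg1 with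
    ⟨h1, α₁, hco, hgF, hall, hx, hY'⟩ | ⟨h0, h1, rfl⟩
  · by_cases hα : α₁ g = 1
    · refine ⟨e', α₁, F', Y', hco, ⟨hco.swap, h'.eq_add, ?_, h'.card_left, h'.card_right,
        h'.sum_left, h'.sum_right⟩, hα⟩
      intro v hv
      rw [hall v hv, hα]
    · obtain rfl := hY' hα
      refine absurd ⟨e', f', α', β', F', e, h', ?_, ?_⟩ hno
      · intro h2
        have : Fact (1 < q) := ⟨by omega⟩
        rw [h2, zero_mul] at hx
        exact zero_ne_one hx
      · intro h2
        rw [h2, one_mul] at hx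
        exact hα hx
  · exact absurd ⟨e, f, α, β, F, e', h, h0, h1⟩ hno

/-- If the line part contains `e₂` with multiplicity `q - 1`, its last term is `e₁ + e₂`. -/
theorem Rep.eq_of_replicate_le (hq : 2 ≤ q) {Z F Y : Multiset (ZMod q × ZMod q)}
    {e f e₂ : ZMod q × ZMod q} {α β : ZMod q × ZMod q →ₗ[ZMod q] ZMod q}
    (h : Rep Z e f α β F Y) (hle : replicate (q - 1) e₂ ≤ F) :
    F = replicate (q - 1) e₂ + {e + e₂} := by
  obtain ⟨D, hD⟩ := Multiset.le_iff_exists_add.1 hle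
  have hc := h.card_left
  rw [hD, card_add, card_replicate] at hc
  obtain ⟨y, rfl⟩ := card_eq_one.1 (show card D = 1 by omega)
  have hs := h.sum_F hq
  rw [hD, sum_add, sum_replicate, sum_singleton, pred_nsmul_plane (by omega)] at hs
  rw [hD, ← hs]
  congr 2
  abel

theorem Rep.isGood_of_replicate_le (hq : 2 ≤ q) {Z F : Multiset (ZMod q × ZMod q)}
    {e f e₂ g : ZMod q × ZMod q} {α β : ZMod q × ZMod q →ₗ[ZMod q] ZMod q}
    (h : Rep Z e f α β F (replicate q g)) (hco : Coord e e₂ α β)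
    (hle : replicate (q - 1) e₂ ≤ F) (hg : α g = 1) : IsGood Z := by
  refine ⟨e₂, e, β, α, hco.swap, fun v hv => ?_⟩
  rw [h.eq_add, h.eq_of_replicate_le hq hle, mem_add, mem_add, mem_add] at hv
  rcases hv with (hv | hv | hv) | hv
  · rw [eq_of_mem_replicate hv]; exact Or.inr hco.fst_left
  · exact Or.inl (eq_of_mem_replicate hv)
  · rw [mem_singleton.1 hv, map_add, hco.fst_left, hco.fst_right, add_zero]; exact Or.inr rfl
  · rw [eq_of_mem_replicate hv]; exact Or.inr hg

/-- The decomposition `e^{q-1} F g^q` is compared with one having `g` in the long part. A base `e'`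
of the latter on the line gives a good sequence. Otherwise `e' = g`, and matching the two long parts
yields `g = κ(e₂ - e)` with `e₂` occurring at least `κ` times in `F`; then `val_sum_lt_of_noShort`
determines `F`. -/
theorem HasConstantBlock.isGood_or_isExotic (hq : 2 ≤ q) {Z : Multiset (ZMod q × ZMod q)}
    (hZ : IsTame q Z) (hZs : Z.sum = 0) (hZc : card Z = 3 * q - 1) (h : HasConstantBlock Z) :
    IsGood Z ∨ IsExotic Z := by
  have : NeZero q := ⟨by omega⟩
  have : Fact (1 < q) := ⟨by omega⟩
  obtain ⟨e, f, α, β, F, g, h, hg0, hg1⟩ := h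
  have hgZ : g ∈ Z := by
    rw [h.eq_add]; exact mem_add.2 (Or.inr (mem_replicate.2 ⟨by omega, rfl⟩))
  have hgF : g ∉ F := fun hgF => hg1 (h.snd_eq_one g hgF)
  have heF : e ∉ F := fun heF => by
    have := h.snd_eq_one e heF
    rw [h.coord.snd_left] at this
    exact zero_ne_one this
  have hge : g ≠ e := h.ne_left_of_snd hg0
  obtain ⟨e', f', α', β', F', Y', h', hgW⟩ := exists_rep hq hZ hZs hZc hgZ
  rcases h.compare hq hZ.noShort h' hgW hg0 hg1 with
    ⟨h1, α₁, hco, hgF', hall, hx, hY'⟩ | ⟨h0, h1, hY⟩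
  · left
    have hR : Rep Z e e' α₁ β F (replicate q g) :=
      ⟨hco, h.eq_add, h.snd_eq_one, h.card_left, h.card_right, h.sum_left, h.sum_right⟩
    have hle : replicate (q - 1) e' ≤ F := by
      have h2 : replicate (q - 1) e' ≤ replicate (q - 1) e + F + replicate q g := by
        rw [← h.eq_add]; exact h'.left_le
      have h3 := le_of_le_add_of_notMem_right h2 fun v hv hv' => by
        rw [eq_of_mem_replicate hv] at hv'
        rw [eq_of_mem_replicate hv'] at h1
        exact hg1 h1
      refine le_of_le_add_of_notMem_left h3 fun v hv hv' => ?_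
      rw [eq_of_mem_replicate hv] at hv'
      rw [eq_of_mem_replicate hv', h.coord.snd_left] at h1
      exact zero_ne_one h1
    refine hR.isGood_of_replicate_le hq hco hle ?_
    -- Otherwise the second block is `e^q`, whereas `e` occurs only `q - 1` times in `Z`.
    by_contra hne
    have h2 : replicate q e ≤ replicate (q - 1) e + F + replicate q g := by
      rw [← h.eq_add, h'.eq_add, hY' hne]; exact Multiset.le_add_left _ _
    have h3 := le_count_iff_replicate_le.2 h2
    rw [count_add, count_add, count_replicate_self, count_eq_zero.2 heF, count_replicate,
      if_neg hge] at h3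
    omega
  · have hq0 : q ≠ 0 := by omega
    obtain rfl : g = e' := by
      have : g ∈ replicate q g := mem_replicate.2 ⟨hq0, rfl⟩
      rw [hY] at this
      exact eq_of_mem_replicate this
    set κ := (β g).val with hκ
    have hκβ : (κ : ZMod q) = β g := ZMod.natCast_zmod_val _
    have hκq : κ < q := ZMod.val_lt _
    have hκ0 : κ ≠ 0 := fun h2 => hg0 (by rw [← hκβ, h2, Nat.cast_zero])
    have hκ1 : κ ≠ 1 := fun h2 => hg1 (by rw [← hκβ, h2, Nat.cast_one])
    have hF'le : F' ≤ replicate (q - 1) e + F := by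
      have h2 : F' ≤ replicate (q - 1) e + F + replicate q g := by
        rw [← h.eq_add, h'.eq_add, add_assoc, add_left_comm]; exact Multiset.le_add_right _ _
      refine le_of_le_add_of_notMem_right h2 fun v hv hv' => ?_
      have := h'.snd_eq_one v hv
      rw [eq_of_mem_replicate hv', h'.coord.snd_left] at this
      exact zero_ne_one this
    have hF'β : ∀ v ∈ F', v ≠ e → v ∈ F := fun v hv hne => by
      rcases mem_add.1 (mem_of_le hF'le hv) with h2 | h2
      · exact absurd (eq_of_mem_replicate h2) hne
      · exact h2
    set D := F'.filter (fun v => v ≠ e) with hD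
    have hsplit : F' = F'.filter (fun v => v = e) + D := (filter_add_not _ _).symm
    have hDF : D ≤ F := by
      refine le_of_le_add_of_notMem_left ((filter_le _ _).trans hF'le) fun v hv hv' => ?_
      exact (mem_filter.1 hv).2 (eq_of_mem_replicate hv')
    -- `F'` sums to `g`; its terms equal to `e` contribute `0` to `β` and those in `D` contribute
    -- `1`. This fixes `|D|` modulo `q`, and `|D| ≤ q` with `0 < κ < q` fixes it exactly.
    have hDc : card D = κ := by
      have h2 : β F'.sum = β g := by rw [h'.sum_F hq]
      rw [hsplit, sum_add, map_add, map_sum_multiset, map_sum_multiset,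
        sum_map_eq_card β 0 _ fun v hv => by rw [(mem_filter.1 hv).2, h.coord.snd_left],
        sum_map_eq_card β 1 D fun v hv => h.snd_eq_one v (mem_of_le hDF hv), ← hκβ] at h2
      have h3 : ((card D : ℕ) : ZMod q) = (κ : ℕ) := by simpa using h2
      have h4 := card_le_card hDF
      rw [h.card_left] at h4
      rw [ZMod.natCast_eq_natCast_iff'] at h3
      rw [Nat.mod_eq_of_lt hκq] at h3
      rcases Nat.lt_or_ge (card D) q with h5 | h5
      · rwa [Nat.mod_eq_of_lt h5] at h3
      · have : card D = q := by omega
        rw [this, Nat.mod_self] at h3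
        omega
    have heF' : e ∈ F' := by
      have h2 := congrArg card hsplit
      rw [card_add, h'.card_left, hDc] at h2
      obtain ⟨v, hv⟩ := card_pos_iff_exists_mem.1
        (show 0 < card (F'.filter (fun v => v = e)) by omega)
      rw [mem_filter] at hv
      exact hv.2 ▸ hv.1
    have hβ'e := h'.snd_eq_one e heF'
    obtain ⟨e₂, he₂⟩ := card_pos_iff_exists_mem.1 (show 0 < card D by omega)
    have hβ'₂ := h'.snd_eq_one e₂ (mem_filter.1 he₂).1
    have hβ₂ : β e₂ = 1 := h.snd_eq_one e₂ (mem_of_le hDF he₂)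
    have hco := h.coord.change_one hβ₂
    set α₁ := α - α e₂ • β with hα₁
    have hβ' : ∀ v, β' v = α₁ v + β v := fun v => by
      conv_lhs => rw [hco.eq_comb v]
      simp [hβ'e, hβ'₂]
    have hDeq : D = replicate κ e₂ := by
      rw [eq_replicate]
      refine ⟨hDc, fun v hv => hco.ext ?_ ?_⟩
      · have h2 := h'.snd_eq_one v (mem_filter.1 hv).1
        rw [hβ', h.snd_eq_one v (mem_of_le hDF hv)] at h2
        rw [hco.fst_right]
        linear_combination h2
      · rw [hβ₂, h.snd_eq_one v (mem_of_le hDF hv)]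
    have hκF : κ ≤ F.count e₂ := by
      rw [le_count_iff_replicate_le, ← hDeq]; exact hDF
    have hαg : α₁ g = -κ := by
      have h2 := h'.coord.snd_left
      rw [hβ', ← hκβ] at h2
      linear_combination h2
    have hgeq : g = κ • (e₂ - e) := by
      apply hco.ext
      · rw [apply_nsmul, map_sub, hco.fst_left, hco.fst_right, hαg]; ring
      · rw [apply_nsmul, map_sub, hco.snd_left, hco.snd_right, ← hκβ]; ring
    have hunit : IsUnit (κ : ZMod q) := by
      have h2 := h'.coord.eq_comb (e₂ - e)
      rw [map_sub β', hβ'₂, hβ'e, sub_self, zero_smul, add_zero] at h2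
      have h3 := congrArg β h2
      rw [map_sub, hβ₂, h.coord.snd_left, map_smul, ← hκβ, smul_eq_mul, sub_zero] at h3
      exact IsUnit.of_mul_eq_one _ (by rw [mul_comm]; exact h3.symm)
    have hR : Rep Z e e₂ α₁ β F (replicate q g) :=
      ⟨hco, h.eq_add, h.snd_eq_one, h.card_left, h.card_right, h.sum_left, h.sum_right⟩
    rcases Nat.lt_or_ge (κ + 1) q with hlt | hge'
    · right
      have hns := hZ.noShort
      rw [h.eq_add, hgeq] at hns
      have hlt' := val_sum_lt_of_noShort hco (by omega) hlt hunit h.snd_eq_one hκF hns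
      -- The total is congruent to `1`, because `F` sums to `e`, and it is less than `q`. Hence all
      -- terms of `F` but one are `e₂`.
      have hone : (F.map fun v => (α₁ v).val).sum = 1 := by
        have h2 : (((F.map fun v => (α₁ v).val).sum : ℕ) : ZMod q) = ((1 : ℕ) : ZMod q) := by
          rw [Nat.cast_multiset_sum, Multiset.map_map, Nat.cast_one, ← hco.fst_left, ← h.sum_F hq,
            map_sum_multiset]
          exact congrArg _ (map_congr rfl fun v _ => by simp)
        rw [ZMod.natCast_eq_natCast_iff', Nat.mod_eq_of_lt hlt', Nat.mod_eq_of_lt (by omega)] at h2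
        exact h2
      obtain ⟨v, hv, hv0⟩ : ∃ v ∈ F, (α₁ v).val ≠ 0 := by
        by_contra hcon
        push Not at hcon
        have : (F.map fun v => (α₁ v).val).sum = 0 := by
          apply Multiset.sum_eq_zero
          intro x hx
          obtain ⟨v, hv, rfl⟩ := mem_map.1 hx
          exact hcon v hv
        omega
      rw [← cons_erase hv, map_cons, sum_cons] at hone
      have hle : replicate (q - 1) e₂ ≤ F := by
        have h2 : F.erase v = replicate (q - 1) e₂ := by
          rw [eq_replicate]
          refine ⟨by rw [card_erase_of_mem hv, h.card_left, Nat.pred_eq_sub_one], fun w hw => ?_⟩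
          apply hco.ext
          · have h3 := single_le_sum (fun x _ => Nat.zero_le x) _
              (mem_map_of_mem (fun v => (α₁ v).val) hw)
            rw [hco.fst_right, ← ZMod.val_eq_zero]
            omega
          · rw [hβ₂, h.snd_eq_one w (mem_of_mem_erase hw)]
        rw [← h2]; exact erase_le _ _
      refine ⟨e, e₂, α₁, β, hco, κ, q - 1, q - 1, q, by omega, hlt, hunit, ?_, ?_, dvd_rfl,
        by omega, ?_⟩
      · rw [Nat.sub_add_cancel (by omega)]
      · rw [Nat.sub_add_cancel (by omega)]
      · rw [h.eq_add, hR.eq_of_replicate_le hq hle, hgeq, add_assoc, add_assoc, add_assoc,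
          add_assoc]
    -- For `κ = q - 1` the block term is `e - e₂`, which lies on the line `e + ⟨e₂⟩`.
    · left
      refine hR.isGood_of_replicate_le hq hco ?_ ?_
      · rw [← le_count_iff_replicate_le]; omega
      · have h2 : κ + 1 = q := by omega
        have h3 := congrArg (Nat.cast : ℕ → ZMod q) h2
        rw [ZMod.natCast_self] at h3
        push_cast at h3
        rw [hαg]
        linear_combination -h3

end ZeroSum

/-! ### Tame sequences of length `3q - 1` without constant block -/

namespace ZeroSum

open Multiset hiding map_add map_nsmul map_zero

variable {q : ℕ}

theorem val_ge_two {c : ZMod q} (hq : 2 ≤ q) (h0 : c ≠ 0) (h1 : c ≠ 1) : 2 ≤ c.val := by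
  have : NeZero q := ⟨by omega⟩
  have e : ((c.val : ℕ) : ZMod q) = c := ZMod.natCast_zmod_val c
  have : c.val ≠ 0 := fun h => h0 (by rw [← e, h, Nat.cast_zero])
  have : c.val ≠ 1 := fun h => h1 (by rw [← e, h, Nat.cast_one])
  omega

theorem natCast_sub_self {k : ℕ} (h : k ≤ q) : ((q - k : ℕ) : ZMod q) = -k := by
  rw [Nat.cast_sub h, ZMod.natCast_self, zero_sub]

theorem val_neg_natCast_sub_one {k : ℕ} (h : k < q) : (-(k : ZMod q) - 1).val = q - 1 - k := by
  have : NeZero q := ⟨by omega⟩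
  have e : -(k : ZMod q) - 1 = ((q - 1 - k : ℕ) : ZMod q) := by
    rw [Nat.cast_sub (by omega), Nat.cast_sub (by omega), ZMod.natCast_self]; push_cast; ring
  rw [e, ZMod.val_natCast, Nat.mod_eq_of_lt (by omega)]

/-- Otherwise `r` yields a third base `e₃` on the line, different from `e₂`. Three elements of
multiplicity `q - 1` leave room only for `r` and `g`, and this rigid sequence contains a zero-sum
subsequence shorter than `q`. -/
theorem Rep.fst_eq_one (hq : 2 ≤ q) {Z F Y F₂ Y₂ : Multiset (ZMod q × ZMod q)}
    {e₁ e₂ g r : ZMod q × ZMod q} {α β : ZMod q × ZMod q →ₗ[ZMod q] ZMod q} (hZ : IsTame q Z)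
    (hZs : Z.sum = 0) (hZc : card Z = 3 * q - 1) (hno : ¬ HasConstantBlock Z)
    (h₁ : Rep Z e₁ e₂ α β F Y) (h₂ : Rep Z e₂ e₁ β α F₂ Y₂) (hg : g ∈ Z) (hg0 : β g ≠ 0)
    (hg1 : β g ≠ 1) (hgα : α g = 1) (hr : r ∈ Z) (hr0 : β r ≠ 0) (hr1 : β r ≠ 1) : α r = 1 := by
  have : NeZero q := ⟨by omega⟩
  have : Fact (1 < q) := ⟨by omega⟩
  by_contra hrα
  obtain ⟨e₃, α₃, F₃, Y₃, hco₃, h₃, hr3⟩ := h₁.exists_second hq hZ hZs hZc hno hr hr0 hr1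
  have hco := h₁.coord
  set c := α e₃ with hc
  have hα : ∀ v, α v = α₃ v + β v * c := fun v => by
    conv_lhs => rw [hco₃.eq_comb v]
    simp [hco.fst_left, hc]
  have hαr : α r = 1 + β r * c := by rw [hα, hr3]
  have hc0 : c ≠ 0 := fun h0 => hrα (by rw [hαr, h0, mul_zero, add_zero])
  have hβ₃ := hco₃.snd_right
  have hne23 : e₂ ≠ e₃ := fun h => hc0 (by rw [hc, ← h, hco.fst_right])
  have hne12 : e₁ ≠ e₂ := fun h => by
    have := hco.snd_left; rw [h, hco.snd_right] at this; exact one_ne_zero this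
  have hne13 : e₁ ≠ e₃ := fun h => by
    have := hco.snd_left; rw [h, hβ₃] at this; exact one_ne_zero this
  have hrg : r ≠ g := fun h => hrα (by rw [h, hgα])
  have hbad : ∀ v, β v ≠ 0 → β v ≠ 1 → v ≠ e₁ ∧ v ≠ e₂ ∧ v ≠ e₃ := fun v h0 h1 =>
    ⟨fun h => h0 (by rw [h, hco.snd_left]), fun h => h1 (by rw [h, hco.snd_right]),
      fun h => h1 (by rw [h, hβ₃])⟩
  obtain ⟨hr_1, hr_2, hr_3⟩ := hbad r hr0 hr1
  obtain ⟨hg_1, hg_2, hg_3⟩ := hbad g hg0 hg1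
  have hM : Z = replicate (q - 1) e₁ + (replicate (q - 1) e₂ + (replicate (q - 1) e₃ +
      ({r} + {g}))) := by
    symm
    apply eq_of_le_of_card_le
    · refine add_le_of_disjoint h₁.left_le (add_le_of_disjoint h₂.left_le (add_le_of_disjoint
        h₃.left_le (add_le_of_disjoint (singleton_le.2 hr) (singleton_le.2 hg) ?_) ?_) ?_) ?_
      · intro a ha; rw [mem_singleton] at ha ⊢; rw [ha]; exact hrg
      · intro a ha
        rw [eq_of_mem_replicate ha]
        simp [hr_3.symm, hg_3.symm]
      · intro a ha
        rw [eq_of_mem_replicate ha]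
        simp [hr_2.symm, hg_2.symm, mem_replicate, hne23]
      · intro a ha
        rw [eq_of_mem_replicate ha]
        simp [hr_1.symm, hg_1.symm, mem_replicate, hne12, hne13]
    · simp only [card_add, card_replicate, card_singleton, hZc]; omega
  have hsum : r + g = e₁ + e₂ + e₃ := by
    have h := hZs
    rw [hM] at h
    simp only [sum_add, sum_replicate, sum_singleton, pred_nsmul_plane (show 0 < q by omega)] at h
    rw [← sub_eq_zero, ← h]; abel
  have hb : β g = 2 - β r := by
    have := congrArg β hsum
    simp only [map_add, hco.snd_left, hco.snd_right, hβ₃] at this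
    linear_combination this
  have hcb : c * (1 - β r) = 1 := by
    have := congrArg α hsum
    simp only [map_add, hco.fst_left, hco.fst_right, ← hc, hαr, hgα] at this
    linear_combination -this
  set b := (β r).val with hbdef
  have hbq : b < q := ZMod.val_lt _
  have hb2 : 2 ≤ b := val_ge_two hq hr0 hr1
  have hbc : (b : ZMod q) = β r := ZMod.natCast_zmod_val _
  set d := q - c.val with hd
  have hcq : c.val < q := ZMod.val_lt _
  have hcv : ((c.val : ℕ) : ZMod q) = c := ZMod.natCast_zmod_val _
  have hdc : (d : ZMod q) = -c := by rw [hd, natCast_sub_self hcq.le, hcv]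
  have hns := hZ.noShort
  rw [hM] at hns
  have hrep : ∀ (u : ZMod q × ZMod q) {k : ℕ}, k ≤ q - 1 → replicate k u ≤ replicate (q - 1) u :=
    fun u k hk => (replicate_le_replicate u).2 hk
  -- This says `d ≤ b - 1`.
  have hz1 : q ≤ c.val + (0 + (b - 2 + 1)) := by
    have h := hns (replicate c.val e₁ + (replicate 0 e₂ + (replicate (b - 2) e₃ + (0 + {g}))))
      (add_le_add (hrep _ (by omega)) (add_le_add (hrep _ (by omega)) (add_le_add
        (hrep _ (by omega)) (add_le_add (Multiset.zero_le _) le_rfl))))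
      (by rw [← card_pos]; simp)
      (by
        have hb2c : ((b - 2 : ℕ) : ZMod q) = β r - 2 := by rw [Nat.cast_sub hb2, hbc]; rfl
        apply hco.eq_zero
        · simp only [sum_add, sum_replicate, sum_singleton, sum_zero, map_add, map_zero,
            apply_nsmul, hco.fst_left, hco.fst_right, ← hc, hgα, hcv, hb2c]
          linear_combination -hcb
        · simp only [sum_add, sum_replicate, sum_singleton, sum_zero, map_add, map_zero,
            apply_nsmul, hco.snd_left, hco.snd_right, hβ₃, hb, hb2c]
          ring)
    simpa only [card_add, card_replicate, card_singleton, card_zero, zero_add] using h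
  -- The conclusion says `l * d ≤ q - b`: the multiples of `d` avoid the interval from `q - b + 1`
  -- to `q - 1`, which has `b - 1` elements.
  have hz2 : ∀ l, l ≤ q - b → l * d < q → q ≤ (q - 1 - l * d) + (l + (q - b - l + 1)) := by
    intro l hl hld
    have hcast : ((q - 1 - l * d : ℕ) : ZMod q) = l * c - 1 := by
      have h := val_neg_natCast_sub_one hld
      rw [← h, ZMod.natCast_zmod_val, Nat.cast_mul, hdc]; ring
    have hcast2 : ((q - b - l : ℕ) : ZMod q) = -β r - l := by
      rw [Nat.cast_sub hl, natCast_sub_self hbq.le, hbc]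
    have h := hns (replicate (q - 1 - l * d) e₁ + (replicate l e₂ + (replicate (q - b - l) e₃ +
        ({r} + 0))))
      (add_le_add (hrep _ (by omega)) (add_le_add (hrep _ (by omega)) (add_le_add
        (hrep _ (by omega)) (add_le_add le_rfl (Multiset.zero_le _)))))
      (by rw [← card_pos]; simp)
      (by
        apply hco.eq_zero
        · simp only [sum_add, sum_replicate, sum_singleton, sum_zero, map_add, map_zero,
            apply_nsmul, hco.fst_left, hco.fst_right, ← hc, hαr, hcast, hcast2]
          ring
        · simp only [sum_add, sum_replicate, sum_singleton, sum_zero, map_add, map_zero,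
            apply_nsmul, hco.snd_left, hco.snd_right, hβ₃, hcast2]
          ring)
    simpa only [card_add, card_replicate, card_singleton, card_zero, add_zero] using h
  rcases Nat.lt_or_ge d 2 with hd1 | hd2
  · have hd1' : d = 1 := by omega
    rw [hd1', Nat.cast_one] at hdc
    apply hg0
    rw [hb]
    linear_combination -hcb + (1 - β r) * hdc
  · have hdm := Nat.div_add_mod (q - b) d
    have hml := Nat.mod_lt (q - b) (show d > 0 by omega)
    obtain ⟨x, hx⟩ : ∃ x, x = (q - b) / d := ⟨_, rfl⟩
    rw [← hx] at hdm
    have hxd : 2 * x ≤ d * x := Nat.mul_le_mul_right x hd2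
    have e1 : (x + 1) * d = d * x + d := by ring
    -- The first multiple of `d` beyond `q - b` is below `q` because `d ≤ b - 1`, so it hits the
    -- forbidden interval.
    have h := hz2 (x + 1) (by
      rcases Nat.eq_zero_or_pos x with rfl | hx0
      · omega
      · omega) (by omega)
    omega

/-- The final step of the classification without constant blocks: `b = β g` is the largest
coordinate that occurs in the remainder `R`. -/
theorem false_of_max_coordinate (hq : 2 ≤ q) {Z R : Multiset (ZMod q × ZMod q)}
    {e₁ e₂ g g' : ZMod q × ZMod q} {α β : ZMod q × ZMod q →ₗ[ZMod q] ZMod q} (hZ : IsTame q Z)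
    (hZs : Z.sum = 0) (hZc : card Z = 3 * q - 1) (hco : Coord e₁ e₂ α β)
    (hZR : Z = replicate (q - 1) e₁ + (replicate (q - 1) e₂ + R))
    (hR : ∀ v ∈ R, (α v = 1 ∧ β v ≠ 0) ∨ (β v = 1 ∧ α v ≠ 0)) (hg : g ∈ R) (hgα : α g = 1)
    (hg1 : β g ≠ 1) (hαmax : ∀ v ∈ R, (α v).val ≤ (β g).val)
    (hβmax : ∀ v ∈ R, (β v).val ≤ (β g).val) (hg' : g' ∈ R) (hg'1 : α g' ≠ 1) : False := by
  have : NeZero q := ⟨by omega⟩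
  have : Fact (1 < q) := ⟨by omega⟩
  have hRc : card R = q + 1 := by
    rw [hZR] at hZc; simp only [card_add, card_replicate] at hZc; omega
  have hRs : R.sum = e₁ + e₂ := by
    rw [hZR] at hZs
    simp only [sum_add, sum_replicate, pred_nsmul_plane (show 0 < q by omega)] at hZs
    rw [← sub_eq_zero, ← hZs]; abel
  have hg0 : β g ≠ 0 := by
    rcases hR g hg with h | h
    · exact h.2
    · exact absurd h.1 hg1
  have hRe₁ : e₁ ∉ R := fun h => by
    rcases hR _ h with h | h
    · exact h.2 hco.snd_left
    · rw [hco.snd_left] at h; exact zero_ne_one h.1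
  have hRe₂ : e₂ ∉ R := fun h => by
    rcases hR _ h with h | h
    · rw [hco.fst_right] at h; exact zero_ne_one h.1
    · exact h.2 hco.fst_right
  have hne12 : e₁ ≠ e₂ := fun h => by
    have := hco.snd_left; rw [h, hco.snd_right] at this; exact one_ne_zero this
  set b := (β g).val with hb
  have hbq : b < q := ZMod.val_lt _
  have hb2 : 2 ≤ b := val_ge_two hq hg0 hg1
  have hbc : (b : ZMod q) = β g := ZMod.natCast_zmod_val _
  set J := R.filter (fun v => α v ≠ 1) with hJ
  have hJβ : ∀ v ∈ J, β v = 1 ∧ 2 ≤ (α v).val ∧ (α v).val ≤ b ∧ v ∈ R := fun v hv => by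
    rw [hJ, mem_filter] at hv
    rcases hR v hv.1 with h | h
    · exact absurd h.1 hv.2
    · exact ⟨h.1, val_ge_two hq h.2 hv.2, hαmax v hv.1, hv.1⟩
  have hgJ : g ∉ J := fun h => (mem_filter.1 h).2 hgα
  let A : Multiset (ZMod q × ZMod q) → ℕ := fun S => (S.map fun v => (α v).val).sum
  have hAα : ∀ S, α S.sum = (A S : ZMod q) := fun S => by
    rw [map_sum_multiset, Nat.cast_multiset_sum, Multiset.map_map]
    exact congrArg _ (map_congr rfl fun v _ => by simp)
  have hAge : ∀ S ≤ J, 2 * card S ≤ A S := fun S hS => by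
    have := card_nsmul_le_sum (s := S.map fun v => (α v).val) (a := 2) (fun x hx => by
      obtain ⟨v, hv, rfl⟩ := mem_map.1 hx
      exact (hJβ v (mem_of_le hS hv)).2.1)
    simp only [card_map, smul_eq_mul] at this
    rw [mul_comm]; exact this
  have hgS : ∀ S ≤ J, {g} + S ≤ R := fun S hS =>
    add_le_of_disjoint (singleton_le.2 hg) (hS.trans (filter_le _ _)) fun a ha ha' => by
      rw [mem_singleton.1 ha] at ha'; exact hgJ (mem_of_le hS ha')
  have hSβ : ∀ S ≤ J, β S.sum = (card S : ZMod q) := fun S hS => by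
    rw [map_sum_multiset, sum_map_eq_card β 1 S fun v hv => (hJβ v (mem_of_le hS hv)).1, mul_one]
  have hrep : ∀ (u : ZMod q × ZMod q) {k : ℕ}, k ≤ q - 1 → replicate k u ≤ replicate (q - 1) u :=
    fun u k hk => (replicate_le_replicate u).2 hk
  have hβe2 : ∀ t, t ≤ q - b → ((q - b - t : ℕ) : ZMod q) = -β g - t := fun t ht => by
    rw [Nat.cast_sub ht, natCast_sub_self hbq.le, hbc]
  -- Completing `g` and `S` by copies of `e₁` and `e₂` gives a zero-sum sequence of length `2q - b -
  -- A S`, which must be at least `q`.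
  have step : ∀ S ≤ J, card S ≤ q - b → A S < q → A S ≤ q - b := by
    intro S hS hSc hA
    have hcast : ((q - 1 - A S : ℕ) : ZMod q) = -(A S : ZMod q) - 1 := by
      rw [← val_neg_natCast_sub_one hA, ZMod.natCast_zmod_val]
    have h := hZ.noShort (replicate (q - 1 - A S) e₁ + (replicate (q - b - card S) e₂ +
      ({g} + S))) (by
        rw [hZR]
        exact add_le_add (hrep _ (by omega)) (add_le_add (hrep _ (by omega)) (hgS S hS)))
      (by rw [← card_pos]; simp)
      (by
        apply hco.eq_zero
        · simp only [sum_add, sum_replicate, sum_singleton, map_add, apply_nsmul, hco.fst_left,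
            hco.fst_right, hgα, hAα, hcast]
          ring
        · simp only [sum_add, sum_replicate, sum_singleton, map_add, apply_nsmul, hco.snd_left,
            hco.snd_right, hSβ S hS, hβe2 _ hSc]
          ring)
    simp only [card_add, card_replicate, card_singleton] at h
    omega
  have claim : ∀ S ≤ J, card S ≤ q - b → A S ≤ q - b := by
    intro S
    induction S using Multiset.induction_on with
    | empty => intro _ _; simp [A]
    | cons v S ih =>
      intro hS hSc
      rw [card_cons] at hSc
      have hSJ : S ≤ J := (le_cons_self _ _).trans hS
      have h1 := ih hSJ (by omega)
      have hv := hJβ v (mem_of_le hS (mem_cons_self _ _))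
      have hAc : A (v ::ₘ S) = (α v).val + A S := by simp [A]
      by_cases hlt : A (v ::ₘ S) < q
      · exact step _ hS (by rw [card_cons]; omega) hlt
      exfalso
      -- Each term adds at most `b`, so a total reaching `q` must be exactly `q`. In this boundary
      -- case a block of length `q` splits off, and the base of the complementary long part is
      -- examined.
      have hAS : A S = q - b := by omega
      set Y := replicate (b - 1) e₁ + (replicate (q - b - card S) e₂ + ({g} + S)) with hY
      have hYZ : Y ≤ Z := by
        rw [hZR]
        exact add_le_add (hrep _ (by omega)) (add_le_add (hrep _ (by omega)) (hgS S hSJ))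
      have hYs : Y.sum = 0 := by
        have hcast : ((b - 1 : ℕ) : ZMod q) = β g - 1 := by
          rw [Nat.cast_sub (by omega), hbc, Nat.cast_one]
        apply hco.eq_zero
        · simp only [hY, sum_add, sum_replicate, sum_singleton, map_add, apply_nsmul, hco.fst_left,
            hco.fst_right, hgα, hAα, hAS, hcast, natCast_sub_self hbq.le, hbc]
          ring
        · simp only [hY, sum_add, sum_replicate, sum_singleton, map_add, apply_nsmul, hco.snd_left,
            hco.snd_right, hSβ S hSJ, hβe2 _ (show card S ≤ q - b by omega)]
          ring
      have hYc : card Y = q := by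
        simp only [hY, card_add, card_replicate, card_singleton]; omega
      obtain ⟨D, hD⟩ := Multiset.le_iff_exists_add.1 (hgS S hSJ)
      have hWY : Z = Y + (replicate (q - b) e₁ + (replicate (b - 1 + card S) e₂ + D)) := by
        rw [hZR, hY, hD]
        have e1 : replicate (q - 1) e₁ = replicate (b - 1) e₁ + replicate (q - b) e₁ := by
          rw [← replicate_add]; congr 1; omega
        have e2 : replicate (q - 1) e₂ =
            replicate (q - b - card S) e₂ + replicate (b - 1 + card S) e₂ := by
          rw [← replicate_add]; congr 1; omega
        rw [e1, e2]; abel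
      set W := replicate (q - b) e₁ + (replicate (b - 1 + card S) e₂ + D) with hW
      have hWZ : W ≤ Z := by rw [hWY]; exact Multiset.le_add_left _ _
      have hWs : W.sum = 0 := by
        rw [hWY, sum_add, hYs, zero_add] at hZs; exact hZs
      have hWc : card W = 2 * q - 1 := by
        rw [hWY, card_add, hYc] at hZc; omega
      obtain ⟨u, hu⟩ := hZ.exists_base W hWZ hWs hWc
      obtain ⟨F, f, α', β', hWF, hF, hco', -, hβ'⟩ :=
        exists_coord_of_replicate_le hq (hZ.noShort.mono hWZ) hWs hWc hu
      have hDR : D ≤ R := by rw [hD]; exact Multiset.le_add_left _ _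
      have hDe₁ : count e₁ D = 0 := count_eq_zero.2 fun h => hRe₁ (mem_of_le hDR h)
      have hDe₂ : count e₂ D = 0 := count_eq_zero.2 fun h => hRe₂ (mem_of_le hDR h)
      have hue₁ : u ≠ e₁ := by
        rintro rfl
        rw [hW, count_add, count_add, count_replicate_self, count_replicate, if_neg hne12.symm,
          hDe₁] at hu
        omega
      have hue₂ : u ≠ e₂ := by
        rintro rfl
        rw [hW, count_add, count_add, count_replicate_self, count_replicate, if_neg hne12,
          hDe₂] at hu
        omega
      have hmemF : ∀ w ∈ W, w ≠ u → β' w = 1 := fun w hw hwu => by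
        rw [hWF, mem_add] at hw
        rcases hw with hw | hw
        · exact absurd (eq_of_mem_replicate hw) hwu
        · exact hβ' w hw
      have h1' := hmemF e₁ (by
        rw [hW, mem_add, mem_replicate]; exact Or.inl ⟨by omega, rfl⟩) hue₁.symm
      have h2' := hmemF e₂ (by
        rw [hW, mem_add, mem_add]
        exact Or.inr (Or.inl (mem_replicate.2 ⟨by omega, rfl⟩))) hue₂.symm
      have huR : u ∈ R := by
        have : u ∈ W := count_pos.1 (by omega)
        rw [hW, mem_add, mem_add] at this
        rcases this with h | h | h
        · exact absurd (eq_of_mem_replicate h) hue₁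
        · exact absurd (eq_of_mem_replicate h) hue₂
        · exact mem_of_le hDR h
      -- Both `e₁` and `e₂` lie on the line of the new base `u`. As one coordinate of `u` is `1`,
      -- the other is `-1`, which forces `b = q - 1` and leaves no room for `S`.
      have hu0 : α u + β u = 0 := by
        have h := hco'.snd_left
        rw [hco.eq_comb u, map_add, map_smul, map_smul, h1', h2'] at h
        simpa using h
      have hval : ∀ c : ZMod q, c = -1 → c.val = q - 1 := by
        rintro c rfl
        have := val_neg_natCast_sub_one (q := q) (k := 0) (by omega)
        simpa using this
      have hbig : q - 1 ≤ b := by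
        rcases hR u huR with h | h
        · have := hβmax u huR
          rwa [hval (β u) (by linear_combination hu0 - h.1)] at this
        · have := hαmax u huR
          rwa [hval (α u) (by linear_combination hu0 - h.1)] at this
      have := hAge S hSJ
      have hS0 : card S ≠ 0 := fun h0 => by
        rw [card_eq_zero] at h0
        rw [h0] at hAS
        simp [A] at hAS
        omega
      omega
  have hJc : card J < q - b := by
    by_contra hge
    obtain ⟨S, hS, hSc⟩ := exists_le_card_eq (S := J) (k := q - b) (by omega)
    have h1 := claim S hS hSc.le
    have h2 := hAge S hS
    omega
  have hAJ := claim J le_rfl hJc.le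
  have hAJ2 := hAge J le_rfl
  have hJ0 : 0 < card J := card_pos_iff_exists_mem.2 ⟨g', mem_filter.2 ⟨hg', hg'1⟩⟩
  have hsplit : R.filter (fun v => α v = 1) + J = R := filter_add_not _ _
  -- Because `R` has `q + 1` terms and sum `e₁ + e₂`. Both sides are below `q`, so they agree as
  -- integers, contrary to `A J ≥ 2|J| > 0`.
  have hmod : ((A J : ℕ) : ZMod q) = (card J : ℕ) := by
    have h := congrArg α hRs
    rw [← hsplit, sum_add, map_add, map_add, hAα J, map_sum_multiset,
      sum_map_eq_card α 1 _ fun v hv => (mem_filter.1 hv).2, hco.fst_left, hco.fst_right] at h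
    have hc := congrArg card hsplit
    rw [card_add, hRc] at hc
    have hc' := congrArg (Nat.cast : ℕ → ZMod q) hc
    push_cast at hc'
    rw [ZMod.natCast_self] at hc'
    linear_combination h - hc'
  rw [ZMod.natCast_eq_natCast_iff', Nat.mod_eq_of_lt (by omega), Nat.mod_eq_of_lt (by omega)]
    at hmod
  omega

/-- A further `e₂` in `R` would form a block `e₂^q`. The complementary long part has base `e₁` or a
base inside the rest of `R`; either way `β` is constant on that rest, while `g` and `g'` have
different `β`. -/
theorem not_mem_remainder (hq : 2 ≤ q) {Z R : Multiset (ZMod q × ZMod q)}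
    {e₁ e₂ g g' : ZMod q × ZMod q} {α β : ZMod q × ZMod q →ₗ[ZMod q] ZMod q} (hZ : IsTame q Z)
    (hZs : Z.sum = 0) (hZc : card Z = 3 * q - 1) (hco : Coord e₁ e₂ α β)
    (hZR : Z = replicate (q - 1) e₁ + (replicate (q - 1) e₂ + R))
    (hg : g ∈ R) (hg1 : β g ≠ 1) (hg2 : g ≠ e₂) (hg' : g' ∈ R) (hg'1 : β g' = 1) (hg'2 : g' ≠ e₂) :
    e₂ ∉ R := by
  have : Fact (1 < q) := ⟨by omega⟩
  intro he
  set M := R.erase e₂ with hM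
  have hRM : R = e₂ ::ₘ M := (cons_erase he).symm
  have hgM : g ∈ M := (mem_erase_of_ne hg2).2 hg
  have hgM' : g' ∈ M := (mem_erase_of_ne hg'2).2 hg'
  have hZ' : Z = (replicate (q - 1) e₁ + M) + replicate q e₂ := by
    rw [hZR, hRM]
    have e : replicate q e₂ = replicate (q - 1) e₂ + {e₂} := by
      rw [add_comm, singleton_add, ← replicate_succ, Nat.sub_add_cancel (by omega)]
    rw [e, ← singleton_add]; abel
  set W := replicate (q - 1) e₁ + M with hW
  have hWZ : W ≤ Z := by rw [hZ']; exact Multiset.le_add_right _ _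
  have hWs : W.sum = 0 := by
    rw [hZ', sum_add, sum_replicate, nsmul_plane, add_zero] at hZs; exact hZs
  have hWc : card W = 2 * q - 1 := by
    rw [hZ', card_add, card_replicate] at hZc; omega
  have hMc : card M = q := by
    rw [hW, card_add, card_replicate] at hWc; omega
  have hMs := sum_eq_left (by omega) hWs
  have hne : β g ≠ β g' := by rw [hg'1]; exact hg1
  obtain ⟨u, hu⟩ := hZ.exists_base W hWZ hWs hWc
  by_cases hue : u = e₁
  · subst hue
    obtain ⟨F, f, α', β', hWF, hF, hco', -, hβ'⟩ :=
      exists_coord_of_replicate_le hq (hZ.noShort.mono hWZ) hWs hWc hu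
    have hFM : M = F := by
      rw [hW] at hWF; exact add_left_cancel hWF
    have hexp : ∀ v, β' v = β v * β' e₂ := fun v => by
      conv_lhs => rw [hco.eq_comb v]
      simp [hco'.snd_left]
    have h1 := hβ' g (hFM ▸ hgM)
    have h2 := hβ' g' (hFM ▸ hgM')
    rw [hexp] at h1 h2
    exact hne (by linear_combination β g' * h1 - β g * h2)
  · have hle : replicate (q - 1) u ≤ M := by
      refine le_of_le_add_of_notMem_left (le_count_iff_replicate_le.1 hu) fun v hv hv' => ?_
      rw [eq_of_mem_replicate hv] at hv'
      exact hue (eq_of_mem_replicate hv')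
    obtain ⟨D, hD⟩ := Multiset.le_iff_exists_add.1 hle
    rw [hD, card_add, card_replicate] at hMc
    obtain ⟨w, rfl⟩ := card_eq_one.1 (show card D = 1 by omega)
    rw [hD, sum_add, sum_replicate, sum_singleton, pred_nsmul_plane (by omega)] at hMs
    have hw : w = u + e₁ := by rw [← hMs]; abel
    have hall : ∀ v ∈ M, β v = β u := fun v hv => by
      rw [hD, mem_add, mem_singleton] at hv
      rcases hv with hv | rfl
      · rw [eq_of_mem_replicate hv]
      · rw [hw, map_add, hco.snd_left, add_zero]
    exact hne (by rw [hall g hgM, hall g' hgM'])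

/-- If `Z` is not good, the decomposition with base `e₁` has an off-line term `g`. This gives a
second base `e₂`, which in turn has an off-line term `g'`. The remaining terms then lie on the two
lines through `e₁` and `e₂`, and a term with the largest coordinate leads to a contradiction through
`false_of_max_coordinate`. -/
theorem isGood_of_not_hasConstantBlock (hq : 2 ≤ q) {Z : Multiset (ZMod q × ZMod q)}
    (hZ : IsTame q Z) (hZs : Z.sum = 0) (hZc : card Z = 3 * q - 1) (hno : ¬ HasConstantBlock Z) :
    IsGood Z := by
  have : Fact (1 < q) := ⟨by omega⟩
  by_contra hgood
  obtain ⟨z, hz⟩ := card_pos_iff_exists_mem.1 (show 0 < card Z by omega)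
  obtain ⟨e₁, f, α₀, β, F, Y, h₀, -⟩ := exists_rep hq hZ hZs hZc hz
  have hbad : ∀ {e f : ZMod q × ZMod q} {α β F Y}, Rep Z e f α β F Y →
      ∃ g ∈ Z, β g ≠ 0 ∧ β g ≠ 1 := fun {e f α β F Y} h => by
    by_contra hcon
    push Not at hcon
    refine hgood ⟨e, f, α, β, h.coord, fun v hv => ?_⟩
    by_cases h0 : β v = 0
    · exact Or.inl (h.eq_left hq hZ.noShort hv h0)
    · exact Or.inr (hcon v hv h0)
  obtain ⟨g, hg, hg0, hg1⟩ := hbad h₀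
  obtain ⟨e₂, α, F₂, Y₂, hco, h₂, hgα⟩ := h₀.exists_second hq hZ hZs hZc hno hg hg0 hg1
  have h₁ : Rep Z e₁ e₂ α β F Y :=
    ⟨hco, h₀.eq_add, h₀.snd_eq_one, h₀.card_left, h₀.card_right, h₀.sum_left, h₀.sum_right⟩
  obtain ⟨g', hg', hg'0, hg'1⟩ := hbad h₂
  have C1 : ∀ v ∈ Z, β v ≠ 0 → β v ≠ 1 → α v = 1 := fun v hv h0 h1 =>
    h₁.fst_eq_one hq hZ hZs hZc hno h₂ hg hg0 hg1 hgα hv h0 h1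
  have hg'β : β g' = 1 := by
    by_contra h1
    by_cases h0 : β g' = 0
    · rw [h₁.eq_left hq hZ.noShort hg' h0, hco.fst_left] at hg'1
      exact hg'1 rfl
    · exact hg'1 (C1 g' hg' h0 h1)
  have hne12 : e₁ ≠ e₂ := fun h => by
    have := hco.snd_left; rw [h, hco.snd_right] at this; exact one_ne_zero this
  obtain ⟨R, hR⟩ := Multiset.le_iff_exists_add.1 (add_le_of_disjoint h₁.left_le h₂.left_le
    fun a ha ha' => hne12 (by rw [← eq_of_mem_replicate ha, eq_of_mem_replicate ha']))
  rw [add_assoc] at hR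
  have hmemR : ∀ v ∈ Z, v ≠ e₁ → v ≠ e₂ → v ∈ R := fun v hv n1 n2 => by
    rw [hR, mem_add, mem_add] at hv
    rcases hv with h | h | h
    · exact absurd (eq_of_mem_replicate h) n1
    · exact absurd (eq_of_mem_replicate h) n2
    · exact h
  have hg_1 : g ≠ e₁ := fun h => hg0 (by rw [h, hco.snd_left])
  have hg_2 : g ≠ e₂ := fun h => hg1 (by rw [h, hco.snd_right])
  have hg'_1 : g' ≠ e₁ := fun h => hg'1 (by rw [h, hco.fst_left])
  have hg'_2 : g' ≠ e₂ := fun h => hg'0 (by rw [h, hco.fst_right])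
  have hgR := hmemR g hg hg_1 hg_2
  have hg'R := hmemR g' hg' hg'_1 hg'_2
  have he₂R : e₂ ∉ R := not_mem_remainder hq hZ hZs hZc hco hR hgR hg1 hg_2 hg'R hg'β hg'_2
  have hR' : Z = replicate (q - 1) e₂ + (replicate (q - 1) e₁ + R) := by rw [hR]; abel
  have he₁R : e₁ ∉ R := not_mem_remainder hq hZ hZs hZc hco.swap hR' hg'R hg'1 hg'_1 hgR hgα hg_1
  have htype : ∀ v ∈ R, (α v = 1 ∧ β v ≠ 0) ∨ (β v = 1 ∧ α v ≠ 0) := fun v hv => by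
    have hvZ : v ∈ Z := by rw [hR]; simp [hv]
    have hb0 : β v ≠ 0 := fun h => he₁R (h₁.eq_left hq hZ.noShort hvZ h ▸ hv)
    have ha0 : α v ≠ 0 := fun h => he₂R (h₂.eq_left hq hZ.noShort hvZ h ▸ hv)
    by_cases h1 : β v = 1
    · exact Or.inr ⟨h1, ha0⟩
    · exact Or.inl ⟨C1 v hvZ hb0 h1, hb0⟩
  obtain ⟨u, hu, hmax⟩ := R.toFinset.exists_max_image (fun v => max (α v).val (β v).val)
    ⟨g, by simpa using hgR⟩
  simp only [mem_toFinset] at hu hmax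
  have hval1 : (1 : ZMod q).val = 1 := ZMod.val_one q
  have hbig : 2 ≤ max (α u).val (β u).val :=
    (val_ge_two hq hg0 hg1).trans ((le_max_right _ _).trans (hmax g hgR))
  rcases htype u hu with ⟨hα1, -⟩ | ⟨hβ1, -⟩
  · rw [hα1, hval1] at hbig hmax
    have h1 : max 1 (β u).val = (β u).val := max_eq_right (by omega)
    rw [h1] at hbig hmax
    exact false_of_max_coordinate hq hZ hZs hZc hco hR htype hu hα1
      (fun h => by rw [h, hval1] at hbig; omega) (fun v hv => (le_max_left _ _).trans (hmax v hv))
      (fun v hv => (le_max_right _ _).trans (hmax v hv)) hg'R hg'1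
  · rw [hβ1, hval1] at hbig hmax
    have h1 : max (α u).val 1 = (α u).val := max_eq_left (by omega)
    rw [h1] at hbig hmax
    exact false_of_max_coordinate hq hZ hZs hZc hco.swap hR' (fun v hv => (htype v hv).symm) hu hβ1
      (fun h => by rw [h, hval1] at hbig; omega) (fun v hv => (le_max_right _ _).trans (hmax v hv))
      (fun v hv => (le_max_left _ _).trans (hmax v hv)) hgR hg1

theorem isGood_or_isExotic_of_card_eq (hq : 2 ≤ q) {Z : Multiset (ZMod q × ZMod q)}
    (hZ : IsTame q Z) (hZs : Z.sum = 0) (hZc : card Z = 3 * q - 1) : IsGood Z ∨ IsExotic Z := by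
  by_cases h : HasConstantBlock Z
  · exact h.isGood_or_isExotic hq hZ hZs hZc
  · exact Or.inl (isGood_of_not_hasConstantBlock hq hZ hZs hZc h)

end ZeroSum

/-! ### Classification of tame sequences of length `kq - 1` -/

namespace ZeroSum

open Multiset hiding map_add map_nsmul map_zero

variable {q : ℕ}

theorem exists_block (hq : 2 ≤ q) {T : Multiset (ZMod q × ZMod q)} (hns : NoShort q T)
    (hc : 3 * q - 2 ≤ card T) : ∃ Y ≤ T, Y.sum = 0 ∧ card Y = q := by
  obtain ⟨-, hη⟩ := davenportBound_and_etaBound q (by omega)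
  obtain ⟨Y, hY, hY0, hYs, hYc⟩ := hη T hc
  exact ⟨Y, hY, hYs, le_antisymm hYc (hns Y hY hY0 hYs)⟩

/-- While at least `3q` terms remain, a block of length exactly `q` exists. With `2q` terms left,
the Davenport bound gives a proper zero-sum part, and the lower bound on its length and on that of
its complement makes both equal to `q`. -/
theorem exists_block_decomposition (hq : 2 ≤ q) (j : ℕ) {T : Multiset (ZMod q × ZMod q)}
    (hns : NoShort q T) (hs : T.sum = 0) (hc : card T = j * q) :
    ∃ Bs : Multiset (Multiset (ZMod q × ZMod q)), card Bs = j ∧ Bs.join = T ∧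
      ∀ B ∈ Bs, B.sum = 0 ∧ card B = q := by
  induction j generalizing T with
  | zero => exact ⟨0, rfl, by rw [join_zero]; exact (card_eq_zero.1 (by simpa using hc)).symm,
      by simp⟩
  | succ j ih =>
    obtain ⟨Y, hY, hYs, hYc⟩ : ∃ Y ≤ T, Y.sum = 0 ∧ card Y = q := by
      rcases Nat.lt_or_ge j 1 with h0 | h0
      · obtain rfl : j = 0 := by omega
        exact ⟨T, le_rfl, hs, by omega⟩
      rcases Nat.lt_or_ge j 2 with h1 | h1
      · obtain rfl : j = 1 := by omega
        obtain ⟨hD, -⟩ := davenportBound_and_etaBound q (by omega)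
        obtain ⟨Y, hY, hY0, hYs, hne⟩ := sub_one_cons_split hD (by omega)
          (show card T = 2 * q by omega)
        have h2 := hns Y hY hY0 hYs
        have h3 := hns.le_card_sub hs hY hYs hne
        exact ⟨Y, hY, hYs, by omega⟩
      · refine exists_block hq hns ?_
        have : 3 * q ≤ (j + 1) * q := Nat.mul_le_mul_right q (by omega)
        omega
    have e : (j + 1) * q = j * q + q := by ring
    obtain ⟨Bs, h1, h2, h3⟩ := ih (T := T - Y) (hns.mono (Multiset.sub_le_self _ _))
      (sum_sub_eq_zero hY hYs hs) (by rw [card_sub hY]; omega)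
    refine ⟨Y ::ₘ Bs, by rw [card_cons, h1], ?_, ?_⟩
    · rw [join_cons, h2, add_comm, Multiset.sub_add_cancel hY]
    · intro B hB
      rcases mem_cons.1 hB with rfl | hB
      · exact ⟨hYs, hYc⟩
      · exact h3 B hB

theorem exists_core (hq : 2 ≤ q) (k : ℕ) {T : Multiset (ZMod q × ZMod q)}
    (hns : NoShort q T) (hs : T.sum = 0) (hc : card T + 1 = (k + 2) * q) :
    ∃ W ≤ T, W.sum = 0 ∧ card W = 2 * q - 1 := by
  induction k generalizing T with
  | zero => exact ⟨T, le_rfl, hs, by omega⟩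
  | succ k ih =>
    have e : (k + 1 + 2) * q = k * q + 3 * q := by ring
    have e' : (k + 2) * q = k * q + 2 * q := by ring
    obtain ⟨Y, hY, hYs, hYc⟩ := exists_block hq hns (by omega)
    obtain ⟨W, hW, h1, h2⟩ := ih (T := T - Y) (hns.mono (Multiset.sub_le_self _ _))
      (sum_sub_eq_zero hY hYs hs) (by rw [card_sub hY]; omega)
    exact ⟨W, hW.trans (Multiset.sub_le_self _ _), h1, h2⟩

theorem Coord.functional_eq {e f : ZMod q × ZMod q} {α β γ : ZMod q × ZMod q →ₗ[ZMod q] ZMod q}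
    (h : Coord e f α β) (v : ZMod q × ZMod q) : γ v = α v * γ e + β v * γ f := by
  conv_lhs => rw [h.eq_comb v]
  simp

/-- In a zero-sum sequence each of whose terms is `e` or has second coordinate `1`, the number of
terms of the second kind is divisible by `q`. -/
theorem dvd_card_filter {e f : ZMod q × ZMod q} {α β : ZMod q × ZMod q →ₗ[ZMod q] ZMod q}
    (h : Coord e f α β) {Y : Multiset (ZMod q × ZMod q)} (hs : Y.sum = 0)
    (hY : ∀ v ∈ Y, v = e ∨ β v = 1) : q ∣ card (Y.filter (fun v => v ≠ e)) := by
  have h1 := congrArg β hs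
  have hsplit : Y.filter (fun v => v = e) + Y.filter (fun v => v ≠ e) = Y := filter_add_not _ _
  rw [← hsplit, sum_add, map_add, map_sum_multiset, map_sum_multiset,
    sum_map_eq_card β 0 _ fun v hv => by rw [(mem_filter.1 hv).2, h.snd_left],
    sum_map_eq_card β 1 (Y.filter (fun v => v ≠ e)) fun v hv =>
      ((hY v (mem_filter.1 hv).1).resolve_left (mem_filter.1 hv).2), map_zero] at h1
  rw [← ZMod.natCast_eq_zero_iff]
  simpa using h1

theorem eq_replicate_or_forall_snd {e f : ZMod q × ZMod q}
    {α β : ZMod q × ZMod q →ₗ[ZMod q] ZMod q}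
    (h : Coord e f α β) {Y : Multiset (ZMod q × ZMod q)} (hs : Y.sum = 0) (hc : card Y = q)
    (hY : ∀ v ∈ Y, v = e ∨ β v = 1) : Y = replicate q e ∨ ∀ v ∈ Y, β v = 1 := by
  have h1 := dvd_card_filter h hs hY
  have h2 : card (Y.filter (fun v => v ≠ e)) ≤ q :=
    (card_le_card (filter_le _ _)).trans hc.le
  rcases Nat.eq_zero_or_pos (card (Y.filter (fun v => v ≠ e))) with h0 | h0
  · left
    rw [eq_replicate]
    refine ⟨hc, fun v hv => ?_⟩
    by_contra hne
    rw [card_eq_zero] at h0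
    have : v ∈ Y.filter (fun v => v ≠ e) := mem_filter.2 ⟨hv, hne⟩
    simp [h0] at this
  · right
    have h3 := Nat.le_of_dvd h0 h1
    have h4 : Y.filter (fun v => v ≠ e) = Y := eq_of_le_of_card_le (filter_le _ _) (by omega)
    intro v hv
    rw [← h4] at hv
    exact (hY v (mem_filter.1 hv).1).resolve_left (mem_filter.1 hv).2

/-- If `Z` is good but not with respect to the base `e` of a decomposition, then it is good with
respect to a second base on the line. -/
theorem Rep.exists_second_base (hq : 2 ≤ q) {Z F Y : Multiset (ZMod q × ZMod q)}
    {e f : ZMod q × ZMod q} {α β : ZMod q × ZMod q →ₗ[ZMod q] ZMod q} (h : Rep Z e f α β F Y)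
    (hgood : IsGood Z) (hbad : ∃ v ∈ Y, v ≠ e ∧ β v ≠ 1) :
    ∃ e₂ α₂, Coord e e₂ α₂ β ∧ F = replicate (q - 1) e₂ + {e + e₂} ∧
      ∀ v ∈ Y, v = e₂ ∨ α₂ v = 1 := by
  have : Fact (1 < q) := ⟨by omega⟩
  obtain ⟨u, w, a, b, hco, hu⟩ := hgood
  have hYZ : Y ≤ Z := by rw [h.eq_add]; exact Multiset.le_add_left _ _
  have hWZ : replicate (q - 1) e + F ≤ Z := by rw [h.eq_add]; exact Multiset.le_add_right _ _
  have hFZ : F ≤ Z := (Multiset.le_add_left _ _).trans hWZ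
  have heF : ∀ v ∈ F, v ≠ e := fun v hv hve => by
    have := h.snd_eq_one v hv
    rw [hve, h.coord.snd_left] at this
    exact zero_ne_one this
  -- With the same base, the two lines would be parallel and share the terms of `F`, so they would
  -- coincide and no off-line term could exist.
  have hue : u ≠ e := by
    rintro rfl
    obtain ⟨v, hv, hvu, hv1⟩ := hbad
    have hbf : b f = 1 := by
      obtain ⟨x, hx⟩ := card_pos_iff_exists_mem.1 (show 0 < card F by rw [h.card_left]; omega)
      have h1 := (hu x (mem_of_le hFZ hx)).resolve_left (heF x hx)
      rw [h.coord.functional_eq, hco.snd_left, h.snd_eq_one x hx] at h1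
      linear_combination h1
    have h2 := (hu v (mem_of_le hYZ hv)).resolve_left hvu
    rw [h.coord.functional_eq, hco.snd_left, hbf] at h2
    exact hv1 (by linear_combination h2)
  have hbe : b e = 1 := (hu e (h.left_mem hq)).resolve_left hue.symm
  -- The terms other than `u` number a positive multiple of `q` among `2q - 1`, hence exactly `q`.
  have hcount : q - 1 ≤ count u (replicate (q - 1) e + F) := by
    have h1 := dvd_card_filter hco h.sum_left fun v hv => hu v (mem_of_le hWZ hv)
    have h2 := congrArg card (filter_add_not (fun v => v = u) (replicate (q - 1) e + F))
    simp only [card_add, card_replicate, h.card_left] at h2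
    have h3 : 0 < card ((replicate (q - 1) e + F).filter (fun v => v ≠ u)) :=
      card_pos_iff_exists_mem.2 ⟨e, mem_filter.2 ⟨mem_add.2 (Or.inl
        (mem_replicate.2 ⟨by omega, rfl⟩)), hue.symm⟩⟩
    have h4 : card ((replicate (q - 1) e + F).filter (fun v => v = u)) =
        count u (replicate (q - 1) e + F) := by
      rw [count_eq_card_filter_eq]
      simp only [eq_comm]
    obtain ⟨d, hd⟩ := h1
    have hd2 : d < 2 := by
      by_contra hge
      have : q * 2 ≤ q * d := Nat.mul_le_mul_left q (by omega)
      change _ + card ((replicate (q - 1) e + F).filter (fun v => v ≠ u)) = _ at h2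
      omega
    have : d = 0 ∨ d = 1 := by omega
    change _ + card ((replicate (q - 1) e + F).filter (fun v => v ≠ u)) = _ at h2
    rcases this with rfl | rfl <;> omega
  have hle : replicate (q - 1) u ≤ F := by
    refine le_of_le_add_of_notMem_left (le_count_iff_replicate_le.1 hcount) fun v hv hv' => hue ?_
    rw [← eq_of_mem_replicate hv, eq_of_mem_replicate hv']
  have huF : u ∈ F := mem_of_le hle (mem_replicate.2 ⟨by omega, rfl⟩)
  have hco₂ := h.coord.change_one (h.snd_eq_one u huF)
  refine ⟨u, _, hco₂, h.eq_of_replicate_le hq hle, fun v hv => ?_⟩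
  rcases hu v (mem_of_le hYZ hv) with h1 | h1
  · exact Or.inl h1
  · right
    rw [hco₂.functional_eq, hbe, hco.snd_left] at h1
    linear_combination h1

/-- The data of an exotic sequence: `κ` is a unit modulo `q` different from `0, 1, -1`. -/
structure ExoticData (e₁ e₂ : ZMod q × ZMod q) (α β : ZMod q × ZMod q →ₗ[ZMod q] ZMod q)
    (κ : ℕ) : Prop where
  coord : Coord e₁ e₂ α β
  two_le : 2 ≤ κ
  add_two_le : κ + 2 ≤ q
  isUnit : IsUnit (κ : ZMod q)

theorem ExoticData.swap {e₁ e₂ : ZMod q × ZMod q} {α β : ZMod q × ZMod q →ₗ[ZMod q] ZMod q}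
    {κ : ℕ} (h : ExoticData e₁ e₂ α β κ) : ExoticData e₂ e₁ β α (q - κ) where
  coord := h.coord.swap
  two_le := by have := h.add_two_le; omega
  add_two_le := by have := h.add_two_le; have := h.two_le; omega
  isUnit := by
    rw [natCast_sub_self (by have := h.add_two_le; omega)]; exact h.isUnit.neg

theorem ExoticData.swap_eq {e₁ e₂ : ZMod q × ZMod q} {α β : ZMod q × ZMod q →ₗ[ZMod q] ZMod q}
    {κ : ℕ} (h : ExoticData e₁ e₂ α β κ) : (q - κ) • (e₁ - e₂) = κ • (e₂ - e₁) := by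
  have h1 := h.add_two_le
  apply h.coord.ext
  · rw [apply_nsmul, apply_nsmul, natCast_sub_self (by omega), map_sub, map_sub]; ring
  · rw [apply_nsmul, apply_nsmul, natCast_sub_self (by omega), map_sub, map_sub]; ring

theorem natCast_ne {a b : ℕ} (ha : a < q) (hb : b < q) (h : a ≠ b) : (a : ZMod q) ≠ b := by
  intro h1
  rw [ZMod.natCast_eq_natCast_iff', Nat.mod_eq_of_lt ha, Nat.mod_eq_of_lt hb] at h1
  exact h h1

theorem ExoticData.cast_ne {e₁ e₂ : ZMod q × ZMod q} {α β : ZMod q × ZMod q →ₗ[ZMod q] ZMod q}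
    {κ : ℕ} (h : ExoticData e₁ e₂ α β κ) :
    (κ : ZMod q) ≠ 0 ∧ (κ : ZMod q) ≠ 1 ∧ (κ : ZMod q) + 1 ≠ 0 := by
  have h1 := h.two_le
  have h2 := h.add_two_le
  refine ⟨?_, ?_, ?_⟩
  · simpa using natCast_ne (q := q) (a := κ) (b := 0) (by omega) (by omega) (by omega)
  · simpa using natCast_ne (q := q) (a := κ) (b := 1) (by omega) (by omega) (by omega)
  · simpa using natCast_ne (q := q) (a := κ + 1) (b := 0) (by omega) (by omega) (by omega)

/-- If `Y` lies on the line, `val_sum_lt_of_noShort` bounds its `α`-total by `q`. The total is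
divisible by `q`, so it is `0` and all terms are `e₂`. -/
theorem ExoticData.block_of_line {e₁ e₂ : ZMod q × ZMod q}
    {α β : ZMod q × ZMod q →ₗ[ZMod q] ZMod q} {κ : ℕ} (h : ExoticData e₁ e₂ α β κ)
    {Y : Multiset (ZMod q × ZMod q)} (hYs : Y.sum = 0) (hYc : card Y = q)
    (hns : NoShort q (replicate (q - 1) e₁ + replicate (q - 1) e₂ + Y +
      replicate q (κ • (e₂ - e₁)))) (hY : ∀ v ∈ Y, v = e₁ ∨ β v = 1) :
    Y = replicate q e₁ ∨ Y = replicate q e₂ := by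
  have h1 := h.two_le
  have h2 := h.add_two_le
  have : NeZero q := ⟨by omega⟩
  rcases eq_replicate_or_forall_snd h.coord hYs hYc hY with h3 | h3
  · exact Or.inl h3
  right
  have hlt := val_sum_lt_of_noShort h.coord h1 h2 h.isUnit (F := replicate (q - 1) e₂ + Y)
    (by
      intro v hv
      rcases mem_add.1 hv with hv | hv
      · rw [eq_of_mem_replicate hv, h.coord.snd_right]
      · exact h3 v hv)
    (by rw [count_add, count_replicate_self]; omega)
    (by rwa [add_assoc (replicate (q - 1) e₁)] at hns)
  rw [Multiset.map_add, sum_add] at hlt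
  have h4 : (((Y.map fun v => (α v).val).sum : ℕ) : ZMod q) = ((0 : ℕ) : ZMod q) := by
    rw [Nat.cast_multiset_sum, Multiset.map_map, Nat.cast_zero, ← map_zero α, ← hYs,
      map_sum_multiset]
    exact congrArg _ (map_congr rfl fun v _ => by simp)
  rw [ZMod.natCast_eq_natCast_iff', Nat.mod_eq_of_lt (by omega), Nat.zero_mod] at h4
  rw [eq_replicate]
  refine ⟨hYc, fun v hv => h.coord.ext ?_ (by rw [h3 v hv, h.coord.snd_right])⟩
  have h5 := single_le_sum (fun x _ => Nat.zero_le x) _ (mem_map_of_mem (fun v => (α v).val) hv)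
  rw [h.coord.fst_right, ← ZMod.val_eq_zero]
  omega

/-- The elements of an exotic sequence, and the two sums that do not occur. -/
theorem ExoticData.sum_not_mem {e₁ e₂ : ZMod q × ZMod q}
    {α β : ZMod q × ZMod q →ₗ[ZMod q] ZMod q} {κ A B C : ℕ} (h : ExoticData e₁ e₂ α β κ)
    {x : ZMod q × ZMod q} (hx : x = e₁ ∨ x = e₂) :
    κ • (e₂ - e₁) + x ∉ replicate A e₁ + replicate B e₂ + {e₁ + e₂} +
      replicate C (κ • (e₂ - e₁)) := by
  have h1 := h.two_le
  have h2 := h.add_two_le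
  have : Fact (1 < q) := ⟨by omega⟩
  obtain ⟨k0, k1, k2⟩ := h.cast_ne
  have hco := h.coord
  intro hmem
  have key : ∀ y, κ • (e₂ - e₁) + x = y → (β y = β x + κ ∧ α y = α x - κ) := by
    rintro y rfl
    constructor
    · rw [map_add, apply_nsmul, map_sub, hco.snd_left, hco.snd_right]; ring
    · rw [map_add, apply_nsmul, map_sub, hco.fst_left, hco.fst_right]; ring
  have hxc : (α x = 1 ∧ β x = 0) ∨ (α x = 0 ∧ β x = 1) := by
    rcases hx with rfl | rfl
    · exact Or.inl ⟨hco.fst_left, hco.snd_left⟩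
    · exact Or.inr ⟨hco.fst_right, hco.snd_right⟩
  simp only [mem_add, mem_singleton] at hmem
  have hx0 : x ≠ 0 := by
    rintro rfl
    simp at hxc
  rcases hmem with ((hm | hm) | hm) | hm
  · obtain ⟨h3, h4⟩ := key _ (eq_of_mem_replicate hm)
    rw [hco.snd_left] at h3
    rw [hco.fst_left] at h4
    rcases hxc with hxc | hxc
    · exact k0 (by rw [hxc.2, zero_add] at h3; exact h3.symm)
    · exact k2 (by rw [hxc.1] at h4; linear_combination h4)
  · obtain ⟨h3, h4⟩ := key _ (eq_of_mem_replicate hm)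
    rw [hco.snd_right] at h3
    rcases hxc with hxc | hxc
    · exact k1 (by rw [hxc.2] at h3; linear_combination -h3)
    · exact k0 (by rw [hxc.2] at h3; linear_combination -h3)
  · obtain ⟨h3, h4⟩ := key _ hm
    rw [map_add, hco.snd_left, hco.snd_right] at h3
    rw [map_add, hco.fst_left, hco.fst_right] at h4
    rcases hxc with hxc | hxc
    · exact k1 (by rw [hxc.2] at h3; linear_combination -h3)
    · exact k0 (by rw [hxc.2] at h3; linear_combination -h3)
  · have := eq_of_mem_replicate hm
    exact hx0 (by simpa using this)

/-- The classification for length `3q - 1` is applied to `e₁^{q-1} e₂^{q-1} (e₁ + e₂) Y`. If this is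
good, its base is `e₁` or `e₂` and `Y` lies on the corresponding line. If it is exotic, `Y` is
constant with value on the line of `e₂ - e₁`, and a value other than `κ(e₂ - e₁)` would create a
short zero-sum subsequence. -/
theorem ExoticData.block {e₁ e₂ : ZMod q × ZMod q}
    {α β : ZMod q × ZMod q →ₗ[ZMod q] ZMod q} {κ : ℕ} (h : ExoticData e₁ e₂ α β κ)
    {T Y : Multiset (ZMod q × ZMod q)} (hT : IsTame q T) (hYs : Y.sum = 0) (hYc : card Y = q)
    (hle : replicate (q - 1) e₁ + replicate (q - 1) e₂ + {e₁ + e₂} +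
      replicate q (κ • (e₂ - e₁)) + Y ≤ T) :
    Y = replicate q e₁ ∨ Y = replicate q e₂ ∨ Y = replicate q (κ • (e₂ - e₁)) := by
  have h1 := h.two_le
  have h2 := h.add_two_le
  have : NeZero q := ⟨by omega⟩
  have : Fact (1 < q) := ⟨by omega⟩
  have hco := h.coord
  obtain ⟨k0, k1, k2⟩ := h.cast_ne
  set g := κ • (e₂ - e₁) with hg
  have hne12 : e₁ ≠ e₂ := fun h => by
    have := hco.snd_left; rw [h, hco.snd_right] at this; exact one_ne_zero this
  set Z := replicate (q - 1) e₁ + replicate (q - 1) e₂ + {e₁ + e₂} + Y with hZ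
  have hZT : Z ≤ T := by
    refine le_trans ?_ hle
    rw [hZ]
    exact add_le_add (Multiset.le_add_right _ _) le_rfl
  have hZs : Z.sum = 0 := by
    rw [hZ]
    simp only [sum_add, sum_replicate, sum_singleton, hYs, pred_nsmul_plane (show 0 < q by omega)]
    abel
  have hZc : card Z = 3 * q - 1 := by
    rw [hZ]; simp only [card_add, card_replicate, card_singleton, hYc]; omega
  have he₁Z : e₁ ∈ Z := by rw [hZ]; simp [mem_replicate]; omega
  have he₂Z : e₂ ∈ Z := by rw [hZ]; simp [mem_replicate]; omega
  have hhZ : e₁ + e₂ ∈ Z := by rw [hZ]; simp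
  have hYZ : Y ≤ Z := Multiset.le_add_left _ _
  have hns₁ : NoShort q (replicate (q - 1) e₁ + replicate (q - 1) e₂ + Y + replicate q g) := by
    refine hT.noShort.mono (le_trans ?_ hle)
    rw [add_right_comm _ Y]
    exact add_le_add (add_le_add (Multiset.le_add_right _ _) le_rfl) le_rfl
  rcases isGood_or_isExotic_of_card_eq (by omega) (hT.mono hZT) hZs hZc with hgood | hex
  · obtain ⟨u, w, a, b, hcob, hu⟩ := hgood
    have two_ne : (2 : ZMod q) ≠ 0 ∧ (2 : ZMod q) ≠ 1 := by
      constructor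
      · simpa using natCast_ne (q := q) (a := 2) (b := 0) (by omega) (by omega) (by omega)
      · simpa using natCast_ne (q := q) (a := 2) (b := 1) (by omega) (by omega) (by omega)
    by_cases hu1 : e₁ = u
    · have hb2 : b e₂ = 1 := (hu e₂ he₂Z).resolve_left fun h => hne12 (by rw [hu1, h])
      rcases h.block_of_line hYs hYc hns₁ (fun v hv => by
        rcases hu v (mem_of_le hYZ hv) with h3 | h3
        · exact Or.inl (by rw [hu1, h3])
        · right
          rw [hco.functional_eq, hu1, hcob.snd_left, hb2] at h3
          linear_combination h3) with h4 | h4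
      · exact Or.inl h4
      · exact Or.inr (Or.inl h4)
    by_cases hu2 : e₂ = u
    · have hb1 : b e₁ = 1 := (hu e₁ he₁Z).resolve_left hu1
      rcases h.swap.block_of_line hYs hYc (by
        rw [h.swap_eq, add_comm (replicate (q - 1) e₂)]; exact hns₁) (fun v hv => by
        rcases hu v (mem_of_le hYZ hv) with h3 | h3
        · exact Or.inl (by rw [hu2, h3])
        · right
          rw [hco.functional_eq, hu2, hcob.snd_left, hb1] at h3
          linear_combination h3) with h4 | h4
      · exact Or.inr (Or.inl h4)
      · exact Or.inl h4
    -- A base different from `e₁` and `e₂` would give `e₁ + e₂` the value `2`, which is neither `0`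
    -- nor `1`.
    exfalso
    have hb1 : b e₁ = 1 := (hu e₁ he₁Z).resolve_left hu1
    have hb2 : b e₂ = 1 := (hu e₂ he₂Z).resolve_left hu2
    have hbh : b (e₁ + e₂) = 2 := by rw [map_add, hb1, hb2]; norm_num
    rcases hu _ hhZ with h3 | h3
    · rw [h3, hcob.snd_left] at hbh
      exact two_ne.1 hbh.symm
    · rw [h3] at hbh
      exact two_ne.2 hbh.symm
  · right; right
    obtain ⟨e₁', e₂', α', β', hco', κ', A, B, C, hκ2, hκq, hκu, hA, hB, hC, hC0, hZe⟩ := hex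
    have h' : ExoticData e₁' e₂' α' β' κ' := ⟨hco', hκ2, hκq, hκu⟩
    set g' := κ' • (e₂' - e₁') with hg'
    have hAq := Nat.le_of_dvd (by omega) hA
    have hBq := Nat.le_of_dvd (by omega) hB
    have hCq := Nat.le_of_dvd hC0 hC
    have hcard := congrArg card hZe
    simp only [hZc, card_add, card_replicate, card_singleton] at hcard
    obtain rfl : A = q - 1 := by omega
    obtain rfl : B = q - 1 := by omega
    obtain rfl : q = C := by omega
    have hne12' : e₁' ≠ e₂' := fun h => by
      have := hco'.snd_left; rw [h, hco'.snd_right] at this; exact one_ne_zero this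
    have hcount : ∀ x, 2 ≤ count x Z → x = e₁' ∨ x = e₂' ∨ x = g' := fun x hx => by
      by_contra hcon
      push Not at hcon
      rw [hZe] at hx
      simp only [count_add, count_replicate, count_singleton, if_neg hcon.1.symm,
        if_neg hcon.2.1.symm, if_neg hcon.2.2.symm] at hx
      split_ifs at hx <;> omega
    have hc1 := hcount e₁ (by
      rw [hZ]; simp only [count_add, count_replicate_self]; omega)
    have hc2 := hcount e₂ (by
      rw [hZ]; simp only [count_add, count_replicate_self]; omega)
    -- Neither `e₁` nor `e₂` equals `g'`: otherwise `e₁ + e₂`, a term of `Z`, would be one of the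
    -- sums excluded by `ExoticData.sum_not_mem`.
    have hpair : (e₁ = e₁' ∧ e₂ = e₂') ∨ (e₁ = e₂' ∧ e₂ = e₁') := by
      rw [hZe] at hhZ
      rcases hc1 with rfl | rfl | h3 <;> rcases hc2 with rfl | rfl | h4
      · exact absurd rfl hne12
      · exact Or.inl ⟨rfl, rfl⟩
      · rw [h4, add_comm _ g'] at hhZ
        exact absurd hhZ (h'.sum_not_mem (Or.inl rfl))
      · exact Or.inr ⟨rfl, rfl⟩
      · exact absurd rfl hne12
      · rw [h4, add_comm _ g'] at hhZ
        exact absurd hhZ (h'.sum_not_mem (Or.inr rfl))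
      · rw [h3] at hhZ
        exact absurd hhZ (h'.sum_not_mem (Or.inl rfl))
      · rw [h3] at hhZ
        exact absurd hhZ (h'.sum_not_mem (Or.inr rfl))
      · exact absurd (h3.trans h4.symm) hne12
    have hYg : Y = replicate q g' := by
      rw [hZ] at hZe
      rcases hpair with ⟨h3, h4⟩ | ⟨h3, h4⟩
      · rw [← h3, ← h4] at hZe
        exact add_left_cancel hZe
      · rw [← h3, ← h4, add_comm (replicate (q - 1) e₂), add_comm e₂] at hZe
        exact add_left_cancel hZe
    have hg'0 : α g' + β g' = 0 := by
      rcases hpair with ⟨h3, h4⟩ | ⟨h3, h4⟩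
      · rw [hg', ← h3, ← h4, apply_nsmul, apply_nsmul, map_sub, map_sub, hco.fst_left,
          hco.fst_right, hco.snd_left, hco.snd_right]
        ring
      · rw [hg', ← h3, ← h4, apply_nsmul, apply_nsmul, map_sub, map_sub, hco.fst_left,
          hco.fst_right, hco.snd_left, hco.snd_right]
        ring
    obtain ⟨c, hc⟩ := h.isUnit.exists_right_inv
    set k := (-(β g' * c)).val with hk
    have hkq : k < q := ZMod.val_lt _
    have hkc : (k : ZMod q) = -(β g' * c) := ZMod.natCast_zmod_val _
    have hlen := hT.noShort (replicate k g + {g'}) (by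
      refine le_trans ?_ hle
      rw [add_assoc]
      refine (add_le_add ((replicate_le_replicate g).2 hkq.le) ?_).trans
        (Multiset.le_add_left _ _)
      rw [hYg, singleton_le, mem_replicate]
      exact ⟨by omega, rfl⟩) (by rw [← card_pos]; simp) (by
        apply hco.eq_zero
        · rw [sum_add, sum_replicate, sum_singleton, map_add, apply_nsmul, hg, apply_nsmul,
            map_sub, hco.fst_left, hco.fst_right, hkc]
          linear_combination hg'0 + (β g') * hc
        · rw [sum_add, sum_replicate, sum_singleton, map_add, apply_nsmul, hg, apply_nsmul,
            map_sub, hco.snd_left, hco.snd_right, hkc]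
          linear_combination (-β g') * hc)
    rw [card_add, card_replicate, card_singleton] at hlen
    have hk1 : (k : ZMod q) = -1 := by
      have h3 : k + 1 = q := by omega
      have h4 := congrArg (Nat.cast : ℕ → ZMod q) h3
      rw [ZMod.natCast_self] at h4
      push_cast at h4
      linear_combination h4
    have hβg' : β g' = κ := by
      have h3 : β g' * c = 1 := by rw [hkc] at hk1; linear_combination -hk1
      linear_combination κ * h3 - β g' * hc
    rw [hYg]
    congr 1
    have hαg : α g = -κ := by
      rw [hg, apply_nsmul, map_sub, hco.fst_left, hco.fst_right]; ring
    have hβg : β g = κ := by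
      rw [hg, apply_nsmul, map_sub, hco.snd_left, hco.snd_right]; ring
    apply hco.ext
    · rw [hαg]; linear_combination hg'0 - hβg'
    · rw [hβg, hβg']

theorem isExotic_of_le (hq : 2 ≤ q) {k : ℕ} {T Z : Multiset (ZMod q × ZMod q)} (hT : IsTame q T)
    (hs : T.sum = 0) (hc : card T + 1 = k * q) (hZT : Z ≤ T) (hZs : Z.sum = 0)
    (hZc : card Z = 3 * q - 1) (hZ : IsExotic Z) : IsExotic T := by
  obtain ⟨e₁, e₂, α, β, hco, κ, A, B, C, hκ2, hκq, hκu, hA, hB, hC, hC0, hZe⟩ := hZ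
  have h : ExoticData e₁ e₂ α β κ := ⟨hco, hκ2, hκq, hκu⟩
  have hAq := Nat.le_of_dvd (by omega) hA
  have hBq := Nat.le_of_dvd (by omega) hB
  have hCq := Nat.le_of_dvd hC0 hC
  have hcard := congrArg card hZe
  simp only [hZc, card_add, card_replicate, card_singleton] at hcard
  obtain rfl : A = q - 1 := by omega
  obtain rfl : B = q - 1 := by omega
  obtain rfl : q = C := by omega
  have hk : 3 ≤ k := by
    by_contra hlt
    have : k * q ≤ 2 * q := Nat.mul_le_mul_right q (by omega)
    have := card_le_card hZT
    omega
  have hks : (k - 3) * q + 3 * q = k * q := by rw [← add_mul, Nat.sub_add_cancel hk]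
  obtain ⟨Bs, -, hBs, hBl⟩ := exists_block_decomposition hq (k - 3) (T := T - Z)
    (hT.noShort.mono (Multiset.sub_le_self _ _)) (sum_sub_eq_zero hZT hZs hs)
    (by rw [card_sub hZT]; omega)
  have hTe : T = Z + Bs.join := by rw [hBs, add_comm, Multiset.sub_add_cancel hZT]
  have hblocks : ∀ Y ∈ Bs, Y = replicate q e₁ ∨ Y = replicate q e₂ ∨
      Y = replicate q (κ • (e₂ - e₁)) := fun Y hY => by
    refine h.block hT (hBl Y hY).1 (hBl Y hY).2 ?_
    rw [← hZe, hTe]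
    gcongr
    obtain ⟨Bs', rfl⟩ := exists_cons_of_mem hY
    rw [join_cons]; exact Multiset.le_add_right _ _
  have main : ∀ Cs ≤ Bs, ∃ A B C : ℕ, q ∣ A + 1 ∧ q ∣ B + 1 ∧ q ∣ C ∧ 0 < C ∧ Z + Cs.join =
      replicate A e₁ + replicate B e₂ + {e₁ + e₂} + replicate C (κ • (e₂ - e₁)) := by
    intro Cs
    induction Cs using Multiset.induction_on with
    | empty => exact fun _ => ⟨q - 1, q - 1, q, hA, hB, hC, hC0, by simpa using hZe⟩
    | cons Y Cs ih =>
      intro hCs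
      obtain ⟨A, B, C, a1, a2, a3, a4, a5⟩ := ih ((le_cons_self _ _).trans hCs)
      have e : Z + (Y ::ₘ Cs).join = Z + Cs.join + Y := by rw [join_cons]; abel
      rw [e, a5]
      rcases hblocks Y (mem_of_le hCs (mem_cons_self _ _)) with hY | hY | hY
      · refine ⟨A + q, B, C, ?_, a2, a3, a4, ?_⟩
        · rw [add_right_comm]; exact dvd_add a1 dvd_rfl
        · rw [replicate_add, ← hY]; abel
      · refine ⟨A, B + q, C, a1, ?_, a3, a4, ?_⟩
        · rw [add_right_comm]; exact dvd_add a2 dvd_rfl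
        · rw [replicate_add, ← hY]; abel
      · refine ⟨A, B, C + q, a1, a2, dvd_add a3 dvd_rfl, by omega, ?_⟩
        rw [replicate_add, ← hY]; abel
  obtain ⟨A, B, C, a1, a2, a3, a4, a5⟩ := main Bs le_rfl
  exact ⟨e₁, e₂, α, β, hco, κ, A, B, C, hκ2, hκq, hκu, a1, a2, a3, a4, hTe.trans a5⟩

/-- The long part and `Y₂` are redistributed so that `y'` enters the line part `F₂`. Goodness of the
new long part together with `Y₁` then gives a second base `e₃` with `F₂ = e₃^{q-1}(e₁ + e₃)`. As
`y'` is in `F₂`, this `e₃` is not `e₂`, so `Y₂ = e₃^q`, and there is no place left for `e₁ + e₃`. -/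
theorem not_two_bad_blocks (hq : 2 ≤ q) {T F Y₁ Y₂ : Multiset (ZMod q × ZMod q)}
    {e₁ e₂ y y' : ZMod q × ZMod q} {α β : ZMod q × ZMod q →ₗ[ZMod q] ZMod q} (hT : IsTame q T)
    (hgood : ∀ Z ≤ T, Z.sum = 0 → card Z = 3 * q - 1 → IsGood Z)
    (h₁ : Rep (replicate (q - 1) e₁ + F + Y₁) e₁ e₂ α β F Y₁)
    (h₂ : Rep (replicate (q - 1) e₁ + F + Y₂) e₁ e₂ α β F Y₂)
    (hF : F = replicate (q - 1) e₂ + {e₁ + e₂})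
    (hle : replicate (q - 1) e₁ + F + Y₂ + Y₁ ≤ T) (hy : y ∈ Y₁) (hyα : α y = 1) (hy0 : β y ≠ 0)
    (hy1 : β y ≠ 1) (hy' : y' ∈ Y₂) (hy'β : β y' = 1) (hy'0 : α y' ≠ 0) (hy'1 : α y' ≠ 1)
    (hY₂ : ∀ v ∈ Y₂, v = e₁ ∨ β v = 1) : False := by
  have : Fact (1 < q) := ⟨by omega⟩
  have hco := h₁.coord
  have hY₂β : ∀ v ∈ Y₂, β v = 1 := by
    rcases eq_replicate_or_forall_snd hco h₂.sum_right h₂.card_right hY₂ with h | h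
    · rw [h] at hy'
      rw [eq_of_mem_replicate hy', hco.snd_left] at hy'β
      exact absurd hy'β zero_ne_one
    · exact h
  have hZle : replicate (q - 1) e₁ + F + Y₂ ≤ T := (Multiset.le_add_right _ _).trans hle
  have hZs : (replicate (q - 1) e₁ + F + Y₂).sum = 0 := by
    rw [sum_add, h₂.sum_left, h₂.sum_right, add_zero]
  have hZc : card (replicate (q - 1) e₁ + F + Y₂) = 3 * q - 1 := by
    rw [card_add, card_add, card_replicate, h₂.card_left, h₂.card_right]; omega
  obtain ⟨u, w, a, b, F', Y', h', hy'W⟩ := exists_rep hq (hT.mono hZle) hZs hZc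
    (mem_add.2 (Or.inr hy'))
  obtain ⟨W, hW⟩ : ∃ W, W = replicate (q - 1) u + F' := ⟨_, rfl⟩
  have hWY : replicate (q - 1) e₁ + F + Y₂ = W + Y' := by rw [hW]; exact h'.eq_add
  have hWs : W.sum = 0 := hW ▸ h'.sum_left
  rw [← hW] at hy'W
  have hWc : card W = 2 * q - 1 := by
    rw [hW, card_add, card_replicate, h'.card_left]; omega
  have hWle : W ≤ replicate (q - 1) e₁ + (F + Y₂) := by
    rw [← add_assoc, hWY]; exact Multiset.le_add_right _ _
  have hne : ∀ v, β v = 1 → v ≠ e₁ := fun v hv hve => by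
    rw [hve, hco.snd_left] at hv; exact zero_ne_one hv
  have hFY : ∀ v ∈ F + Y₂, β v = 1 := fun v hv => by
    rcases mem_add.1 hv with hv | hv
    · exact h₂.snd_eq_one v hv
    · exact hY₂β v hv
  have hWtype : ∀ v ∈ W, v = e₁ ∨ β v = 1 := fun v hv => by
    rcases mem_add.1 (mem_of_le hWle hv) with hv | hv
    · exact Or.inl (eq_of_mem_replicate hv)
    · exact Or.inr (hFY v hv)
  set F₂ := W.filter (fun v => v ≠ e₁) with hF₂
  have hsplit : W.filter (fun v => v = e₁) + F₂ = W := filter_add_not _ _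
  have hF₂le : F₂ ≤ F + Y₂ := by
    refine le_of_le_add_of_notMem_left ((filter_le _ _).trans hWle) fun v hv hv' => ?_
    exact (mem_filter.1 hv).2 (eq_of_mem_replicate hv')
  have hE : W.filter (fun v => v = e₁) = replicate (count e₁ W) e₁ := filter_eq' _ _
  have hcount : count e₁ W ≤ q - 1 := by
    have := count_le_of_le e₁ hWle
    rwa [count_add, count_replicate_self, count_eq_zero.2 fun h => hne e₁ (hFY e₁ h) rfl,
      add_zero] at this
  have hsc := congrArg card hsplit
  rw [hE, card_add, card_replicate, hWc] at hsc
  have hF₂c : card F₂ = q := by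
    obtain ⟨d, hd⟩ := dvd_card_filter hco hWs hWtype
    rw [← hF₂] at hd
    have hd2 : d < 2 := by
      by_contra hge
      have : q * 2 ≤ q * d := Nat.mul_le_mul_left q (by omega)
      omega
    have : d = 0 ∨ d = 1 := by omega
    rcases this with rfl | rfl <;> omega
  have hWeq : W = replicate (q - 1) e₁ + F₂ := by
    conv_lhs => rw [← hsplit, hE]
    rw [show count e₁ W = q - 1 by omega]
  have hR : Rep (W + Y₁) e₁ e₂ α β F₂ Y₁ :=
    ⟨hco, by rw [hWeq], fun v hv => hFY v (mem_of_le hF₂le hv), hF₂c, h₁.card_right,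
      by rw [← hWeq]; exact hWs, h₁.sum_right⟩
  have hWT : W + Y₁ ≤ T := by
    refine le_trans ?_ hle
    rw [hWY]
    exact add_le_add (Multiset.le_add_right _ _) le_rfl
  have hy_1 : y ≠ e₁ := fun h => hy0 (by rw [h, hco.snd_left])
  obtain ⟨e₃, α₃, hco₃, hF₂e, hY₁⟩ := hR.exists_second_base hq
    (hgood _ hWT (by rw [sum_add, hWs, h₁.sum_right, add_zero])
      (by rw [card_add, hWc, h₁.card_right]; omega)) ⟨y, hy, hy_1, hy1⟩
  have hα₃y : α₃ y = 1 :=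
    (hY₁ y hy).resolve_left fun h => hy1 (by rw [h, hco₃.snd_right])
  have hx : β y * α e₃ = 0 := by
    have := hco₃.functional_eq (γ := α) y
    rw [hyα, hα₃y, hco.fst_left] at this
    linear_combination -this
  have hx0 : α e₃ ≠ 0 := fun h0 => by
    have hm : y' ∈ F₂ := mem_filter.2 ⟨hy'W, hne y' hy'β⟩
    rw [hF₂e, mem_add, mem_singleton] at hm
    rcases hm with hm | hm
    · exact hy'0 (by rw [eq_of_mem_replicate hm, h0])
    · exact hy'1 (by rw [hm, map_add, h0, hco.fst_left, add_zero])
  have hx1 : α e₃ ≠ 1 := fun h => hy0 (by rw [h, mul_one] at hx; exact hx)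
  have hle₃ : replicate (q - 1) e₃ ≤ Y₂ := by
    have h3 : replicate (q - 1) e₃ ≤ F + Y₂ := by
      refine le_trans ?_ hF₂le
      rw [hF₂e]; exact Multiset.le_add_right _ _
    refine le_of_le_add_of_notMem_left h3 fun v hv hv' => ?_
    rw [eq_of_mem_replicate hv, hF, mem_add, mem_singleton] at hv'
    rcases hv' with h | h
    · exact hx0 (by rw [eq_of_mem_replicate h, hco.fst_right])
    · exact hx1 (by rw [h, map_add, hco.fst_left, hco.fst_right, add_zero])
  have hY₂e := eq_replicate_of_replicate_le (by omega) h₂.card_right h₂.sum_right hle₃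
  have hlast : e₁ + e₃ ∈ F + Y₂ := mem_of_le hF₂le (by rw [hF₂e]; simp)
  rw [hF, hY₂e, mem_add, mem_add, mem_singleton] at hlast
  rcases hlast with (h | h) | h
  · have h3 := congrArg α (eq_of_mem_replicate h)
    rw [map_add, hco.fst_left, hco.fst_right] at h3
    exact hy0 (by linear_combination β y * h3 - hx)
  · exact hx0 (by rw [add_left_cancel h, hco.fst_right])
  · have h3 := congrArg α (eq_of_mem_replicate h)
    rw [map_add, hco.fst_left] at h3
    exact one_ne_zero (α := ZMod q) (by linear_combination h3)

/-- Every block is good together with the core. A block that is bad for the base `e₁` forces a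
second base `e₂`; if another block is bad for `e₂`, the two blocks contradict `not_two_bad_blocks`.
-/
theorem isGood_of_forall_isGood (hq : 2 ≤ q) {k : ℕ} {T : Multiset (ZMod q × ZMod q)}
    (hT : IsTame q T) (hs : T.sum = 0) (hc : card T + 1 = (k + 2) * q)
    (hgood : ∀ Z ≤ T, Z.sum = 0 → card Z = 3 * q - 1 → IsGood Z) : IsGood T := by
  have : Fact (1 < q) := ⟨by omega⟩
  obtain ⟨W, hWT, hWs, hWc⟩ := exists_core hq k hT.noShort hs hc
  obtain ⟨e₁, he₁⟩ := hT.exists_base W hWT hWs hWc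
  obtain ⟨F, f, α₀, β, hWF, hF, hco₀, -, hβF⟩ :=
    exists_coord_of_replicate_le hq (hT.noShort.mono hWT) hWs hWc he₁
  obtain ⟨Bs, -, hBs, hB⟩ := exists_block_decomposition hq k (T := T - W)
    (hT.noShort.mono (Multiset.sub_le_self _ _)) (sum_sub_eq_zero hWT hWs hs) (by
      rw [card_sub hWT]
      have : (k + 2) * q = k * q + 2 * q := by ring
      omega)
  have hTe : T = W + Bs.join := by rw [hBs, add_comm, Multiset.sub_add_cancel hWT]
  have hleT : ∀ Y ∈ Bs, W + Y ≤ T := fun Y hY => by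
    rw [hTe]
    obtain ⟨Bs', rfl⟩ := exists_cons_of_mem hY
    rw [join_cons]
    exact add_le_add le_rfl (Multiset.le_add_right _ _)
  have hgoodY : ∀ Y ∈ Bs, IsGood (W + Y) := fun Y hY =>
    hgood _ (hleT Y hY) (by rw [sum_add, hWs, (hB Y hY).1, add_zero])
      (by rw [card_add, hWc, (hB Y hY).2]; omega)
  have hmem : ∀ v ∈ T, v ∈ W ∨ ∃ Y ∈ Bs, v ∈ Y := fun v hv => by
    rw [hTe, mem_add, mem_join] at hv; exact hv
  have hrep : ∀ {f α} (_ : Coord e₁ f α β), ∀ Y ∈ Bs, Rep (W + Y) e₁ f α β F Y :=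
    fun {f α} hco Y hY => ⟨hco, by rw [hWF], hβF, hF, (hB Y hY).2, hWF ▸ hWs, (hB Y hY).1⟩
  by_cases hfine : ∀ Y ∈ Bs, ∀ v ∈ Y, v = e₁ ∨ β v = 1
  · refine ⟨e₁, f, α₀, β, hco₀, fun v hv => ?_⟩
    rcases hmem v hv with h | ⟨Y, hY, h⟩
    · rw [hWF, mem_add] at h
      rcases h with h | h
      · exact Or.inl (eq_of_mem_replicate h)
      · exact Or.inr (hβF v h)
    · exact hfine Y hY v h
  push Not at hfine
  obtain ⟨Y₁, hY₁, y, hy, hye, hy1⟩ := hfine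
  obtain ⟨e₂, α, hco, hFe, hY₁α⟩ := (hrep hco₀ Y₁ hY₁).exists_second_base hq (hgoodY Y₁ hY₁)
    ⟨y, hy, hye, hy1⟩
  have hy0 : β y ≠ 0 := fun h0 => hye ((hrep hco Y₁ hY₁).eq_left hq
    (hT.noShort.mono (hleT Y₁ hY₁)) (mem_add.2 (Or.inr hy)) h0)
  have hyα : α y = 1 := (hY₁α y hy).resolve_left fun h => hy1 (by rw [h, hco.snd_right])
  have hq3 : 3 ≤ q := by
    have : NeZero q := ⟨by omega⟩
    have := val_ge_two hq hy0 hy1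
    have := ZMod.val_lt (β y)
    omega
  by_cases hfine₂ : ∀ Y ∈ Bs, ∀ v ∈ Y, v = e₂ ∨ α v = 1
  · refine ⟨e₂, e₁, β, α, hco.swap, fun v hv => ?_⟩
    rcases hmem v hv with h | ⟨Y, hY, h⟩
    · rw [hWF, hFe, mem_add, mem_add, mem_singleton] at h
      rcases h with h | h | h
      · rw [eq_of_mem_replicate h]; exact Or.inr hco.fst_left
      · exact Or.inl (eq_of_mem_replicate h)
      · rw [h, map_add, hco.fst_left, hco.fst_right, add_zero]; exact Or.inr rfl
    · exact hfine₂ Y hY v h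
  push Not at hfine₂
  exfalso
  obtain ⟨Y₂, hY₂, y', hy', hy'e, hy'1⟩ := hfine₂
  have hWF' : W = replicate (q - 1) e₂ + (replicate (q - 1) e₁ + {e₁ + e₂}) := by
    rw [hWF, hFe]; abel
  have hR₂ : Rep (W + Y₂) e₂ e₁ β α (replicate (q - 1) e₁ + {e₁ + e₂}) Y₂ := by
    refine ⟨hco.swap, by rw [hWF'], fun v hv => ?_, ?_, (hB Y₂ hY₂).2, hWF' ▸ hWs, (hB Y₂ hY₂).1⟩
    · rw [mem_add, mem_singleton] at hv
      rcases hv with h | h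
      · rw [eq_of_mem_replicate h, hco.fst_left]
      · rw [h, map_add, hco.fst_left, hco.fst_right, add_zero]
    · rw [card_add, card_replicate, card_singleton]; omega
  have hy'0 : α y' ≠ 0 := fun h0 => hy'e (hR₂.eq_left hq
    (hT.noShort.mono (hleT Y₂ hY₂)) (mem_add.2 (Or.inr hy')) h0)
  obtain ⟨e₃, β₃, hco₃, hFe₃, hY₂β⟩ := hR₂.exists_second_base hq (hgoodY Y₂ hY₂)
    ⟨y', hy', hy'e, hy'1⟩
  -- `e₃` has multiplicity at least `q - 1 ≥ 2` in `e₁^{q-1}(e₁ + e₂)`.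
  have he₃ : e₃ = e₁ := by
    by_contra hne
    have h1 : replicate (q - 1) e₃ ≤ {e₁ + e₂} := by
      refine le_of_le_add_of_notMem_left (B := replicate (q - 1) e₁) (hFe₃ ▸
        Multiset.le_add_right _ _) fun v hv hv' => hne ?_
      rw [← eq_of_mem_replicate hv, eq_of_mem_replicate hv']
    have := card_le_card h1
    rw [card_replicate, card_singleton] at this
    omega
  subst he₃
  have hY₂' : ∀ v ∈ Y₂, v = e₃ ∨ β v = 1 := fun v hv => by
    rcases hY₂β v hv with h | h
    · exact Or.inl h
    · right
      rw [hco.functional_eq, hco₃.fst_right, hco₃.fst_left] at h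
      linear_combination h
  have hy'β : β y' = 1 := (hY₂' y' hy').resolve_left fun h => hy'1 (by rw [h, hco.fst_left])
  refine not_two_bad_blocks hq hT hgood (hWF ▸ hrep hco Y₁ hY₁) (hWF ▸ hrep hco Y₂ hY₂) hFe ?_ hy
    hyα hy0 hy1 hy' hy'β hy'0 hy'1 hY₂'
  have hne : Y₂ ≠ Y₁ := by
    rintro rfl
    exact (hY₁α y' hy').elim hy'e hy'1
  rw [← hWF, hTe, add_assoc]
  refine add_le_add le_rfl ?_
  obtain ⟨Bs', rfl⟩ := exists_cons_of_mem hY₂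
  obtain ⟨Bs'', rfl⟩ := exists_cons_of_mem ((mem_cons.1 hY₁).resolve_left hne.symm)
  rw [join_cons, join_cons]
  exact add_le_add le_rfl (Multiset.le_add_right _ _)

/-- Classification of tame zero-sum sequences of length `kq - 1`. -/
theorem isGood_or_isExotic (hq : 2 ≤ q) {k : ℕ} (hk : 2 ≤ k) {T : Multiset (ZMod q × ZMod q)}
    (hT : IsTame q T) (hs : T.sum = 0) (hc : card T + 1 = k * q) : IsGood T ∨ IsExotic T := by
  by_cases h : ∀ Z ≤ T, Z.sum = 0 → card Z = 3 * q - 1 → IsGood Z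
  · exact Or.inl (isGood_of_forall_isGood hq (k := k - 2) hT hs
      (by rw [Nat.sub_add_cancel hk]; exact hc) h)
  · push Not at h
    obtain ⟨Z, hZT, hZs, hZc, hZ⟩ := h
    exact Or.inr (isExotic_of_le hq hT hs hc hZT hZs hZc
      ((isGood_or_isExotic_of_card_eq hq (hT.mono hZT) hZs hZc).resolve_left hZ))

end ZeroSum

/-! ### The multiples of `N` as a plane over `ZMod p`, and calibrated functionals -/

namespace ZeroSum

open Multiset hiding map_add map_nsmul map_zero

section Torsion

variable {N p Q : ℕ}

/-- `N * c` depends only on `c` modulo the prime `p`, where a nonzero class is invertible. -/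
theorem exists_natCast_mul_mul_eq (h : Q = N * p) (hN : N ≠ 0) (hp : p.Prime) {c : ZMod Q}
    (hc : (N : ZMod Q) * c ≠ 0) : ∃ c', (N : ZMod Q) * (c * c') = N := by
  have : Fact p.Prime := ⟨hp⟩
  rw [Ne, mul_eq_zero_iff_castHom h hN] at hc
  obtain ⟨c', hc'⟩ := ZMod.castHom_surjective (Dvd.intro_left N h.symm)
    (ZMod.castHom (Dvd.intro_left N h.symm) (ZMod p) c)⁻¹
  have h1 := (mul_eq_zero_iff_castHom h hN (c * c' - 1)).2
    (by rw [map_sub, map_mul, hc', map_one, mul_inv_cancel₀ hc, sub_self])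
  exact ⟨c', by linear_combination h1⟩

theorem natCast_mul_natCast_eq_zero_iff (h : Q = N * p) (hN : N ≠ 0) (k : ℕ) :
    (N : ZMod Q) * k = 0 ↔ p ∣ k := by
  rw [mul_eq_zero_iff_castHom h hN, map_natCast, ZMod.natCast_eq_zero_iff]

theorem natCast_level_ne_zero (h : Q = N * p) (hN : N ≠ 0) (hp : p.Prime) :
    (N : ZMod Q) ≠ 0 := fun h0 => by
  have := (natCast_mul_natCast_eq_zero_iff h hN 1).1 (by rw [h0, zero_mul])
  exact hp.one_lt.ne' (Nat.dvd_one.1 this)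

theorem smul_eq_zero_of_level (h : Q = N * p) (hQ : Q ≠ 0) {c : ZMod Q}
    (hc : (N : ZMod Q) * c = 0) {x : ZMod Q × ZMod Q}
    (hx : level (Dvd.intro p h.symm) x = 0) : c • x = 0 := by
  obtain ⟨y, rfl⟩ := (level_eq_zero_iff h hQ x).1 hx
  rw [← Nat.cast_smul_eq_nsmul (ZMod Q), smul_smul, mul_comm, hc, zero_smul]

theorem smul_eq_self_of_level (h : Q = N * p) (hQ : Q ≠ 0) {c : ZMod Q}
    (hc : (N : ZMod Q) * c = N) {x : ZMod Q × ZMod Q}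
    (hx : level (Dvd.intro p h.symm) x = 0) : c • x = x := by
  have := smul_eq_zero_of_level h hQ (c := c - 1) (by rw [mul_sub, hc]; ring) hx
  rwa [sub_smul, one_smul, sub_eq_zero] at this

theorem nsmul_eq_zero_plane (x : ZMod N × ZMod N) : N • x = 0 := by
  ext <;> simp

/-- For every `c` there is a functional killing `N • c` but not all of `N • V`. -/
theorem exists_functional_kill (h : Q = N * p) (hN : N ≠ 0) (hp : p.Prime)
    (c : ZMod Q × ZMod Q) : ∃ Λ : ZMod Q × ZMod Q →ₗ[ZMod Q] ZMod Q,
      (N : ZMod Q) * Λ c = 0 ∧ ∃ w, (N : ZMod Q) * Λ w ≠ 0 := by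
  have hN0 := natCast_level_ne_zero h hN hp
  by_cases hc : (N : ZMod Q) * c.1 = 0
  · exact ⟨LinearMap.fst _ _ _, hc, (1, 0), by simpa using hN0⟩
  · exact ⟨c.1 • LinearMap.snd _ _ _ - c.2 • LinearMap.fst _ _ _, by simp; ring, (0, 1), by
      simpa using hc⟩

/-- Two functionals agreeing on `N • d ≠ 0`, where they vanish, and on `N • y`, where they take
the value `N`, agree on `N • V`. -/
theorem functional_unique (h : Q = N * p) (hN : N ≠ 0) (hp : p.Prime)
    {Λ Λ' : ZMod Q × ZMod Q →ₗ[ZMod Q] ZMod Q} {d y : ZMod Q × ZMod Q} (hd : N • d ≠ 0)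
    (h1 : (N : ZMod Q) * Λ d = 0) (h1' : (N : ZMod Q) * Λ' d = 0) (h2 : (N : ZMod Q) * Λ y = N)
    (h2' : (N : ZMod Q) * Λ' y = N) (w : ZMod Q × ZMod Q) :
    (N : ZMod Q) * Λ w = N * Λ' w := by
  have cramer : ∀ w : ZMod Q × ZMod Q, (d.1 * y.2 - d.2 * y.1) • w =
      (w.1 * y.2 - w.2 * y.1) • d + (d.1 * w.2 - d.2 * w.1) • y := fun w => by
    ext <;> simp <;> ring
  have hΛ : ∀ M : ZMod Q × ZMod Q →ₗ[ZMod Q] ZMod Q, ∀ w,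
      (d.1 * y.2 - d.2 * y.1) * M w =
      (w.1 * y.2 - w.2 * y.1) * M d + (d.1 * w.2 - d.2 * w.1) * M y := fun M w => by
    have := congrArg M (cramer w)
    simpa using this
  have hD : (N : ZMod Q) * (d.1 * y.2 - d.2 * y.1) ≠ 0 := fun h0 => by
    have key : ∀ w : ZMod Q × ZMod Q, (N : ZMod Q) * (d.1 * w.2 - d.2 * w.1) = 0 := fun w => by
      linear_combination Λ w * h0 - N * hΛ Λ w - (w.1 * y.2 - w.2 * y.1) * h1 -
        (d.1 * w.2 - d.2 * w.1) * h2
    apply hd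
    have k1 := key (0, 1)
    have k2 := key (1, 0)
    ext <;> simp <;> simp at k1 k2 <;> assumption
  obtain ⟨c', hc'⟩ := exists_natCast_mul_mul_eq h hN hp hD
  have e1 := hΛ Λ w
  have e2 := hΛ Λ' w
  have e3 : (N : ZMod Q) * (d.1 * y.2 - d.2 * y.1) * Λ w =
      N * (d.1 * y.2 - d.2 * y.1) * Λ' w := by
    linear_combination N * e1 - N * e2 + (w.1 * y.2 - w.2 * y.1) * (h1 - h1') +
      (d.1 * w.2 - d.2 * w.1) * (h2 - h2')
  linear_combination c' * e3 + (Λ' w - Λ w) * hc'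

end Torsion

section Calibrated

variable {N p Q : ℕ}

/-- `Λ` takes the value `N` on the sum of every nonempty proper subsequence of `X` whose sum
is killed by `π`. -/
def Calibrated (π : ZMod Q × ZMod Q →+ ZMod N × ZMod N)
    (Λ : ZMod Q × ZMod Q →ₗ[ZMod Q] ZMod Q) (X : Multiset (ZMod Q × ZMod Q)) : Prop :=
  ∀ Ω ≤ X, Ω ≠ 0 → Ω ≠ X → π Ω.sum = 0 → Λ Ω.sum = N

variable {π : ZMod Q × ZMod Q →+ ZMod N × ZMod N} {Λ : ZMod Q × ZMod Q →ₗ[ZMod Q] ZMod Q}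
  {X E F G : Multiset (ZMod Q × ZMod Q)} {e f g : ZMod N × ZMod N}

theorem map_sum_const (hE : ∀ v ∈ E, π v = e) : π E.sum = card E • e := by
  rw [map_multiset_sum, map_congr rfl hE, map_const', sum_replicate]

theorem Calibrated.apply_eq (hc : Calibrated π Λ X) {Ω : Multiset (ZMod Q × ZMod Q)}
    (hΩ : Ω ≤ X) (h0 : 0 < card Ω) (hlt : card Ω < card X) (hs : π Ω.sum = 0) :
    Λ Ω.sum = N :=
  hc Ω hΩ (card_pos.1 h0) (fun h => hlt.ne (congrArg card h)) hs

/-- Since `1 ≤ r < |E|`, the zero-sum relation can be realised with one term of `E` exchanged for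
another. Both realisations have the same `Λ`-value `N`. -/
theorem Calibrated.exists_const (hc : Calibrated π Λ X) (hX : E + F + G ≤ X)
    (hE : ∀ v ∈ E, π v = e) (hF : ∀ v ∈ F, π v = f) (hG : ∀ v ∈ G, π v = g) {r j k : ℕ}
    (hr0 : 1 ≤ r) (hr : r < card E) (hj : j ≤ card F) (hk : k ≤ card G)
    (hz : r • e + j • f + k • g = 0) : ∃ A, ∀ v ∈ E, Λ v = A := by
  obtain ⟨F', hF', hFc⟩ := exists_le_card_eq hj
  obtain ⟨G', hG', hGc⟩ := exists_le_card_eq hk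
  obtain ⟨y, hy⟩ := card_pos_iff_exists_mem.1 (show 0 < card E by omega)
  refine ⟨Λ y, fun v hv => ?_⟩
  by_cases hvy : v = y
  · rw [hvy]
  obtain ⟨E₁, rfl⟩ := exists_cons_of_mem hy
  obtain ⟨E₂, rfl⟩ := exists_cons_of_mem ((mem_cons.1 hv).resolve_left hvy)
  simp only [card_cons] at hr
  obtain ⟨E', hE', hEc⟩ := exists_le_card_eq (show r - 1 ≤ card E₂ by omega)
  have key : ∀ z, z ∈ y ::ₘ v ::ₘ E₂ → z ::ₘ E' ≤ y ::ₘ v ::ₘ E₂ →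
      Λ (z ::ₘ E' + F' + G').sum = N := fun z hz hle => by
    have hle' : z ::ₘ E' + F' + G' ≤ y ::ₘ v ::ₘ E₂ + F + G :=
      add_le_add (add_le_add hle hF') hG'
    refine hc.apply_eq (hle'.trans hX) (by simp) ?_ ?_
    · refine lt_of_lt_of_le ?_ (card_le_card hX)
      simp only [card_add, card_cons]
      omega
    · rw [sum_add, sum_add, map_add, map_add,
        map_sum_const fun w hw => hE w (mem_of_le hle hw),
        map_sum_const fun w hw => hF w (mem_of_le hF' hw),
        map_sum_const fun w hw => hG w (mem_of_le hG' hw), card_cons, hEc, hFc, hGc,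
        Nat.sub_add_cancel hr0, ‹_ + _ + _ = (0 : ZMod N × ZMod N)›]
  have h1 := key y (mem_cons_self _ _) (cons_le_cons _ (hE'.trans (le_cons_self _ _)))
  have h2 := key v hv ((cons_le_cons v hE').trans (le_cons_self _ _))
  simp only [sum_add, sum_cons, map_add] at h1 h2
  linear_combination h2 - h1

/-- Turns a relation among the classes at level `N` into a linear equation for the constant values
of `Λ`. -/
theorem Calibrated.comb_add_eq (hc : Calibrated π Λ X) {T : Multiset (ZMod Q × ZMod Q)}
    (hX : E + F + G + T ≤ X)
    (hE : ∀ v ∈ E, π v = e) (hF : ∀ v ∈ F, π v = f) (hG : ∀ v ∈ G, π v = g) {A B C : ZMod Q}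
    (hA : ∀ v ∈ E, Λ v = A) (hB : ∀ v ∈ F, Λ v = B) (hC : ∀ v ∈ G, Λ v = C) {i j k : ℕ}
    (hi : i ≤ card E) (hj : j ≤ card F) (hk : k ≤ card G) (h0 : 0 < i + j + k)
    (hlt : i + j + k + card T < card X) (hz : i • e + j • f + k • g + π T.sum = 0) :
    (i : ZMod Q) * A + j * B + k * C + Λ T.sum = N := by
  obtain ⟨E', hE', rfl⟩ := exists_le_card_eq hi
  obtain ⟨F', hF', rfl⟩ := exists_le_card_eq hj
  obtain ⟨G', hG', rfl⟩ := exists_le_card_eq hk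
  have h1 := hc.apply_eq (Ω := E' + F' + G' + T)
    ((add_le_add (add_le_add (add_le_add hE' hF') hG') le_rfl).trans hX)
    (by simp only [card_add]; omega) (by simpa using hlt) (by
      rw [sum_add, sum_add, sum_add, map_add, map_add, map_add,
        map_sum_const fun w hw => hE w (mem_of_le hE' hw),
        map_sum_const fun w hw => hF w (mem_of_le hF' hw),
        map_sum_const fun w hw => hG w (mem_of_le hG' hw), hz])
  rw [sum_add, sum_add, sum_add, map_add, map_add, map_add, map_sum_multiset,
    map_sum_multiset Λ F', map_sum_multiset Λ G',
    sum_map_eq_card Λ A _ fun w hw => hA w (mem_of_le hE' hw),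
    sum_map_eq_card Λ B _ fun w hw => hB w (mem_of_le hF' hw),
    sum_map_eq_card Λ C _ fun w hw => hC w (mem_of_le hG' hw)] at h1
  exact h1

theorem Calibrated.comb_eq (hc : Calibrated π Λ X) (hX : E + F + G ≤ X)
    (hE : ∀ v ∈ E, π v = e) (hF : ∀ v ∈ F, π v = f) (hG : ∀ v ∈ G, π v = g) {A B C : ZMod Q}
    (hA : ∀ v ∈ E, Λ v = A) (hB : ∀ v ∈ F, Λ v = B) (hC : ∀ v ∈ G, Λ v = C) {i j k : ℕ}
    (hi : i ≤ card E) (hj : j ≤ card F) (hk : k ≤ card G) (h0 : 0 < i + j + k)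
    (hlt : i + j + k < card X) (hz : i • e + j • f + k • g = 0) :
    (i : ZMod Q) * A + j * B + k * C = N := by
  have := hc.comb_add_eq (T := 0) (by simpa using hX) hE hF hG hA hB hC hi hj hk h0
    (by simpa using hlt) (by simpa using hz)
  simpa using this

theorem exists_blocks_of_card {α : Type*} {N : ℕ} (i : ℕ) {T : Multiset α}
    (hT : card T = i * N) :
    ∃ B : Fin i → Multiset α, T = ∑ t, B t ∧ ∀ t, card (B t) = N := by
  induction i generalizing T with
  | zero => exact ⟨fun _ => 0, by simpa using hT, fun t => t.elim0⟩
  | succ i ih =>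
    classical
    rw [add_mul, one_mul] at hT
    obtain ⟨T', hT', hc⟩ := exists_le_card_eq (show i * N ≤ card T by omega)
    obtain ⟨U, rfl⟩ := Multiset.le_iff_exists_add.1 hT'
    obtain ⟨B, rfl, hB⟩ := ih hc
    refine ⟨Fin.cons U B, ?_, Fin.cases ?_ ?_⟩
    · rw [Fin.sum_univ_succ, Fin.cons_zero, add_comm]
      simp
    · rw [card_add] at hT
      simp only [Fin.cons_zero]
      omega
    · simpa using hB

/-- The functionals attached to a minimal zero-sum sequence consisting of three classes at
level `N` and a remainder, grouped into blocks of length `N` inside the classes. -/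
theorem exists_grouping (h : Q = N * p) (hN : N ≠ 0) (hp : p.Prime)
    {W R E₀ F₀ G₀ : Multiset (ZMod Q × ZMod Q)} (hW : IsMinimalZeroSum W)
    (hWe : W = E + F + G + R) (hE₀ : E₀ ≤ E) (hF₀ : F₀ ≤ F) (hG₀ : G₀ ≤ G) {i j k : ℕ}
    (hi : card E = card E₀ + i * N) (hj : card F = card F₀ + j * N)
    (hk : card G = card G₀ + k * N) (hijk : i + j + k = 2 * p - 2)
    (hE : ∀ v ∈ E, level (Dvd.intro p h.symm) v = e)
    (hF : ∀ v ∈ F, level (Dvd.intro p h.symm) v = f)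
    (hG : ∀ v ∈ G, level (Dvd.intro p h.symm) v = g) (hL : E₀ + F₀ + G₀ + R ≠ 0) :
    ∃ (BE : Fin i → Multiset (ZMod Q × ZMod Q)) (BF : Fin j → Multiset (ZMod Q × ZMod Q))
      (BG : Fin k → Multiset (ZMod Q × ZMod Q))
      (ΛE : Fin i → (ZMod Q × ZMod Q →ₗ[ZMod Q] ZMod Q))
      (ΛF : Fin j → (ZMod Q × ZMod Q →ₗ[ZMod Q] ZMod Q))
      (ΛG : Fin k → (ZMod Q × ZMod Q →ₗ[ZMod Q] ZMod Q)),
      (∀ t, card (BE t) = N ∧ E₀ + BE t ≤ E ∧ level (Dvd.intro p h.symm) (BE t).sum = 0 ∧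
        Calibrated (level (Dvd.intro p h.symm)) (ΛE t) (E₀ + F₀ + G₀ + R + BE t)) ∧
      (∀ t, card (BF t) = N ∧ F₀ + BF t ≤ F ∧ level (Dvd.intro p h.symm) (BF t).sum = 0 ∧
        Calibrated (level (Dvd.intro p h.symm)) (ΛF t) (E₀ + F₀ + G₀ + R + BF t)) ∧
      (∀ t, card (BG t) = N ∧ G₀ + BG t ≤ G ∧ level (Dvd.intro p h.symm) (BG t).sum = 0 ∧
        Calibrated (level (Dvd.intro p h.symm)) (ΛG t) (E₀ + F₀ + G₀ + R + BG t)) ∧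
      ∀ w, ∑ t, ΛE t w • (BE t).sum + ∑ t, ΛF t w • (BF t).sum + ∑ t, ΛG t w • (BG t).sum =
        -(N • w) := by
  classical
  have split : ∀ {A A₀ : Multiset (ZMod Q × ZMod Q)} {a : ZMod N × ZMod N} {l : ℕ}, A₀ ≤ A →
      card A = card A₀ + l * N → (∀ v ∈ A, level (Dvd.intro p h.symm) v = a) →
      ∃ B : Fin l → Multiset (ZMod Q × ZMod Q), A = A₀ + ∑ t, B t ∧ ∀ t, card (B t) = N ∧
        A₀ + B t ≤ A ∧ level (Dvd.intro p h.symm) (B t).sum = 0 := by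
    intro A A₀ a l hle hcard hlev
    obtain ⟨U, rfl⟩ := Multiset.le_iff_exists_add.1 hle
    obtain ⟨B, rfl, hB⟩ := exists_blocks_of_card l (T := U) (N := N)
      (by rw [card_add] at hcard; omega)
    refine ⟨B, rfl, fun t => ?_⟩
    have h1 : B t ≤ ∑ t, B t := Finset.single_le_sum (f := B) (fun _ _ => Multiset.zero_le _)
      (Finset.mem_univ t)
    refine ⟨hB t, add_le_add le_rfl h1, ?_⟩
    rw [map_sum_const fun v hv => hlev v (mem_add.2 (Or.inr (mem_of_le h1 hv))), hB t,
      nsmul_eq_zero_plane]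
  obtain ⟨BE, hEeq, hBE⟩ := split hE₀ hi hE
  obtain ⟨BF, hFeq, hBF⟩ := split hF₀ hj hF
  obtain ⟨BG, hGeq, hBG⟩ := split hG₀ hk hG
  have hne : ∀ {B : Multiset (ZMod Q × ZMod Q)}, card B = N → B ≠ 0 := fun hB h0 => by
    rw [h0, card_zero] at hB; exact hN hB.symm
  obtain ⟨lam, hlam, hid⟩ := exists_functionals h hN hp (ι := (Fin i ⊕ Fin j) ⊕ Fin k)
    (by simpa using hijk) (W := W) (L := E₀ + F₀ + G₀ + R)
    (B := Sum.elim (Sum.elim BE BF) BG) hW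
    (by
      rw [hWe, Fintype.sum_sum_type, Fintype.sum_sum_type]
      simp only [Sum.elim_inl, Sum.elim_inr]
      conv_lhs => rw [hEeq, hFeq, hGeq]
      abel) hL
    (by
      rintro ((t | t) | t)
      exacts [hne (hBE t).1, hne (hBF t).1, hne (hBG t).1])
    (by
      rintro ((t | t) | t)
      exacts [(hBE t).2.2, (hBF t).2.2, (hBG t).2.2])
  refine ⟨BE, BF, BG, fun t => lam (Sum.inl (Sum.inl t)), fun t => lam (Sum.inl (Sum.inr t)),
    fun t => lam (Sum.inr t), fun t => ⟨(hBE t).1, (hBE t).2.1, (hBE t).2.2, hlam (Sum.inl (Sum.inl t))⟩,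
    fun t => ⟨(hBF t).1, (hBF t).2.1, (hBF t).2.2, hlam (Sum.inl (Sum.inr t))⟩,
    fun t => ⟨(hBG t).1, (hBG t).2.1, (hBG t).2.2, hlam (Sum.inr t)⟩, fun w => ?_⟩
  have := hid w
  rw [Fintype.sum_sum_type, Fintype.sum_sum_type] at this
  exact this

end Calibrated

end ZeroSum

/-! ### Exotic images: a term over `e₁ + e₂` excludes the class of `κ(e₂ - e₁)` -/

namespace ZeroSum

open Multiset hiding map_add map_nsmul map_zero

variable {N p Q : ℕ}

theorem exotic_comb_eq_zero {e₁ e₂ : ZMod N × ZMod N} {r s a κ : ℕ} (hr : (r : ZMod N) = a * κ)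
    (hs : (s : ZMod N) = -(a * κ)) : r • e₁ + s • e₂ + a • (κ • (e₂ - e₁)) = 0 := by
  rw [← Nat.cast_smul_eq_nsmul (ZMod N) r, ← Nat.cast_smul_eq_nsmul (ZMod N) s,
    ← Nat.cast_smul_eq_nsmul (ZMod N) a, ← Nat.cast_smul_eq_nsmul (ZMod N) κ, hr, hs]
  module

theorem pred_nsmul_add {k : ℕ} (hk : 1 ≤ k) (x : ZMod N × ZMod N) : (k - 1) • x + x = k • x := by
  rw [← succ_nsmul, Nat.sub_add_cancel hk]

variable {e₁ e₂ : ZMod N × ZMod N} {α β : ZMod N × ZMod N →ₗ[ZMod N] ZMod N} {κ : ℕ}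
  {W E F G : Multiset (ZMod Q × ZMod Q)}

/-- Two values of `a` suffice. For `2κ < N`, `a = 2` gives `s = 0` and the first `a` with `aκ > N`
gives `N = 0`. For `2κ > N`, `a = 2` gives `s = N`; with `μ = N - κ`, the value `a = ⌊N/μ⌋ + 1` has
`t = a - 2` and again gives `N = 0`. -/
theorem exotic_relation_false (hN0 : (N : ZMod Q) ≠ 0) (h2 : 2 ≤ κ) (h3 : κ + 2 ≤ N)
    (hne : 2 * κ ≠ N) {s : ZMod Q}
    (hrel : ∀ a t r, 1 ≤ a → a < N → 0 < r → r < N → a * κ = N * t + r →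
      (t : ZMod Q) * N + s * (a - 1 - 2 * t) = 0) : False := by
  rcases lt_or_gt_of_ne hne with hlt | hgt
  · have h4 := hrel 2 0 (2 * κ) (by omega) (by omega) (by omega) hlt (by ring)
    have hs : s = 0 := by push_cast at h4; linear_combination h4
    have h5 : N / κ ≤ N / 2 := Nat.div_le_div_left h2 (by omega)
    have h6 := Nat.div_add_mod N κ
    have h7 := Nat.mod_lt N (show 0 < κ by omega)
    have h8 := hrel (N / κ + 1) 1 (κ - N % κ) (Nat.le_add_left _ _) (by omega) (by omega) (by omega)
      (by rw [add_mul, mul_comm]; omega)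
    apply hN0
    rw [hs] at h8
    push_cast at h8
    linear_combination h8
  · have h4 := hrel 2 1 (2 * κ - N) (by omega) (by omega) (by omega) (by omega) (by omega)
    have hs : s = N := by push_cast at h4; linear_combination -h4
    obtain ⟨μ, rfl⟩ : ∃ μ, N = κ + μ := ⟨N - κ, by omega⟩
    have h5 : (κ + μ) / μ ≤ (κ + μ) / 2 := Nat.div_le_div_left (by omega) (by omega)
    have h6 := Nat.div_add_mod (κ + μ) μ
    have h7 := Nat.mod_lt (κ + μ) (show 0 < μ by omega)
    have h9 : 1 ≤ (κ + μ) / μ := (Nat.one_le_div_iff (by omega)).2 (by omega)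
    obtain ⟨t, ht⟩ := Nat.exists_eq_add_of_le h9
    rw [ht] at h6 h5
    have h8 := hrel (t + 2) t ((κ + μ) - (μ - (κ + μ) % μ)) (by omega) (by omega) (by omega)
      (by omega) (by
        zify [show μ - (κ + μ) % μ ≤ κ + μ by omega, show (κ + μ) % μ ≤ μ by omega]
        zify at h6
        linear_combination -h6)
    apply hN0
    rw [hs] at h8
    push_cast at h8 ⊢
    linear_combination h8

/-- In the presence of a term over `e₁ + e₂` there are no terms over `κ • (e₂ - e₁)`. -/
theorem ExoticData.false_of_block (hx : ExoticData e₁ e₂ α β κ) (h : Q = N * p) (hp : p.Prime)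
    (hW : IsMinimalZeroSum W) {y : ZMod Q × ZMod Q} (hWe : W = E + F + G + {y}) {i j k : ℕ}
    (hi : card E = N - 1 + i * N) (hj : card F = N - 1 + j * N) (hk : card G = k * N)
    (hijk : i + j + k = 2 * p - 2) (hk0 : 0 < k)
    (hE : ∀ v ∈ E, level (Dvd.intro p h.symm) v = e₁)
    (hF : ∀ v ∈ F, level (Dvd.intro p h.symm) v = e₂)
    (hG : ∀ v ∈ G, level (Dvd.intro p h.symm) v = κ • (e₂ - e₁))
    (hy : level (Dvd.intro p h.symm) y = e₁ + e₂) : False := by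
  have h2 := hx.two_le
  have h3 := hx.add_two_le
  have hN : N ≠ 0 := by omega
  have hN0 := natCast_level_ne_zero h hN hp
  obtain ⟨E₀, hE₀, hE₀c⟩ := exists_le_card_eq (show N - 1 ≤ card E by omega)
  obtain ⟨F₀, hF₀, hF₀c⟩ := exists_le_card_eq (show N - 1 ≤ card F by omega)
  obtain ⟨-, -, BG, -, -, ΛG, -, -, hBG, -⟩ := exists_grouping h hN hp hW hWe hE₀ hF₀
    (Multiset.zero_le G) (i := i) (j := j) (k := k) (by omega) (by omega) (by simpa using hk)
    hijk hE hF hG (by simp)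
  obtain ⟨hBc, hBle, -, hcal⟩ := hBG ⟨0, hk0⟩
  generalize BG ⟨0, hk0⟩ = B at *
  generalize ΛG ⟨0, hk0⟩ = Λ at *
  replace hE : ∀ v ∈ E₀, _ := fun v hv => hE v (mem_of_le hE₀ hv)
  replace hF : ∀ v ∈ F₀, _ := fun v hv => hF v (mem_of_le hF₀ hv)
  replace hG : ∀ v ∈ B, _ := fun v hv => hG v (mem_of_le ((Multiset.le_add_left _ _).trans hBle) hv)
  have hX : E₀ + F₀ + B + {y} = E₀ + F₀ + 0 + {y} + B := by abel
  rw [← hX] at hcal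
  have hXc : card (E₀ + F₀ + B + {y}) = 3 * N - 1 := by
    simp only [card_add, card_singleton]; omega
  have hle : E₀ + F₀ + B ≤ E₀ + F₀ + B + {y} := Multiset.le_add_right _ _
  have hz1 : κ • e₁ + (N - κ) • e₂ + 1 • (κ • (e₂ - e₁)) = 0 :=
    exotic_comb_eq_zero (by simp) (by rw [natCast_sub_self (by omega)]; simp)
  obtain ⟨A, hA⟩ := hcal.exists_const hle hE hF hG (r := κ) (j := N - κ) (k := 1) (by omega)
    (by omega) (by omega) (by omega) hz1
  obtain ⟨B', hB'⟩ := hcal.exists_const (E := F₀) (F := E₀) (G := B) (by rwa [add_comm F₀])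
    hF hE hG (r := N - κ) (j := κ) (k := 1) (by omega)
    (by omega) (by omega) (by omega) (by rwa [add_comm ((N - κ) • e₂)])
  obtain ⟨C, hC⟩ := hcal.exists_const (E := B) (F := F₀) (G := E₀)
    (by rwa [add_comm, add_comm B, ← add_assoc])
    hG hF hE (r := 1) (j := N - κ) (k := κ) (by omega)
    (by omega) (by omega) (by omega)
    (by rwa [add_comm, add_comm (1 • _), ← add_assoc])
  have r1 := hcal.comb_eq hle hE hF hG hA hB' hC (i := κ) (j := N - κ) (k := 1) (by omega)
    (by omega) (by omega) (by omega) (by omega) hz1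
  have r2 := hcal.comb_add_eq le_rfl hE hF hG hA hB' hC (i := N - 1) (j := N - 1) (k := 0)
    (by omega) (by omega) (by omega) (by omega) (by rw [card_singleton]; omega) (by
      rw [sum_singleton, hy, zero_nsmul]
      calc _ = ((N - 1) • e₁ + e₁) + ((N - 1) • e₂ + e₂) := by abel
        _ = 0 := by
          rw [pred_nsmul_add (by omega), pred_nsmul_add (by omega), nsmul_eq_zero_plane,
            nsmul_eq_zero_plane, add_zero])
  have r3 := hcal.comb_add_eq le_rfl hE hF hG hA hB' hC (i := κ - 1) (j := N - κ - 1) (k := 1)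
    (by omega) (by omega) (by omega) (by omega) (by rw [card_singleton]; omega) (by
      rw [sum_singleton, hy, ← hz1]
      rw [← pred_nsmul_add (show 1 ≤ κ by omega) e₁,
        ← pred_nsmul_add (show 1 ≤ N - κ by omega) e₂]
      abel)
  rw [sum_singleton] at r2 r3
  have c1 : ((N - κ : ℕ) : ZMod Q) = N - κ := Nat.cast_sub (by omega)
  have c2 : ((N - 1 : ℕ) : ZMod Q) = N - 1 := by rw [Nat.cast_sub (by omega), Nat.cast_one]
  have c3 : ((κ - 1 : ℕ) : ZMod Q) = κ - 1 := by rw [Nat.cast_sub (by omega), Nat.cast_one]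
  have c4 : ((N - κ - 1 : ℕ) : ZMod Q) = N - κ - 1 := by
    rw [Nat.cast_sub (by omega), c1, Nat.cast_one]
  rw [c1, Nat.cast_one] at r1
  rw [c2, Nat.cast_zero] at r2
  rw [c3, c4, Nat.cast_one] at r3
  -- Comparing the relations with and without `y` eliminates both `Λ y` and `C`; what remains
  -- involves only the unknown `N * A`.
  have hAB : (N : ZMod Q) * A + N * B' = N := by linear_combination r2 - r3 + r1
  have hne : 2 * κ ≠ N := fun h2κ => by
    have h4 : (2 : ZMod N) * κ = 0 := by
      have : ((2 * κ : ℕ) : ZMod N) = 0 := by rw [h2κ, ZMod.natCast_self]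
      exact_mod_cast this
    have h5 : ((2 : ℕ) : ZMod N) = 0 := by
      exact_mod_cast hx.isUnit.mul_left_eq_zero.1 h4
    have := Nat.le_of_dvd (by omega) ((ZMod.natCast_eq_zero_iff _ _).1 h5)
    omega
  refine exotic_relation_false hN0 h2 h3 hne (s := N * A) fun a t r ha1 haN hr0 hrN har => ?_
  have har' : (a : ZMod Q) * κ = N * t + r := by exact_mod_cast congrArg (Nat.cast (R := ZMod Q)) har
  have har'' : (r : ZMod N) = a * κ := by
    have := congrArg (Nat.cast (R := ZMod N)) har
    push_cast at this
    rw [this, ZMod.natCast_self]; ring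
  have r4 := hcal.comb_eq hle hE hF hG hA hB' hC (i := r) (j := N - r) (k := a) (by omega)
    (by omega) (by omega) (by omega) (by omega) (exotic_comb_eq_zero har''
      (by rw [natCast_sub_self (by omega), har'']))
  rw [Nat.cast_sub hrN.le] at r4
  linear_combination r4 - a * r1 + (A - B') * har' + (a - t - 1) * hAB

end ZeroSum

/-! ### Exotic images: two classes and one term over `e₁ + e₂` -/

namespace ZeroSum

open Multiset hiding map_add map_nsmul map_zero

variable {N p Q : ℕ}

theorem Calibrated.exists_const_block {π : ZMod Q × ZMod Q →+ ZMod N × ZMod N}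
    {Λ : ZMod Q × ZMod Q →ₗ[ZMod Q] ZMod Q} {X E : Multiset (ZMod Q × ZMod Q)}
    {e : ZMod N × ZMod N} (hc : Calibrated π Λ X) (hN : N ≠ 0) (hX : E ≤ X)
    (hE : ∀ v ∈ E, π v = e) (hcard : N < card E) :
    ∃ A, (N : ZMod Q) * A = N ∧ ∀ v ∈ E, Λ v = A := by
  have hX' : E + 0 + 0 ≤ X := by simpa using hX
  have h0 : ∀ v ∈ (0 : Multiset (ZMod Q × ZMod Q)), π v = 0 := by simp
  have hz : N • e + 0 • (0 : ZMod N × ZMod N) + 0 • 0 = 0 := by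
    rw [nsmul_eq_zero_plane]; simp
  obtain ⟨A, hA⟩ := hc.exists_const hX' hE h0 h0 (r := N) (j := 0) (k := 0) (by omega) hcard
    le_rfl le_rfl hz
  have := hc.comb_eq hX' hE h0 h0 hA (B := 0) (C := 0) (by simp) (by simp) (i := N) (j := 0)
    (k := 0) hcard.le le_rfl le_rfl (by omega) (by have := card_le_card hX; omega) hz
  exact ⟨A, by simpa using this, hA⟩

theorem exists_nsmul_eq_sub (h : Q = N * p) (hQ : Q ≠ 0) {e : ZMod N × ZMod N}
    {a a' : ZMod Q × ZMod Q} (ha : level (Dvd.intro p h.symm) a = e)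
    (ha' : level (Dvd.intro p h.symm) a' = e) : ∃ d, a - a' = N • d :=
  (level_eq_zero_iff h hQ _).1 (by rw [map_sub, ha, ha', sub_self])

theorem exists_le_card_eq_of_pair {α : Type*} {E : Multiset α} {a a' : α} (ha : a ∈ E)
    (ha' : a' ∈ E) (hne : a ≠ a') {k : ℕ} (h2 : 2 ≤ k) (hk : k ≤ card E) :
    ∃ E₀ ≤ E, card E₀ = k ∧ a ∈ E₀ ∧ a' ∈ E₀ := by
  obtain ⟨E₁, rfl⟩ := exists_cons_of_mem ha
  obtain ⟨E₂, rfl⟩ := exists_cons_of_mem ((mem_cons.1 ha').resolve_left hne.symm)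
  simp only [card_cons] at hk
  obtain ⟨U, hU, hUc⟩ := exists_le_card_eq (show k - 2 ≤ card E₂ by omega)
  exact ⟨a ::ₘ a' ::ₘ U, cons_le_cons _ (cons_le_cons _ hU), by simp only [card_cons]; omega,
    by simp, by simp⟩

theorem sum_eq_nsmul {E : Multiset (ZMod Q × ZMod Q)} {b : ZMod Q × ZMod Q} {k : ℕ}
    (hE : ∀ v ∈ E, v = b) (hc : card E = k) : E.sum = k • b := by
  rw [eq_replicate.2 ⟨hc, hE⟩, sum_replicate]

/-- A minimal zero-sum sequence made of a class over `e₁`, a class over `e₂` and one term over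
`e₁ + e₂`. -/
structure LineData (h : Q = N * p) (W E F : Multiset (ZMod Q × ZMod Q)) (y : ZMod Q × ZMod Q)
    (e₁ e₂ : ZMod N × ZMod N) (i j : ℕ) : Prop where
  prime : p.Prime
  three_le : 3 ≤ N
  minimal : IsMinimalZeroSum W
  eq_add : W = E + F + {y}
  card_left : card E = N - 1 + i * N
  card_right : card F = N - 1 + j * N
  add_eq : i + j = 2 * p - 2
  level_left : ∀ v ∈ E, level (Dvd.intro p h.symm) v = e₁
  level_right : ∀ v ∈ F, level (Dvd.intro p h.symm) v = e₂
  level_last : level (Dvd.intro p h.symm) y = e₁ + e₂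

namespace LineData

variable {h : Q = N * p} {W E F : Multiset (ZMod Q × ZMod Q)} {y : ZMod Q × ZMod Q}
  {e₁ e₂ : ZMod N × ZMod N} {i j : ℕ}

theorem swap (hd : LineData h W E F y e₁ e₂ i j) : LineData h W F E y e₂ e₁ j i where
  prime := hd.prime
  three_le := hd.three_le
  minimal := hd.minimal
  eq_add := by rw [hd.eq_add, add_comm E]
  card_left := hd.card_right
  card_right := hd.card_left
  add_eq := by rw [add_comm, hd.add_eq]
  level_left := hd.level_right
  level_right := hd.level_left
  level_last := by rw [hd.level_last, add_comm]

theorem ne_zero (hd : LineData h W E F y e₁ e₂ i j) : N ≠ 0 := by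
  have := hd.three_le; omega

theorem modulus_ne_zero (hd : LineData h W E F y e₁ e₂ i j) : Q ≠ 0 := by
  rw [h]; exact mul_ne_zero hd.ne_zero hd.prime.ne_zero

theorem level_core (hd : LineData h W E F y e₁ e₂ i j) {E₀ F₀ : Multiset (ZMod Q × ZMod Q)}
    (hE₀ : E₀ ≤ E) (hF₀ : F₀ ≤ F) (hE₀c : card E₀ = N - 1) (hF₀c : card F₀ = N - 1) :
    level (Dvd.intro p h.symm) (E₀ + F₀ + {y}).sum = 0 := by
  have h3 := hd.three_le
  rw [sum_add, sum_add, map_add, map_add, sum_singleton, hd.level_last,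
    map_sum_const fun v hv => hd.level_left v (mem_of_le hE₀ hv),
    map_sum_const fun v hv => hd.level_right v (mem_of_le hF₀ hv), hE₀c, hF₀c]
  calc _ = ((N - 1) • e₁ + e₁) + ((N - 1) • e₂ + e₂) := by abel
    _ = 0 := by
      rw [pred_nsmul_add (by omega), pred_nsmul_add (by omega), nsmul_eq_zero_plane,
        nsmul_eq_zero_plane, add_zero]

theorem exists_grouping (hd : LineData h W E F y e₁ e₂ i j)
    {E₀ F₀ : Multiset (ZMod Q × ZMod Q)} (hE₀ : E₀ ≤ E) (hF₀ : F₀ ≤ F)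
    (hE₀c : card E₀ = N - 1) (hF₀c : card F₀ = N - 1) :
    ∃ (BE : Fin i → Multiset (ZMod Q × ZMod Q)) (BF : Fin j → Multiset (ZMod Q × ZMod Q))
      (ΛE : Fin i → (ZMod Q × ZMod Q →ₗ[ZMod Q] ZMod Q))
      (ΛF : Fin j → (ZMod Q × ZMod Q →ₗ[ZMod Q] ZMod Q)),
      (∀ t, card (BE t) = N ∧ BE t ≤ E ∧ level (Dvd.intro p h.symm) (BE t).sum = 0 ∧
        (∃ A, (N : ZMod Q) * A = N ∧ ∀ v ∈ E₀, ΛE t v = A) ∧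
        ΛE t (E₀ + F₀ + {y}).sum = N) ∧
      (∀ t, card (BF t) = N ∧ BF t ≤ F ∧ level (Dvd.intro p h.symm) (BF t).sum = 0 ∧
        (∃ A, (N : ZMod Q) * A = N ∧ ∀ v ∈ F₀, ΛF t v = A) ∧
        ΛF t (E₀ + F₀ + {y}).sum = N) ∧
      ∀ w, ∑ t, ΛE t w • (BE t).sum + ∑ t, ΛF t w • (BF t).sum = -(N • w) := by
  have h3 := hd.three_le
  have hN := hd.ne_zero
  have hcore := hd.level_core hE₀ hF₀ hE₀c hF₀c
  obtain ⟨BE, BF, BG, ΛE, ΛF, ΛG, hBE, hBF, -, hid⟩ := ZeroSum.exists_grouping h hN hd.prime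
    hd.minimal (G := 0) (R := {y}) (by rw [hd.eq_add, add_zero]) hE₀ hF₀ le_rfl (k := 0)
    (by rw [hd.card_left, hE₀c]) (by rw [hd.card_right, hF₀c]) (by simp) hd.add_eq
    hd.level_left hd.level_right (g := 0) (by simp) (by simp)
  rw [add_zero] at hBE hBF
  have hlast : ∀ B : Multiset (ZMod Q × ZMod Q), card B = N →
      ∀ Λ, Calibrated (level (Dvd.intro p h.symm)) Λ (E₀ + F₀ + {y} + B) →
        Λ (E₀ + F₀ + {y}).sum = N := fun B hB Λ hc =>
    hc.apply_eq (Multiset.le_add_right _ _) (by simp) (by simp only [card_add]; omega) hcore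
  refine ⟨BE, BF, ΛE, ΛF, fun t => ?_, fun t => ?_, fun w => by simpa using hid w⟩
  · obtain ⟨h1, h2, h4, h5⟩ := hBE t
    refine ⟨h1, (Multiset.le_add_left _ _).trans h2, h4, ?_, hlast _ h1 _ h5⟩
    obtain ⟨A, hA, hA'⟩ := h5.exists_const_block hN (E := E₀ + BE t) (by
        rw [add_assoc, add_assoc]
        exact add_le_add le_rfl ((Multiset.le_add_left _ _).trans (Multiset.le_add_left _ _)))
      (fun v hv => hd.level_left v (mem_of_le h2 hv)) (by rw [card_add]; omega)
    exact ⟨A, hA, fun v hv => hA' v (mem_add.2 (Or.inl hv))⟩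
  · obtain ⟨h1, h2, h4, h5⟩ := hBF t
    refine ⟨h1, (Multiset.le_add_left _ _).trans h2, h4, ?_, hlast _ h1 _ h5⟩
    obtain ⟨A, hA, hA'⟩ := h5.exists_const_block hN (E := F₀ + BF t) (by
        rw [add_assoc E₀, add_assoc E₀, add_assoc]
        exact (add_le_add le_rfl (Multiset.le_add_left _ _)).trans (Multiset.le_add_left _ _))
      (fun v hv => hd.level_right v (mem_of_le h2 hv)) (by rw [card_add]; omega)
    exact ⟨A, hA, fun v hv => hA' v (mem_add.2 (Or.inl hv))⟩

/-- Without blocks in `E`, all blocks lie in `F`. If `F` is constant, the linear identity would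
express every multiple of `N` through a single vector. If not, the difference of two terms of `F` is
killed by all functionals, hence zero by the identity. -/
theorem left_pos (hd : LineData h W E F y e₁ e₂ i j) : 0 < i := by
  have h3 := hd.three_le
  have hN := hd.ne_zero
  have hQ := hd.modulus_ne_zero
  rw [Nat.pos_iff_ne_zero]
  rintro rfl
  have hEc := hd.card_left
  have hFc := hd.card_right
  by_cases hconst : ∃ b, ∀ v ∈ F, v = b
  · obtain ⟨b, hb⟩ := hconst
    obtain ⟨F₀, hF₀, hF₀c⟩ := exists_le_card_eq (show N - 1 ≤ card F by omega)
    obtain ⟨BE, BF, ΛE, ΛF, -, hBF, hid⟩ := hd.exists_grouping le_rfl hF₀ (by omega) hF₀c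
    obtain ⟨Λ, hΛb, w, hw⟩ := exists_functional_kill h hN hd.prime b
    have h1 := congrArg Λ (hid w)
    rw [Finset.univ_eq_empty, Finset.sum_empty, zero_add, map_sum, map_neg, apply_nsmul,
      Finset.sum_eq_zero] at h1
    · exact hw (by linear_combination h1)
    · intro t _
      rw [sum_eq_nsmul (fun v hv => hb v (mem_of_le (hBF t).2.1 hv)) (hBF t).1, map_smul,
        apply_nsmul, hΛb, smul_zero]
  · obtain ⟨b, hb⟩ := card_pos_iff_exists_mem.1 (show 0 < card F by omega)
    push Not at hconst
    obtain ⟨b', hb', hne⟩ := hconst b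
    obtain ⟨F₀, hF₀, hF₀c, hbF, hbF'⟩ := exists_le_card_eq_of_pair hb' hb hne
      (show 2 ≤ N - 1 by omega) (by omega)
    obtain ⟨BE, BF, ΛE, ΛF, -, hBF, hid⟩ := hd.exists_grouping le_rfl hF₀ (by omega) hF₀c
    obtain ⟨d, hdd⟩ := exists_nsmul_eq_sub h hQ (hd.level_right _ hb') (hd.level_right _ hb)
    have h1 := hid d
    rw [Finset.univ_eq_empty, Finset.sum_empty, zero_add, Finset.sum_eq_zero, ← hdd] at h1
    · exact hne (sub_eq_zero.1 (neg_eq_zero.1 h1.symm))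
    · intro t _
      obtain ⟨-, -, h2, ⟨A, -, hA⟩, -⟩ := hBF t
      refine smul_eq_zero_of_level h hQ ?_ h2
      rw [← apply_nsmul, ← hdd, map_sub, hA _ hbF, hA _ hbF', sub_self]

/-- One of the two classes is constant. -/
theorem const_or_const (hd : LineData h W E F y e₁ e₂ i j) {a a' b b' : ZMod Q × ZMod Q}
    (ha : a ∈ E) (ha' : a' ∈ E) (hb : b ∈ F) (hb' : b' ∈ F) : a = a' ∨ b = b' := by
  have h3 := hd.three_le
  have hN := hd.ne_zero
  have hQ := hd.modulus_ne_zero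
  have hEc := hd.card_left
  have hFc := hd.card_right
  have hi := hd.left_pos
  have hj := hd.swap.left_pos
  have hjN : N ≤ j * N := Nat.le_mul_of_pos_left N hj
  by_contra! hne
  obtain ⟨hnea, hneb⟩ := hne
  obtain ⟨E₀, hE₀, hE₀c, haE, haE'⟩ := exists_le_card_eq_of_pair ha ha' hnea
    (show 2 ≤ N - 1 by omega) (by omega)
  obtain ⟨F₀, hF₀, hF₀c, hbF, hbF'⟩ := exists_le_card_eq_of_pair hb hb' hneb
    (show 2 ≤ N - 1 by omega) (by omega)
  obtain ⟨d, hdd⟩ := exists_nsmul_eq_sub h hQ (hd.level_left _ ha) (hd.level_left _ ha')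
  obtain ⟨δ, hδ⟩ := exists_nsmul_eq_sub h hQ (hd.level_right _ hb) (hd.level_right _ hb')
  have hd0 : N • d ≠ 0 := by rw [← hdd]; exact sub_ne_zero.2 hnea
  have hkill : ∀ Λ : ZMod Q × ZMod Q →ₗ[ZMod Q] ZMod Q,
      (∃ A, (N : ZMod Q) * A = N ∧ ∀ v ∈ E₀, Λ v = A) →
      (N : ZMod Q) * Λ d = 0 ∧ (N : ZMod Q) * Λ a = N := by
    rintro Λ ⟨A, hNA, hA⟩
    rw [hA a haE, ← apply_nsmul, ← hdd, map_sub, hA a haE, hA a' haE', sub_self]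
    exact ⟨rfl, hNA⟩
  -- On multiples of `N`, a functional of an `E`-block is determined by its values at `N • d` and `N
  -- • a`, so it does not depend on the chosen core `F₁`.
  have hother : ∀ Λ : ZMod Q × ZMod Q →ₗ[ZMod Q] ZMod Q,
      (∃ A, (N : ZMod Q) * A = N ∧ ∀ v ∈ E₀, Λ v = A) →
      ∀ F₁ ≤ F, card F₁ = N - 1 → Λ (E₀ + F₁ + {y}).sum = N := by
    intro Λ hΛ F₁ hF₁ hF₁c
    obtain ⟨BE, BF, ΛE, ΛF, hBE, -, -⟩ := hd.exists_grouping hE₀ hF₁ hE₀c hF₁c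
    obtain ⟨-, -, -, h1, h2⟩ := hBE ⟨0, hi⟩
    obtain ⟨k1, k2⟩ := hkill _ hΛ
    obtain ⟨k3, k4⟩ := hkill _ h1
    obtain ⟨w, hw⟩ := (level_eq_zero_iff h hQ _).1 (hd.level_core hE₀ hF₁ hE₀c hF₁c)
    rw [← h2, hw, apply_nsmul, apply_nsmul]
    exact functional_unique h hN hd.prime hd0 k1 k3 k2 k4 w
  -- Exchanging `b` and `b'` in the core leaves the value `N` unchanged. So every functional, of
  -- either kind, kills `b - b'`, and the identity makes this difference zero.
  have hbb : ∀ Λ : ZMod Q × ZMod Q →ₗ[ZMod Q] ZMod Q,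
      (∃ A, (N : ZMod Q) * A = N ∧ ∀ v ∈ E₀, Λ v = A) → Λ b = Λ b' := by
    intro Λ hΛ
    have h1 := hother Λ hΛ
    obtain ⟨F₁, rfl⟩ := exists_cons_of_mem hb
    obtain ⟨F₂, rfl⟩ := exists_cons_of_mem ((mem_cons.1 hb').resolve_left hneb.symm)
    simp only [card_cons] at hFc
    obtain ⟨U, hU, hUc⟩ := exists_le_card_eq (show N - 2 ≤ card F₂ by omega)
    have h4 := h1 (b ::ₘ U) (cons_le_cons _ (hU.trans (le_cons_self _ _)))
      (by rw [card_cons]; omega)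
    have h5 := h1 (b' ::ₘ U) ((cons_le_cons _ hU).trans (le_cons_self _ _))
      (by rw [card_cons]; omega)
    simp only [sum_add, sum_cons, map_add] at h4 h5
    linear_combination h4 - h5
  obtain ⟨BE, BF, ΛE, ΛF, hBE, hBF, hid⟩ := hd.exists_grouping hE₀ hF₀ hE₀c hF₀c
  have h1 := hid δ
  rw [Finset.sum_eq_zero, Finset.sum_eq_zero, ← hδ, add_zero] at h1
  · exact hneb (sub_eq_zero.1 (neg_eq_zero.1 h1.symm))
  · intro t _
    obtain ⟨-, -, h2, ⟨A, -, hA⟩, -⟩ := hBF t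
    refine smul_eq_zero_of_level h hQ ?_ h2
    rw [← apply_nsmul, ← hδ, map_sub, hA _ hbF, hA _ hbF', sub_self]
  · intro t _
    obtain ⟨-, -, h2, h4, -⟩ := hBE t
    refine smul_eq_zero_of_level h hQ ?_ h2
    rw [← apply_nsmul, ← hδ, map_sub, hbb _ h4, sub_self]

/-- With a functional `Λ` killing `N • b`, the identity at `a` becomes `(i + 1) N Λ(a) = 0`. If `p ∤
i + 1`, then `Λ` kills all block sums, hence all multiples of `N`. -/
theorem dvd_of_const_left (hd : LineData h W E F y e₁ e₂ i j) {a b : ZMod Q × ZMod Q}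
    (ha : ∀ v ∈ E, v = a) (hb : ∀ v ∈ F, v = b) : p ∣ i + 1 := by
  have h3 := hd.three_le
  have hN := hd.ne_zero
  have hQ := hd.modulus_ne_zero
  have hEc := hd.card_left
  have hFc := hd.card_right
  obtain ⟨E₀, hE₀, hE₀c⟩ := exists_le_card_eq (show N - 1 ≤ card E by omega)
  obtain ⟨F₀, hF₀, hF₀c⟩ := exists_le_card_eq (show N - 1 ≤ card F by omega)
  obtain ⟨BE, BF, ΛE, ΛF, hBE, hBF, hid⟩ := hd.exists_grouping hE₀ hF₀ hE₀c hF₀c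
  obtain ⟨Λ, hΛb, w, hw⟩ := exists_functional_kill h hN hd.prime b
  have hFz : ∀ x, Λ (∑ t, ΛF t x • (BF t).sum) = 0 := fun x => by
    rw [map_sum]
    refine Finset.sum_eq_zero fun t _ => ?_
    rw [sum_eq_nsmul (fun v hv => hb v (mem_of_le (hBF t).2.1 hv)) (hBF t).1, map_smul,
        apply_nsmul, hΛb, smul_zero]
  have hEs : ∀ t, (BE t).sum = N • a := fun t =>
    sum_eq_nsmul (fun v hv => ha v (mem_of_le (hBE t).2.1 hv)) (hBE t).1
  have haE : a ∈ E₀ := by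
    obtain ⟨x, hx⟩ := card_pos_iff_exists_mem.1 (show 0 < card E₀ by omega)
    rwa [ha x (mem_of_le hE₀ hx)] at hx
  have h1 := congrArg Λ (hid a)
  rw [map_add, hFz, add_zero, Finset.sum_congr rfl fun t _ => show ΛE t a • (BE t).sum = N • a by
      obtain ⟨-, -, h2, ⟨A, hNA, hA⟩, -⟩ := hBE t
      rw [smul_eq_self_of_level h hQ (by rw [hA a haE, hNA]) h2, hEs t],
    Finset.sum_const, Finset.card_univ, Fintype.card_fin, apply_nsmul, map_neg, apply_nsmul] at h1
  by_contra hndvd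
  have h4 : (N : ZMod Q) * ((i + 1 : ℕ) : ZMod Q) ≠ 0 := fun h0 =>
    hndvd ((natCast_mul_natCast_eq_zero_iff h hN _).1 h0)
  obtain ⟨c, hc⟩ := exists_natCast_mul_mul_eq h hN hd.prime h4
  push_cast at hc
  have h5 : (N : ZMod Q) * Λ a = 0 := by linear_combination c * h1 - Λ a * hc
  have h6 := congrArg Λ (hid w)
  rw [map_add, hFz, add_zero, map_sum, Finset.sum_eq_zero fun t _ => by
    rw [hEs t, map_smul, apply_nsmul, h5, smul_zero], map_neg, apply_nsmul] at h6
  exact hw (by linear_combination h6)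

/-- The `E`-functionals kill `a - a'`, so the identity makes this difference proportional to `N •
b`. They therefore kill `N • b` as well, and the identity at `b` reads `(j + 1) N • b = 0` with `N •
b ≠ 0`. -/
theorem dvd_of_ne_of_const_right (hd : LineData h W E F y e₁ e₂ i j)
    {a a' b : ZMod Q × ZMod Q} (ha : a ∈ E) (ha' : a' ∈ E) (hne : a ≠ a')
    (hb : ∀ v ∈ F, v = b) : p ∣ j + 1 := by
  have h3 := hd.three_le
  have hN := hd.ne_zero
  have hQ := hd.modulus_ne_zero
  have hEc := hd.card_left
  have hFc := hd.card_right
  obtain ⟨E₀, hE₀, hE₀c, haE, haE'⟩ := exists_le_card_eq_of_pair ha ha' hne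
    (show 2 ≤ N - 1 by omega) (by omega)
  obtain ⟨F₀, hF₀, hF₀c⟩ := exists_le_card_eq (show N - 1 ≤ card F by omega)
  obtain ⟨d, hdd⟩ := exists_nsmul_eq_sub h hQ (hd.level_left _ ha) (hd.level_left _ ha')
  obtain ⟨BE, BF, ΛE, ΛF, hBE, hBF, hid⟩ := hd.exists_grouping hE₀ hF₀ hE₀c hF₀c
  have hFs : ∀ t, (BF t).sum = N • b := fun t =>
    sum_eq_nsmul (fun v hv => hb v (mem_of_le (hBF t).2.1 hv)) (hBF t).1
  have hbF : b ∈ F₀ := by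
    obtain ⟨x, hx⟩ := card_pos_iff_exists_mem.1 (show 0 < card F₀ by omega)
    rwa [hb x (mem_of_le hF₀ hx)] at hx
  have hEd : ∀ t, ΛE t (a - a') = 0 := fun t => by
    obtain ⟨-, -, -, ⟨A, -, hA⟩, -⟩ := hBE t
    rw [map_sub, hA _ haE, hA _ haE', sub_self]
  have h1 := hid d
  simp only [hFs] at h1
  rw [Finset.sum_eq_zero fun t _ => smul_eq_zero_of_level h hQ
      (by rw [← apply_nsmul, ← hdd, hEd]) (hBE t).2.2.1, zero_add, ← Finset.sum_smul, ← hdd] at h1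
  set τ := ∑ t, ΛF t d
  have hlevb : level (Dvd.intro p h.symm) (N • b) = 0 := by
    rw [_root_.map_nsmul, nsmul_eq_zero_plane]
  have hτ : (N : ZMod Q) * τ ≠ 0 := fun h0 => by
    rw [smul_eq_zero_of_level h hQ h0 hlevb] at h1
    exact hne (sub_eq_zero.1 (neg_eq_zero.1 h1.symm))
  have hNb : N • b ≠ 0 := fun h0 => by
    rw [h0, smul_zero] at h1
    exact hne (sub_eq_zero.1 (neg_eq_zero.1 h1.symm))
  obtain ⟨τ', hτ'⟩ := exists_natCast_mul_mul_eq h hN hd.prime hτ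
  have hEb : ∀ t, (N : ZMod Q) * ΛE t b = 0 := fun t => by
    have h2 := congrArg (ΛE t) h1
    rw [map_neg, hEd, map_smul, apply_nsmul, smul_eq_mul] at h2
    linear_combination τ' * h2 - ΛE t b * hτ'
  have h4 := hid b
  simp only [hFs] at h4
  rw [Finset.sum_eq_zero fun t _ => smul_eq_zero_of_level h hQ (hEb t) (hBE t).2.2.1, zero_add,
    Finset.sum_congr rfl fun t _ => show ΛF t b • (N • b) = N • b by
      obtain ⟨-, -, -, ⟨A, hNA, hA⟩, -⟩ := hBF t
      exact smul_eq_self_of_level h hQ (by rw [hA b hbF, hNA]) hlevb,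
    Finset.sum_const, Finset.card_univ, Fintype.card_fin, ← sub_eq_zero, sub_neg_eq_add,
    ← succ_nsmul] at h4
  by_contra hndvd
  have h5 : (N : ZMod Q) * ((j + 1 : ℕ) : ZMod Q) ≠ 0 := fun h0 =>
    hndvd ((natCast_mul_natCast_eq_zero_iff h hN _).1 h0)
  obtain ⟨c, hc⟩ := exists_natCast_mul_mul_eq h hN hd.prime h5
  apply hNb
  rw [← Nat.cast_smul_eq_nsmul (ZMod Q), ← Nat.cast_smul_eq_nsmul (ZMod Q), smul_smul] at h4
  rw [← Nat.cast_smul_eq_nsmul (ZMod Q), ← hc,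
    show (N : ZMod Q) * (((j + 1 : ℕ) : ZMod Q) * c) = c * (((j + 1 : ℕ) : ZMod Q) * N) by ring,
    ← smul_smul, h4, smul_zero]

theorem exists_count_of_dvd (hd : LineData h W E F y e₁ e₂ i j) {a : ZMod Q × ZMod Q}
    (ha : ∀ v ∈ E, v = a) (hi : p ∣ i + 1) : Q - 1 ≤ W.count a := by
  have h2 := hd.prime.two_le
  have h3 := hd.three_le
  have h4 := hd.add_eq
  have hi' : i + 1 = p := by
    obtain ⟨c, hc⟩ := hi
    have : c < 2 := by
      by_contra hge
      have : p * 2 ≤ p * c := Nat.mul_le_mul_left p (by omega)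
      omega
    have : c ≠ 0 := by rintro rfl; omega
    obtain rfl : c = 1 := by omega
    omega
  have h5 : Q - 1 = card E := by
    rw [hd.card_left, h, ← hi', mul_add, mul_one, mul_comm]
    omega
  rw [h5, hd.eq_add, eq_replicate.2 ⟨rfl, ha⟩, count_add, count_add, count_replicate_self,
    card_replicate]
  omega

/-- A constant class whose number of blocks is `-1` modulo `p` has exactly `p - 1` blocks, because
`i + j = 2p - 2`. It thus consists of `N - 1 + (p - 1)N = Q - 1` equal terms. -/
theorem exists_count (hd : LineData h W E F y e₁ e₂ i j) : ∃ x, Q - 1 ≤ W.count x := by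
  have h3 := hd.three_le
  have hEc := hd.card_left
  have hFc := hd.card_right
  obtain ⟨a, ha⟩ := card_pos_iff_exists_mem.1 (show 0 < card E by omega)
  obtain ⟨b, hb⟩ := card_pos_iff_exists_mem.1 (show 0 < card F by omega)
  by_cases hE : ∀ v ∈ E, v = a
  · by_cases hF : ∀ v ∈ F, v = b
    · exact ⟨a, hd.exists_count_of_dvd hE (hd.dvd_of_const_left hE hF)⟩
    · push Not at hF
      obtain ⟨b', hb', hne⟩ := hF
      exact ⟨a, hd.exists_count_of_dvd hE (hd.swap.dvd_of_ne_of_const_right hb' hb hne hE)⟩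
  · push Not at hE
    obtain ⟨a', ha', hne⟩ := hE
    have hF : ∀ v ∈ F, v = b := fun v hv => (hd.const_or_const ha' ha hv hb).resolve_left hne
    exact ⟨b, hd.swap.exists_count_of_dvd hF (hd.dvd_of_ne_of_const_right ha' ha hne hF)⟩

end LineData

end ZeroSum

/-! ### Exotic images: three classes without a term over `e₁ + e₂` -/

namespace ZeroSum

open Multiset hiding map_add map_nsmul map_zero

variable {N p Q : ℕ}

/-- `Λ` is constant on each of `E₀`, `F₀`, `G₀`, with the normalisation satisfied by the
functional of a block in the class of `E₀`. -/
def FanValues (N κ ι : ℕ) (Λ : ZMod Q × ZMod Q →ₗ[ZMod Q] ZMod Q)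
    (E₀ F₀ G₀ : Multiset (ZMod Q × ZMod Q)) : Prop :=
  ∃ A B C, (N : ZMod Q) * A = N ∧ (∀ v ∈ E₀, Λ v = A) ∧ (∀ v ∈ F₀, Λ v = B) ∧
    (∀ v ∈ G₀, Λ v = C) ∧ (N ≤ κ * ι → (N : ZMod Q) * C = 0 ∧ (N : ZMod Q) * B = N)

/-- The relation `(N - 1)e₁ + e₂ + ι κ(e₂ - e₁) = 0` links the three constants. When `κι ≥ N`, the
first multiple of `ι` beyond `N` uses at most `κ` copies of `e₂` and supplies a second independent
relation, which fixes the remaining constants after multiplication by `N`. -/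
theorem Calibrated.fanValues {π : ZMod Q × ZMod Q →+ ZMod N × ZMod N}
    {Λ : ZMod Q × ZMod Q →ₗ[ZMod Q] ZMod Q} {X B E₀ F₀ G₀ : Multiset (ZMod Q × ZMod Q)}
    {e₁ e₂ : ZMod N × ZMod N} {κ ι : ℕ} (hc : Calibrated π Λ X) (h2 : 2 ≤ κ) (h3 : κ + 2 ≤ N)
    (hι2 : 2 ≤ ι) (hι3 : ι + 2 ≤ N) (hικ : (ι : ZMod N) * κ = -1)
    (hX : E₀ + B + F₀ + G₀ ≤ X) (hE : ∀ v ∈ E₀ + B, π v = e₁) (hF : ∀ v ∈ F₀, π v = e₂)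
    (hG : ∀ v ∈ G₀, π v = κ • (e₂ - e₁)) (hB : card B = N) (hEc : card E₀ = N - κ)
    (hFc : card F₀ = κ) (hGc : card G₀ = N - 1) : FanValues N κ ι Λ E₀ F₀ G₀ := by
  have hEBc : card (E₀ + B) = 2 * N - κ := by rw [card_add]; omega
  have hXc := card_le_card hX
  rw [card_add, card_add] at hXc
  obtain ⟨A, hNA, hA⟩ := hc.exists_const_block (by omega) (E := E₀ + B)
    ((Multiset.le_add_right _ _).trans ((Multiset.le_add_right _ _).trans hX)) hE (by omega)
  have hz : (N - 1) • e₁ + 1 • e₂ + ι • (κ • (e₂ - e₁)) = 0 :=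
    exotic_comb_eq_zero (by rw [natCast_sub_self (by omega), hικ]; simp) (by rw [hικ]; simp)
  obtain ⟨b, hb⟩ := hc.exists_const (E := F₀) (F := E₀ + B) (G := G₀)
    (by rwa [add_comm F₀]) hF hE hG (r := 1) (j := N - 1) (k := ι) le_rfl (by omega) (by omega)
    (by omega) (by rwa [add_comm (1 • e₂)])
  obtain ⟨c, hcc⟩ := hc.exists_const (E := G₀) (F := E₀ + B) (G := F₀)
    (by rwa [add_assoc, add_comm G₀]) hG hE hF (r := ι) (j := N - 1) (k := 1) (by omega)
    (by omega) (by omega) (by omega) (by rwa [add_assoc, add_comm (ι • _)])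
  refine ⟨A, b, c, hNA, fun v hv => hA v (mem_add.2 (Or.inl hv)), hb, hcc, fun hle => ?_⟩
  have r1 := hc.comb_eq hX hE hF hG hA hb hcc (i := N - 1) (j := 1) (k := ι) (by omega) (by omega)
    (by omega) (by omega) (by omega) hz
  rw [Nat.cast_sub (by omega), Nat.cast_one] at r1
  have hbeq : b = A - ι * c := by linear_combination r1 - hNA
  obtain ⟨t, ht⟩ : N ∣ ι * κ + 1 := by
    rw [← ZMod.natCast_eq_zero_iff]
    push_cast
    rw [hικ]; ring
  have ht2 : 2 ≤ t := by
    by_contra hlt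
    have : N * t ≤ N * 1 := Nat.mul_le_mul_left N (by omega)
    rw [mul_comm] at hle
    omega
  have ht3 : 2 * N ≤ κ * ι + 1 := by
    rw [mul_comm κ, ht, mul_comm]
    exact Nat.mul_le_mul_left N ht2
  have h6 := Nat.div_add_mod N ι
  have h7 := Nat.mod_lt N (show 0 < ι by omega)
  have hkκ : N / ι + 1 ≤ κ := by
    by_contra hlt
    have h8 : κ * ι ≤ (N / ι) * ι := Nat.mul_le_mul_right ι (by omega)
    rw [mul_comm (N / ι)] at h8
    omega
  generalize hk : N / ι + 1 = k at hkκ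
  have hr : k * ι = N + (ι - N % ι) := by rw [← hk, add_mul, mul_comm]; omega
  generalize ι - N % ι = r at *
  have hrι : r ≤ ι := by
    by_contra hlt
    have h9 : (N / ι) * ι ≤ N := Nat.div_mul_le_self N ι
    rw [← hk, add_mul] at hr
    omega
  have hrκ : (r : ZMod N) * κ = -k := by
    have h8 := congrArg (Nat.cast (R := ZMod N)) hr
    push_cast at h8
    rw [ZMod.natCast_self, zero_add] at h8
    rw [← h8, mul_assoc, hικ]; ring
  have r2 := hc.comb_eq hX hE hF hG hA hb hcc (i := N - k) (j := k) (k := r) (by omega) (by omega)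
    (by omega) (by omega) (by omega)
    (exotic_comb_eq_zero (by rw [natCast_sub_self (by omega), hrκ]) (by rw [hrκ, neg_neg]))
  rw [Nat.cast_sub (by omega)] at r2
  have hr' : (k : ZMod Q) * ι = N + r := by exact_mod_cast congrArg (Nat.cast (R := ZMod Q)) hr
  have hNc : (N : ZMod Q) * c = 0 := by
    rw [hbeq] at r2
    linear_combination -r2 + hNA - c * hr'
  exact ⟨hNc, by rw [hbeq]; linear_combination hNA - ι * hNc⟩

/-- A minimal zero-sum sequence made of classes over `e₁`, `e₂` and `κ • (e₂ - e₁)`. -/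
structure FanData (h : Q = N * p) (W E F G : Multiset (ZMod Q × ZMod Q))
    (e₁ e₂ : ZMod N × ZMod N) (κ ι i j k : ℕ) : Prop where
  prime : p.Prime
  two_le : 2 ≤ κ
  add_two_le : κ + 2 ≤ N
  two_le_inv : 2 ≤ ι
  inv_add_two_le : ι + 2 ≤ N
  inv_mul : (ι : ZMod N) * κ = -1
  minimal : IsMinimalZeroSum W
  eq_add : W = E + F + G
  card_left : card E = N - κ + i * N
  card_right : card F = κ + j * N
  card_third : card G = N - 1 + k * N
  add_eq : i + j + k = 2 * p - 2
  level_left : ∀ v ∈ E, level (Dvd.intro p h.symm) v = e₁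
  level_right : ∀ v ∈ F, level (Dvd.intro p h.symm) v = e₂
  level_third : ∀ v ∈ G, level (Dvd.intro p h.symm) v = κ • (e₂ - e₁)

namespace FanData

variable {h : Q = N * p} {W E F G : Multiset (ZMod Q × ZMod Q)} {e₁ e₂ : ZMod N × ZMod N}
  {κ ι i j k : ℕ}

theorem swap (hd : FanData h W E F G e₁ e₂ κ ι i j k) :
    FanData h W F E G e₂ e₁ (N - κ) (N - ι) j i k where
  prime := hd.prime
  two_le := by have := hd.add_two_le; omega
  add_two_le := by have := hd.two_le; have := hd.add_two_le; omega
  two_le_inv := by have := hd.inv_add_two_le; omega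
  inv_add_two_le := by have := hd.two_le_inv; have := hd.inv_add_two_le; omega
  inv_mul := by
    have h1 := hd.add_two_le
    have h2 := hd.inv_add_two_le
    rw [natCast_sub_self (by omega), natCast_sub_self (by omega), neg_mul_neg, hd.inv_mul]
  minimal := hd.minimal
  eq_add := by rw [hd.eq_add, add_comm E]
  card_left := by rw [hd.card_right]; have := hd.add_two_le; omega
  card_right := hd.card_left
  card_third := hd.card_third
  add_eq := by rw [← hd.add_eq]; omega
  level_left := hd.level_right
  level_right := hd.level_left
  level_third := fun v hv => by
    have h1 := hd.add_two_le
    rw [hd.level_third v hv, ← Nat.cast_smul_eq_nsmul (ZMod N) (N - κ),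
      natCast_sub_self (by omega), ← Nat.cast_smul_eq_nsmul (ZMod N) κ]
    module

theorem ne_zero (hd : FanData h W E F G e₁ e₂ κ ι i j k) : N ≠ 0 := by
  have := hd.add_two_le; omega

theorem modulus_ne_zero (hd : FanData h W E F G e₁ e₂ κ ι i j k) : Q ≠ 0 := by
  rw [h]; exact mul_ne_zero hd.ne_zero hd.prime.ne_zero

theorem exists_grouping (hd : FanData h W E F G e₁ e₂ κ ι i j k)
    {E₀ F₀ G₀ : Multiset (ZMod Q × ZMod Q)} (hE₀ : E₀ ≤ E) (hF₀ : F₀ ≤ F) (hG₀ : G₀ ≤ G)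
    (hE₀c : card E₀ = N - κ) (hF₀c : card F₀ = κ) (hG₀c : card G₀ = N - 1) :
    ∃ (BE : Fin i → Multiset (ZMod Q × ZMod Q)) (BF : Fin j → Multiset (ZMod Q × ZMod Q))
      (BG : Fin k → Multiset (ZMod Q × ZMod Q))
      (ΛE : Fin i → (ZMod Q × ZMod Q →ₗ[ZMod Q] ZMod Q))
      (ΛF : Fin j → (ZMod Q × ZMod Q →ₗ[ZMod Q] ZMod Q))
      (ΛG : Fin k → (ZMod Q × ZMod Q →ₗ[ZMod Q] ZMod Q)),
      (∀ t, card (BE t) = N ∧ BE t ≤ E ∧ level (Dvd.intro p h.symm) (BE t).sum = 0 ∧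
        FanValues N κ ι (ΛE t) E₀ F₀ G₀) ∧
      (∀ t, card (BF t) = N ∧ BF t ≤ F ∧ level (Dvd.intro p h.symm) (BF t).sum = 0 ∧
        FanValues N (N - κ) (N - ι) (ΛF t) F₀ E₀ G₀) ∧
      (∀ t, card (BG t) = N ∧ BG t ≤ G ∧ level (Dvd.intro p h.symm) (BG t).sum = 0 ∧
        ∃ C, ∀ v ∈ G₀, ΛG t v = C) ∧
      ∀ w, ∑ t, ΛE t w • (BE t).sum + ∑ t, ΛF t w • (BF t).sum + ∑ t, ΛG t w • (BG t).sum =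
        -(N • w) := by
  have h2 := hd.two_le
  have h3 := hd.add_two_le
  have hN := hd.ne_zero
  have hs := hd.swap
  obtain ⟨BE, BF, BG, ΛE, ΛF, ΛG, hBE, hBF, hBG, hid⟩ := ZeroSum.exists_grouping h hN hd.prime
    hd.minimal (R := 0) (by rw [hd.eq_add, add_zero]) hE₀ hF₀ hG₀
    (by rw [hd.card_left, hE₀c]) (by rw [hd.card_right, hF₀c]) (by rw [hd.card_third, hG₀c])
    hd.add_eq hd.level_left hd.level_right hd.level_third (by
      rw [← card_pos]; simp only [card_add]; omega)
  rw [add_zero] at hBE hBF hBG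
  refine ⟨BE, BF, BG, ΛE, ΛF, ΛG, fun t => ?_, fun t => ?_, fun t => ?_, hid⟩
  · obtain ⟨h1, h4, h5, h6⟩ := hBE t
    refine ⟨h1, (Multiset.le_add_left _ _).trans h4, h5, ?_⟩
    exact h6.fanValues h2 h3 hd.two_le_inv hd.inv_add_two_le hd.inv_mul
      (show E₀ + BE t + F₀ + G₀ ≤ _ from le_of_eq (by abel))
      (fun v hv => hd.level_left v (mem_of_le h4 hv))
      (fun v hv => hd.level_right v (mem_of_le hF₀ hv))
      (fun v hv => hd.level_third v (mem_of_le hG₀ hv)) h1 hE₀c hF₀c hG₀c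
  · obtain ⟨h1, h4, h5, h6⟩ := hBF t
    refine ⟨h1, (Multiset.le_add_left _ _).trans h4, h5, ?_⟩
    exact h6.fanValues hs.two_le hs.add_two_le hs.two_le_inv hs.inv_add_two_le hs.inv_mul
      (show F₀ + BF t + E₀ + G₀ ≤ _ from le_of_eq (by abel))
      (fun v hv => hs.level_left v (mem_of_le h4 hv))
      (fun v hv => hs.level_right v (mem_of_le hE₀ hv))
      (fun v hv => hs.level_third v (mem_of_le hG₀ hv)) h1 (by omega) hE₀c hG₀c
  · obtain ⟨h1, h4, h5, h6⟩ := hBG t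
    refine ⟨h1, (Multiset.le_add_left _ _).trans h4, h5, ?_⟩
    obtain ⟨C, -, hC⟩ := h6.exists_const_block hN (E := G₀ + BG t)
      (by rw [add_assoc]; exact Multiset.le_add_left _ _)
      (fun v hv => hd.level_third v (mem_of_le h4 hv)) (by rw [card_add]; omega)
    exact ⟨C, fun v hv => hC v (mem_add.2 (Or.inl hv))⟩

/-- Every functional is constant on `G₀`, so all of them kill the difference of two terms of the
third class; by the identity this difference is zero. -/
theorem third_const (hd : FanData h W E F G e₁ e₂ κ ι i j k) {c c' : ZMod Q × ZMod Q}
    (hc : c ∈ G) (hc' : c' ∈ G) : c = c' := by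
  have h2 := hd.two_le
  have h3 := hd.add_two_le
  have hQ := hd.modulus_ne_zero
  have hEc := hd.card_left
  have hFc := hd.card_right
  have hGc := hd.card_third
  by_contra hne
  obtain ⟨E₀, hE₀, hE₀c⟩ := exists_le_card_eq (show N - κ ≤ card E by omega)
  obtain ⟨F₀, hF₀, hF₀c⟩ := exists_le_card_eq (show κ ≤ card F by omega)
  obtain ⟨G₀, hG₀, hG₀c, hcG, hcG'⟩ := exists_le_card_eq_of_pair hc hc' hne
    (show 2 ≤ N - 1 by omega) (by omega)
  obtain ⟨BE, BF, BG, ΛE, ΛF, ΛG, hBE, hBF, hBG, hid⟩ :=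
    hd.exists_grouping hE₀ hF₀ hG₀ hE₀c hF₀c hG₀c
  obtain ⟨d, hdd⟩ := exists_nsmul_eq_sub h hQ (hd.level_third _ hc) (hd.level_third _ hc')
  have hkill : ∀ (Λ : ZMod Q × ZMod Q →ₗ[ZMod Q] ZMod Q) (C : ZMod Q), (∀ v ∈ G₀, Λ v = C) →
      (N : ZMod Q) * Λ d = 0 := fun Λ C hC => by
    rw [← apply_nsmul, ← hdd, map_sub, hC _ hcG, hC _ hcG', sub_self]
  have h1 := hid d
  rw [Finset.sum_eq_zero, Finset.sum_eq_zero, Finset.sum_eq_zero, ← hdd, add_zero, add_zero] at h1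
  · exact hne (sub_eq_zero.1 (neg_eq_zero.1 h1.symm))
  · intro t _
    obtain ⟨-, -, h5, C, hC⟩ := hBG t
    exact smul_eq_zero_of_level h hQ (hkill _ C hC) h5
  · intro t _
    obtain ⟨-, -, h5, A, B, C, -, -, -, hC, -⟩ := hBF t
    exact smul_eq_zero_of_level h hQ (hkill _ C hC) h5
  · intro t _
    obtain ⟨-, -, h5, A, B, C, -, -, -, hC, -⟩ := hBE t
    exact smul_eq_zero_of_level h hQ (hkill _ C hC) h5

/-- A functional killing `N • c`, where `c` is the value of the third class, is constant on the
first class. -/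
theorem left_eq (hd : FanData h W E F G e₁ e₂ κ ι i j k) {c : ZMod Q × ZMod Q} (hc : c ∈ G)
    {Λ : ZMod Q × ZMod Q →ₗ[ZMod Q] ZMod Q} (hΛ : (N : ZMod Q) * Λ c = 0)
    {a a' : ZMod Q × ZMod Q} (ha : a ∈ E) (ha' : a' ∈ E) : Λ a = Λ a' := by
  have h2 := hd.two_le
  have h3 := hd.add_two_le
  have hQ := hd.modulus_ne_zero
  have hEc := hd.card_left
  have hFc := hd.card_right
  have hGc := hd.card_third
  by_cases hne : a = a'
  · rw [hne]
  obtain ⟨E₀, hE₀, hE₀c, haE, haE'⟩ := exists_le_card_eq_of_pair ha ha' hne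
    (show 2 ≤ N - κ by omega) (by omega)
  obtain ⟨F₀, hF₀, hF₀c⟩ := exists_le_card_eq (show κ ≤ card F by omega)
  obtain ⟨G₀, hG₀, hG₀c⟩ := exists_le_card_eq (show N - 1 ≤ card G by omega)
  obtain ⟨BE, BF, BG, ΛE, ΛF, ΛG, hBE, hBF, hBG, hid⟩ :=
    hd.exists_grouping hE₀ hF₀ hG₀ hE₀c hF₀c hG₀c
  obtain ⟨d, hdd⟩ := exists_nsmul_eq_sub h hQ (hd.level_left _ ha) (hd.level_left _ ha')
  have hkill : ∀ (Λ : ZMod Q × ZMod Q →ₗ[ZMod Q] ZMod Q) (C : ZMod Q), (∀ v ∈ E₀, Λ v = C) →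
      (N : ZMod Q) * Λ d = 0 := fun Λ C hC => by
    rw [← apply_nsmul, ← hdd, map_sub, hC _ haE, hC _ haE', sub_self]
  have h1 := hid d
  rw [Finset.sum_eq_zero fun t _ => by
      obtain ⟨-, -, h5, A, B, C, -, hA, -, -, -⟩ := hBE t
      exact smul_eq_zero_of_level h hQ (hkill _ A hA) h5,
    Finset.sum_eq_zero fun t _ => by
      obtain ⟨-, -, h5, A, B, C, -, -, hB, -, -⟩ := hBF t
      exact smul_eq_zero_of_level h hQ (hkill _ B hB) h5, ← hdd, zero_add, zero_add] at h1
  have h4 := congrArg Λ h1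
  rw [map_sum, Finset.sum_eq_zero fun t _ => by
    rw [sum_eq_nsmul (fun v hv => hd.third_const (mem_of_le (hBG t).2.1 hv) hc) (hBG t).1,
      map_smul, apply_nsmul, hΛ, smul_zero], map_neg, map_sub] at h4
  linear_combination h4

theorem apply_block (hd : FanData h W E F G e₁ e₂ κ ι i j k) {c : ZMod Q × ZMod Q} (hc : c ∈ G)
    {Λ : ZMod Q × ZMod Q →ₗ[ZMod Q] ZMod Q} (hΛ : (N : ZMod Q) * Λ c = 0)
    {a : ZMod Q × ZMod Q} (ha : a ∈ E) {B : Multiset (ZMod Q × ZMod Q)} (hB : B ≤ E)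
    (hBc : card B = N) : Λ B.sum = N * Λ a := by
  rw [map_sum_multiset, sum_map_eq_card Λ (Λ a) B fun v hv => hd.left_eq hc hΛ (mem_of_le hB hv) ha,
    hBc]

/-- The functional of an `E`-block kills the sums of the `G`-blocks. Applied to the identity at a
term `b` of the second class, it receives `N` from each `E`- and `F`-block and `-N` from the right
side. -/
theorem dvd_of_le_mul (hd : FanData h W E F G e₁ e₂ κ ι i j k) (hi : 0 < i) (hle : N ≤ κ * ι) :
    p ∣ i + j + 1 := by
  have h2 := hd.two_le
  have h3 := hd.add_two_le
  have hN := hd.ne_zero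
  have hEc := hd.card_left
  have hFc := hd.card_right
  have hGc := hd.card_third
  obtain ⟨E₀, hE₀, hE₀c⟩ := exists_le_card_eq (show N - κ ≤ card E by omega)
  obtain ⟨F₀, hF₀, hF₀c⟩ := exists_le_card_eq (show κ ≤ card F by omega)
  obtain ⟨G₀, hG₀, hG₀c⟩ := exists_le_card_eq (show N - 1 ≤ card G by omega)
  obtain ⟨BE, BF, BG, ΛE, ΛF, ΛG, hBE, hBF, hBG, hid⟩ :=
    hd.exists_grouping hE₀ hF₀ hG₀ hE₀c hF₀c hG₀c
  obtain ⟨a, ha⟩ := card_pos_iff_exists_mem.1 (show 0 < card E₀ by omega)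
  obtain ⟨b, hb⟩ := card_pos_iff_exists_mem.1 (show 0 < card F₀ by omega)
  obtain ⟨c, hc⟩ := card_pos_iff_exists_mem.1 (show 0 < card G₀ by omega)
  have hcG := mem_of_le hG₀ hc
  obtain ⟨-, -, -, A, B, C, hNA, hA, hB, hC, hcond⟩ := hBE ⟨0, hi⟩
  obtain ⟨hNC, hNB⟩ := hcond hle
  generalize ΛE ⟨0, hi⟩ = Λ at hA hB hC
  have hΛ : (N : ZMod Q) * Λ c = 0 := by rw [hC c hc, hNC]
  have h1 := congrArg Λ (hid b)
  simp only [map_add, map_sum, map_smul, smul_eq_mul] at h1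
  rw [Finset.sum_congr rfl fun t _ => show ΛE t b * Λ (BE t).sum = N by
      rw [hd.apply_block hcG hΛ (mem_of_le hE₀ ha) (hBE t).2.1 (hBE t).1, hA a ha, hNA]
      obtain ⟨-, -, -, A', B', C', -, -, hB', -, hcond'⟩ := hBE t
      rw [hB' b hb, mul_comm, (hcond' hle).2],
    Finset.sum_congr rfl fun t _ => show ΛF t b * Λ (BF t).sum = N by
      rw [hd.swap.apply_block hcG hΛ (mem_of_le hF₀ hb) (hBF t).2.1 (hBF t).1, hB b hb, hNB]
      obtain ⟨-, -, -, A', B', C', hNA', hA', -⟩ := hBF t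
      rw [hA' b hb, mul_comm, hNA'],
    Finset.sum_eq_zero (s := Finset.univ) (f := fun t => ΛG t b * Λ (BG t).sum) fun t _ => by
      rw [sum_eq_nsmul (fun v hv => hd.third_const (mem_of_le (hBG t).2.1 hv) hcG) (hBG t).1,
        apply_nsmul, hΛ, mul_zero], map_neg, apply_nsmul, hB b hb, hNB] at h1
  simp only [Finset.sum_const, Finset.card_univ, Fintype.card_fin, nsmul_eq_mul] at h1
  rw [← natCast_mul_natCast_eq_zero_iff h hN]
  push_cast
  linear_combination h1

/-- Under a functional killing `N • c`, only the `E`-blocks contribute. The identity at a term `a`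
then gives `(i + 1) N Λ(a) = 0`, and `Λ(a)` cannot be killed by `N`. -/
theorem dvd_of_right_eq_zero (hd : FanData h W E F G e₁ e₂ κ ι i 0 k) : p ∣ i + 1 := by
  have h2 := hd.two_le
  have h3 := hd.add_two_le
  have hN := hd.ne_zero
  have hQ := hd.modulus_ne_zero
  have hEc := hd.card_left
  have hFc := hd.card_right
  have hGc := hd.card_third
  obtain ⟨E₀, hE₀, hE₀c⟩ := exists_le_card_eq (show N - κ ≤ card E by omega)
  obtain ⟨F₀, hF₀, hF₀c⟩ := exists_le_card_eq (show κ ≤ card F by omega)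
  obtain ⟨G₀, hG₀, hG₀c⟩ := exists_le_card_eq (show N - 1 ≤ card G by omega)
  obtain ⟨BE, BF, BG, ΛE, ΛF, ΛG, hBE, -, hBG, hid⟩ :=
    hd.exists_grouping hE₀ hF₀ hG₀ hE₀c hF₀c hG₀c
  obtain ⟨a, ha⟩ := card_pos_iff_exists_mem.1 (show 0 < card E₀ by omega)
  obtain ⟨c, hc⟩ := card_pos_iff_exists_mem.1 (show 0 < card G by omega)
  obtain ⟨Λ, hΛ, w, hw⟩ := exists_functional_kill h hN hd.prime c
  have hid' : ∀ x, ∑ t, ΛE t x * (N * Λ a) = -(N * Λ x) := fun x => by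
    have h1 := congrArg Λ (hid x)
    simp only [map_add, map_sum, map_smul, smul_eq_mul] at h1
    rw [Finset.univ_eq_empty (α := Fin 0), Finset.sum_empty, add_zero,
      Finset.sum_congr rfl fun t _ => show ΛE t x * Λ (BE t).sum = ΛE t x * (N * Λ a) by
        rw [hd.apply_block hc hΛ (mem_of_le hE₀ ha) (hBE t).2.1 (hBE t).1],
      Finset.sum_eq_zero (s := Finset.univ) (f := fun t => ΛG t x * Λ (BG t).sum) fun t _ => by
        rw [sum_eq_nsmul (fun v hv => hd.third_const (mem_of_le (hBG t).2.1 hv) hc) (hBG t).1,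
          apply_nsmul, hΛ, mul_zero], map_neg, apply_nsmul, add_zero] at h1
    exact h1
  have h1 := hid' a
  rw [Finset.sum_congr rfl fun t _ => show ΛE t a * (N * Λ a) = N * Λ a by
      obtain ⟨-, -, -, A, B, C, hNA, hA, -⟩ := hBE t
      rw [hA a ha, ← mul_assoc, mul_comm A, hNA]] at h1
  simp only [Finset.sum_const, Finset.card_univ, Fintype.card_fin, nsmul_eq_mul] at h1
  by_contra hndvd
  have h4 : (N : ZMod Q) * ((i + 1 : ℕ) : ZMod Q) ≠ 0 := fun h0 =>
    hndvd ((natCast_mul_natCast_eq_zero_iff h hN _).1 h0)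
  obtain ⟨x, hx⟩ := exists_natCast_mul_mul_eq h hN hd.prime h4
  push_cast at hx
  have h5 : (N : ZMod Q) * Λ a = 0 := by linear_combination x * h1 - Λ a * hx
  have h6 := hid' w
  simp only [h5, mul_zero, Finset.sum_const_zero] at h6
  exact hw (by linear_combination h6)

theorem le_mul_or_le_mul (hd : FanData h W E F G e₁ e₂ κ ι i j k) :
    N ≤ κ * ι ∨ N ≤ (N - κ) * (N - ι) := by
  have h2 := hd.two_le
  have h3 := hd.add_two_le
  have h4 := hd.two_le_inv
  have h5 := hd.inv_add_two_le
  by_contra! hlt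
  obtain ⟨hlt, hlt'⟩ := hlt
  obtain ⟨u, hu⟩ : ∃ u, N = κ + 2 + u := ⟨N - κ - 2, by omega⟩
  obtain ⟨v, hv⟩ : ∃ v, N = ι + 2 + v := ⟨N - ι - 2, by omega⟩
  have e1 : N - κ = u + 2 := by omega
  have e2 : N - ι = v + 2 := by omega
  rw [e1, e2] at hlt'
  nlinarith

theorem dvd (hd : FanData h W E F G e₁ e₂ κ ι i j k) : p ∣ i + j + 1 := by
  rcases Nat.eq_zero_or_pos j with rfl | hj
  · exact hd.dvd_of_right_eq_zero
  rcases Nat.eq_zero_or_pos i with rfl | hi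
  · rw [zero_add]; exact hd.swap.dvd_of_right_eq_zero
  rcases hd.le_mul_or_le_mul with hle | hle
  · exact hd.dvd_of_le_mul hi hle
  · rw [add_comm i]; exact hd.swap.dvd_of_le_mul hj hle

/-- Divisibility forces `i + j + 1 = p`, hence `k = p - 1`, and the constant third class has `N - 1
+ (p - 1)N = Q - 1` terms. -/
theorem exists_count (hd : FanData h W E F G e₁ e₂ κ ι i j k) : ∃ x, Q - 1 ≤ W.count x := by
  have h2 := hd.prime.two_le
  have h3 := hd.add_two_le
  have h4 := hd.add_eq
  have hGc := hd.card_third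
  obtain ⟨c, hc⟩ := card_pos_iff_exists_mem.1 (show 0 < card G by omega)
  have hk : k + 1 = p := by
    obtain ⟨x, hx⟩ := hd.dvd
    have : x < 2 := by
      by_contra hge
      have : p * 2 ≤ p * x := Nat.mul_le_mul_left p (by omega)
      omega
    have : x ≠ 0 := by rintro rfl; omega
    obtain rfl : x = 1 := by omega
    omega
  have h5 : Q - 1 = card G := by
    rw [hGc, h, ← hk, mul_add, mul_one, mul_comm]
    omega
  refine ⟨c, ?_⟩
  rw [h5, hd.eq_add, eq_replicate.2 ⟨rfl, fun v hv => hd.third_const hv hc⟩, count_add,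
    count_replicate_self, card_replicate]
  omega

end FanData

end ZeroSum

/-! ### Exclusion of exotic images by climbing the levels -/

namespace ZeroSum

open Multiset hiding map_add map_nsmul map_zero

theorem exists_split_of_map_le {α β : Type*} [DecidableEq β] [DecidableEq α] {f : α → β}
    {W : Multiset α} {A B : Multiset β} (h : W.map f ≤ A + B) :
    ∃ W₁ W₂, W = W₁ + W₂ ∧ W₁.map f ≤ A ∧ W₂.map f ≤ B := by
  obtain ⟨W₁, hW₁, h1⟩ := exists_le_of_le_map (Multiset.inter_le_left (s := W.map f) (t := A))
  obtain ⟨W₂, rfl⟩ := Multiset.le_iff_exists_add.1 hW₁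
  refine ⟨W₁, W₂, rfl, h1 ▸ Multiset.inter_le_right, ?_⟩
  have h2 : W₂.map f = (W₁ + W₂).map f - A := by
    rw [← add_right_inj (W₁.map f), ← Multiset.map_add]
    rw [h1]
    exact ((add_comm _ _).trans (Multiset.sub_add_inter _ _)).symm
  rw [h2]
  exact tsub_le_iff_left.2 h

variable {N p Q : ℕ}

theorem forall_eq_of_map_le_replicate {α β : Type*} {f : α → β} {E : Multiset α} {k : ℕ} {e : β}
    (h : E.map f ≤ replicate k e) : ∀ v ∈ E, f v = e := fun _ hv =>
  eq_of_mem_replicate (mem_of_le h (mem_map_of_mem f hv))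

theorem ExoticData.exists_inv {e₁ e₂ : ZMod N × ZMod N}
    {α β : ZMod N × ZMod N →ₗ[ZMod N] ZMod N} {κ : ℕ} (hx : ExoticData e₁ e₂ α β κ) :
    ∃ ι : ℕ, 2 ≤ ι ∧ ι + 2 ≤ N ∧ (ι : ZMod N) * κ = -1 := by
  have h3 := hx.add_two_le
  have : NeZero N := ⟨by omega⟩
  obtain ⟨u, hu⟩ := hx.isUnit
  obtain ⟨-, h1, h2⟩ := hx.cast_ne
  have hmul : ((-(↑u⁻¹ : ZMod N)).val : ZMod N) * κ = -1 := by
    rw [ZMod.natCast_zmod_val, ← hu, neg_mul, Units.inv_mul]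
  have hlt := ZMod.val_lt (-(↑u⁻¹ : ZMod N))
  generalize (-(↑u⁻¹ : ZMod N)).val = ι at hmul hlt
  refine ⟨ι, ?_, ?_, hmul⟩
  · by_contra hι
    have : ι = 0 ∨ ι = 1 := by omega
    rcases this with rfl | rfl
    · apply h1
      have h4 : (1 : ZMod N) = 0 := by rw [Nat.cast_zero, zero_mul] at hmul; linear_combination hmul
      linear_combination (κ - 1 : ZMod N) * h4
    · apply h2
      rw [Nat.cast_one] at hmul
      linear_combination hmul
  · by_contra hι
    obtain rfl : ι = N - 1 := by omega
    rw [natCast_sub_self (by omega), Nat.cast_one] at hmul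
    apply h1
    linear_combination -hmul

/-- A minimal zero-sum sequence of maximal length whose image at level `N` lies in an exotic
sequence has a term of multiplicity at least `Q - 1`. -/
theorem ExoticData.exists_count {e₁ e₂ : ZMod N × ZMod N}
    {α β : ZMod N × ZMod N →ₗ[ZMod N] ZMod N} {κ : ℕ} (hx : ExoticData e₁ e₂ α β κ)
    (h : Q = N * p) (hp : p.Prime) {W : Multiset (ZMod Q × ZMod Q)} (hW : IsMinimalZeroSum W)
    (hc : card W = 2 * Q - 1) {a b c : ℕ}
    (hle : W.map (level (Dvd.intro p h.symm)) ≤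
      replicate a e₁ + replicate b e₂ + {e₁ + e₂} + replicate c (κ • (e₂ - e₁))) :
    ∃ x, Q - 1 ≤ W.count x := by
  have h2 := hx.two_le
  have h3 := hx.add_two_le
  have hN : 0 < N := by omega
  have hQ : 0 < Q := by rw [h]; exact Nat.mul_pos hN hp.pos
  obtain ⟨U, G, hWe, hU, hG⟩ := exists_split_of_map_le hle
  obtain ⟨V, H, rfl, hV, hH⟩ := exists_split_of_map_le hU
  obtain ⟨E, F, rfl, hE, hF⟩ := exists_split_of_map_le hV
  replace hE := forall_eq_of_map_le_replicate hE
  replace hF := forall_eq_of_map_le_replicate hF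
  replace hG := forall_eq_of_map_le_replicate hG
  have hH' : ∀ v ∈ H, level (Dvd.intro p h.symm) v = e₁ + e₂ := fun v hv =>
    mem_singleton.1 (mem_of_le hH (mem_map_of_mem _ hv))
  have hHc : card H ≤ 1 := by simpa using card_le_card hH
  have hsum := congrArg (level (Dvd.intro p h.symm)) hW.2.1
  rw [hWe, sum_add, sum_add, sum_add, map_add, map_add, map_add, map_zero, map_sum_const hE,
    map_sum_const hF, map_sum_const hH', map_sum_const hG] at hsum
  have hα := congrArg α hsum
  have hβ := congrArg β hsum
  simp only [map_add, apply_nsmul, map_sub, hx.coord.fst_left, hx.coord.fst_right,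
    hx.coord.snd_left, hx.coord.snd_right, map_zero] at hα hβ
  have hcard : card E + card F + card H + card G + 1 = 2 * (N * p) := by
    rw [hWe] at hc
    simp only [card_add] at hc
    omega
  have htot := congrArg (Nat.cast (R := ZMod N)) hcard
  push_cast at htot
  rw [ZMod.natCast_self] at htot
  -- The zero sum and the length fix the class sizes modulo `N`: without a term over `e₁ + e₂` they
  -- are `-κ`, `κ`, `-1`; with one they are `-1`, `-1`, `0`.
  have hcases : card H = 0 ∨ card H = 1 := by omega
  rcases hcases with h0 | h1
  · rw [card_eq_zero] at h0
    subst h0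
    simp only [card_zero, Nat.cast_zero] at hα hβ htot hcard
    have hGz : (card G : ZMod N) = -1 := by linear_combination htot - hα - hβ
    obtain ⟨i, hi⟩ : N ∣ card E + κ := by
      rw [← ZMod.natCast_eq_zero_iff]; push_cast
      linear_combination hα + κ * hGz
    obtain ⟨j, hj⟩ : N ∣ card F + (N - κ) := by
      rw [← ZMod.natCast_eq_zero_iff]; push_cast
      rw [natCast_sub_self (by omega)]
      linear_combination hβ - κ * hGz
    obtain ⟨k, hk⟩ : N ∣ card G + 1 := by
      rw [← ZMod.natCast_eq_zero_iff]; push_cast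
      linear_combination hGz
    obtain ⟨i, rfl⟩ : ∃ i', i = i' + 1 := Nat.exists_eq_succ_of_ne_zero (by rintro rfl; omega)
    obtain ⟨j, rfl⟩ : ∃ j', j = j' + 1 := Nat.exists_eq_succ_of_ne_zero (by rintro rfl; omega)
    obtain ⟨k, rfl⟩ : ∃ k', k = k' + 1 := Nat.exists_eq_succ_of_ne_zero (by rintro rfl; omega)
    have hijk : i + j + k + 2 = 2 * p := by
      refine Nat.eq_of_mul_eq_mul_left hN ?_
      rw [mul_add] at hi hj hk
      have : N * (i + j + k + 2) = N * i + N * j + N * k + 2 * N := by ring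
      have : N * (2 * p) = 2 * (N * p) := by ring
      omega
    obtain ⟨ι, hι2, hι3, hικ⟩ := hx.exists_inv
    rw [mul_add, mul_comm] at hi hj hk
    exact FanData.exists_count (h := h) (E := E) (F := F) (G := G) (e₁ := e₁) (e₂ := e₂) (κ := κ)
      (ι := ι) (i := i) (j := j) (k := k)
      ⟨hp, h2, h3, hι2, hι3, hικ, hW, by rw [hWe, add_zero], by omega, by omega, by omega,
        by omega, hE, hF, hG⟩
  · obtain ⟨y, rfl⟩ := card_eq_one.1 h1
    simp only [card_singleton, Nat.cast_one] at hα hβ htot hcard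
    have hGz : (card G : ZMod N) = 0 := by linear_combination htot - hα - hβ
    obtain ⟨i, hi⟩ : N ∣ card E + 1 := by
      rw [← ZMod.natCast_eq_zero_iff]; push_cast
      linear_combination hα + κ * hGz
    obtain ⟨j, hj⟩ : N ∣ card F + 1 := by
      rw [← ZMod.natCast_eq_zero_iff]; push_cast
      linear_combination hβ - κ * hGz
    obtain ⟨k, hk⟩ : N ∣ card G := by
      rwa [← ZMod.natCast_eq_zero_iff]
    obtain ⟨i, rfl⟩ : ∃ i', i = i' + 1 := Nat.exists_eq_succ_of_ne_zero (by rintro rfl; omega)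
    obtain ⟨j, rfl⟩ : ∃ j', j = j' + 1 := Nat.exists_eq_succ_of_ne_zero (by rintro rfl; omega)
    have hijk : i + j + k + 2 = 2 * p := by
      refine Nat.eq_of_mul_eq_mul_left hN ?_
      rw [mul_add] at hi hj
      have : N * (i + j + k + 2) = N * i + N * j + N * k + 2 * N := by ring
      have : N * (2 * p) = 2 * (N * p) := by ring
      omega
    rw [mul_add, mul_comm] at hi hj
    rw [mul_comm] at hk
    have hy := hH' y (mem_singleton_self y)
    rcases Nat.eq_zero_or_pos k with rfl | hk0
    · have hG0 : G = 0 := by rw [← card_eq_zero, hk, zero_mul]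
      exact LineData.exists_count (h := h) (E := E) (F := F) (y := y) (e₁ := e₁) (e₂ := e₂)
        (i := i) (j := j) ⟨hp, by omega, hW, by rw [hWe, hG0, add_zero], by omega, by omega,
          by omega, hE, hF, hy⟩
    · exact (hx.false_of_block h hp hW (y := y) (by rw [hWe, add_right_comm]) (i := i) (j := j)
        (k := k) (by omega) (by omega) hk (by omega) hk0 hE hF hG hy).elim

/-- Goodness at level `Q` provides a functional whose values on `T` reduce to `0` or `1` modulo `N`.
Whichever of `e₁`, `e₂` lies below the base, this fails at `e₁ + e₂`, where the value would be `2`,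
or at `κ(e₂ - e₁)`, where it would be `±κ`. -/
theorem ExoticData.not_isGood {e₁ e₂ : ZMod N × ZMod N}
    {α β : ZMod N × ZMod N →ₗ[ZMod N] ZMod N} {κ : ℕ} (hx : ExoticData e₁ e₂ α β κ)
    (h : Q = N * p) (hp : p ≠ 0) {T : Multiset (ZMod Q × ZMod Q)}
    (h1 : e₁ ∈ T.map (level (Dvd.intro p h.symm))) (h2 : e₂ ∈ T.map (level (Dvd.intro p h.symm)))
    (h3 : e₁ + e₂ ∈ T.map (level (Dvd.intro p h.symm)))
    (h4 : κ • (e₂ - e₁) ∈ T.map (level (Dvd.intro p h.symm))) : ¬ IsGood T := by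
  rintro ⟨e, f, a, b, hco, hT⟩
  have hκ2 := hx.two_le
  have hκN := hx.add_two_le
  have : Fact (1 < N) := ⟨by omega⟩
  have hQ : Q ≠ 0 := by rw [h]; exact mul_ne_zero (by omega) hp
  obtain ⟨hκ0, hκ1, hκ'⟩ := hx.cast_ne
  obtain ⟨x₁, hx₁, rfl⟩ := mem_map.1 h1
  obtain ⟨x₂, hx₂, rfl⟩ := mem_map.1 h2
  obtain ⟨y, hy, hye⟩ := mem_map.1 h3
  obtain ⟨z, hz, hze⟩ := mem_map.1 h4
  have hker : ∀ v, level (Dvd.intro p h.symm) v = 0 →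
      ZMod.castHom (Dvd.intro p h.symm) (ZMod N) (b v) = 0 := fun v hv => by
    obtain ⟨w, rfl⟩ := (level_eq_zero_iff h hQ v).1 hv
    rw [apply_nsmul, map_mul, map_natCast, ZMod.natCast_self, zero_mul]
  have hval : ∀ v ∈ T, v = e ∨ ZMod.castHom (Dvd.intro p h.symm) (ZMod N) (b v) = 1 :=
    fun v hv => (hT v hv).imp_right fun hb => by rw [hb, map_one]
  have hbe : ZMod.castHom (Dvd.intro p h.symm) (ZMod N) (b e) = 0 := by
    rw [hco.snd_left, _root_.map_zero]
  have hy' := hker (y - (x₁ + x₂)) (by rw [map_sub, hye, map_add, sub_self])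
  have hz' := hker (z - κ • (x₂ - x₁)) (by rw [map_sub, hze, _root_.map_nsmul, map_sub, sub_self])
  simp only [map_sub, map_add, apply_nsmul, map_mul, map_natCast] at hy' hz'
  have hbool : ∀ v ∈ T, ZMod.castHom (Dvd.intro p h.symm) (ZMod N) (b v) = 0 ∨
      ZMod.castHom (Dvd.intro p h.symm) (ZMod N) (b v) = 1 := fun v hv =>
    (hval v hv).imp_left fun hv => by rw [hv, hbe]
  have h20 : (2 : ZMod N) ≠ 0 := fun h0 => by
    have := Nat.le_of_dvd (by omega) ((ZMod.natCast_eq_zero_iff 2 N).1 (by exact_mod_cast h0))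
    omega
  have hby := hbool y hy
  have hbz := hbool z hz
  rcases hval x₁ hx₁ with he₁ | he₁ <;> rcases hval x₂ hx₂ with he₂ | he₂
  · have h5 := hx.coord.fst_left
    rw [he₁, ← he₂, hx.coord.fst_right] at h5
    exact zero_ne_one h5
  · rw [he₁, hbe, he₂] at hz'
    rcases hbz with hb | hb <;> rw [hb] at hz'
    · exact hκ0 (by linear_combination -hz')
    · exact hκ1 (by linear_combination -hz')
  · rw [he₂, hbe, he₁] at hz'
    rcases hbz with hb | hb <;> rw [hb] at hz'
    · exact hκ0 (by linear_combination hz')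
    · exact hκ' (by linear_combination hz')
  · rw [he₁, he₂] at hy'
    rcases hby with hb | hb <;> rw [hb] at hy'
    · exact h20 (by linear_combination -hy')
    · exact one_ne_zero (α := ZMod N) (by linear_combination -hy')

theorem isTame_level_of_propertyB {M d : ℕ} (h : M = N * d) (hM : M ≠ 0) (hB : PropertyB N)
    {S : Multiset (ZMod M × ZMod M)} (hS : IsMinimalZeroSum S) (hc : card S = 2 * M - 1) :
    IsTame N (S.map (level (Dvd.intro d h.symm))) := by
  have hns := noShort_level h hM hS hc
  refine ⟨hns, fun W hW hWs hWc => ?_⟩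
  have hN : 0 < N := Nat.pos_of_ne_zero (by rintro rfl; exact hM (by simpa using h))
  obtain ⟨g, hg⟩ := hB W ((hns.mono hW).isMinimalZeroSum hN hWs hWc) hWc
  exact ⟨g, hg.ge⟩

theorem isGood_or_isExotic_level {M d : ℕ} (h : M = N * d) (hM : M ≠ 0) (hN : 2 ≤ N)
    {S : Multiset (ZMod M × ZMod M)} (hS : IsMinimalZeroSum S) (hc : card S = 2 * M - 1)
    (hT : IsTame N (S.map (level (Dvd.intro d h.symm)))) :
    IsGood (S.map (level (Dvd.intro d h.symm))) ∨ IsExotic (S.map (level (Dvd.intro d h.symm))) := by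
  have hd : d ≠ 0 := by rintro rfl; exact hM (by simpa using h)
  refine isGood_or_isExotic hN (k := 2 * d) (by omega) hT ?_ ?_
  · rw [← map_multiset_sum, hS.2.1, map_zero]
  · rw [card_map, hc]
    have : 2 * d * N = 2 * M := by rw [h]; ring
    omega

/-- An exotic image at level `N` makes the image at level `Np` exotic as well, for every prime `p`
dividing the cofactor `d`; the cofactor decreases until the level is `M` itself. -/
theorem not_isExotic_level {M : ℕ} (hM : M ≠ 0) {S : Multiset (ZMod M × ZMod M)}
    (hS : IsMinimalZeroSum S) (hc : card S = 2 * M - 1) (d : ℕ) :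
    ∀ {N : ℕ} (h : M = N * d), ¬ IsExotic (S.map (level (Dvd.intro d h.symm))) := by
  induction d using Nat.strong_induction_on with
  | _ d ih =>
    rintro N h ⟨e₁, e₂, α, β, hco, κ, A, B, C, hκ2, hκN, hκu, hA, hB, hC, hC0, hT⟩
    have hx : ExoticData e₁ e₂ α β κ := ⟨hco, hκ2, hκN, hκu⟩
    have hd0 : d ≠ 0 := by rintro rfl; exact hM (by simpa using h)
    have hA' := Nat.le_of_dvd (by omega) hA
    have hB' := Nat.le_of_dvd (by omega) hB
    have hC' := Nat.le_of_dvd hC0 hC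
    -- At the top level an exotic sequence would have at least `3M - 1` terms, but `S` has `2M - 1`.
    by_cases hd1 : d = 1
    · have h1 := congrArg card hT
      simp only [card_map, card_add, card_replicate, card_singleton, hc] at h1
      rw [hd1, mul_one] at h
      omega
    obtain ⟨p, hp, d', rfl⟩ := Nat.exists_prime_and_dvd hd1
    have hd' : d' ≠ 0 := by rintro rfl; exact hd0 (by simp)
    have h' : M = N * p * d' := by rw [h]; ring
    set T := S.map (level (Dvd.intro d' h'.symm)) with hTdef
    have hTmap : T.map (level (Dvd.intro p rfl)) = S.map (level (Dvd.intro (p * d') h.symm)) := by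
      rw [hTdef, Multiset.map_map]
      exact map_congr rfl fun x _ => level_level _ _ _
    have hns : NoShort (N * p) T := noShort_level h' hM hS hc
    have hNp : 2 ≤ N * p := by
      have := Nat.mul_le_mul (show 2 ≤ N by omega) hp.one_le
      omega
    -- This replaces Property B at level `Np`, which is not available: the required multiplicity
    -- comes from the exotic image below.
    have htame : IsTame (N * p) T := by
      refine ⟨hns, fun W hW hWs hWc => ?_⟩
      refine hx.exists_count rfl hp ((hns.mono hW).isMinimalZeroSum (by omega) hWs hWc) hWc
        (a := A) (b := B) (c := C) ?_
      rw [← hT, ← hTmap]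
      exact Multiset.map_le_map hW
    rcases isGood_or_isExotic_level h' hM hNp hS hc htame with hg | he
    · refine hx.not_isGood rfl hp.ne_zero (T := T) ?_ ?_ ?_ ?_ hg <;> rw [hTmap, hT] <;>
        simp only [mem_add, mem_replicate, mem_singleton]
      · exact Or.inl (Or.inl (Or.inl ⟨by omega, trivial⟩))
      · exact Or.inl (Or.inl (Or.inr ⟨by omega, trivial⟩))
      · exact Or.inl (Or.inr trivial)
      · exact Or.inr ⟨by omega, trivial⟩
    · exact ih d' (by
        have := Nat.mul_le_mul hp.two_le (le_refl d')
        omega) h' he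

theorem isGood_level {M d : ℕ} (h : M = N * d) (hM : M ≠ 0) (hN : 2 ≤ N) (hB : PropertyB N)
    {S : Multiset (ZMod M × ZMod M)} (hS : IsMinimalZeroSum S) (hc : card S = 2 * M - 1) :
    IsGood (S.map (level (Dvd.intro d h.symm))) :=
  (isGood_or_isExotic_level h hM hN hS hc (isTame_level_of_propertyB h hM hB hS hc)).resolve_right
    (not_isExotic_level hM hS hc d h)

end ZeroSum

/-! ### Translation to `φ(G)` and assembly -/

namespace ZeroSum

open Multiset hiding map_add map_nsmul map_zero

theorem map_Icc_getD {α : Type*} (l : List α) (d : α) {k : ℕ} (hk : k ≤ l.length) :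
    (Finset.Icc 1 k).val.map (fun ν => l.getD (ν - 1) d) = (l.take k : Multiset α) := by
  induction k with
  | zero => simp
  | succ k ih =>
    rw [← Finset.insert_Icc_right_eq_Icc_add_one (by omega), Finset.insert_val_of_notMem (by simp),
      map_cons, ih (by omega), List.take_succ_eq_append_getElem hk, ← coe_add,
      Nat.add_sub_cancel, List.getD_eq_getElem l d hk, coe_singleton, ← singleton_add, add_comm]

variable {n : ℕ}

/-- One function `x` serves all prefixes of the list, so the same coordinates can describe both
`φ(W₀)` and `φ(S)`. Positions are shifted by one because the indices `ν` start at `1`. -/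
theorem Coord.exists_affineSeq (hn : n ≠ 0) {e f : ZMod n × ZMod n}
    {α β : ZMod n × ZMod n →ₗ[ZMod n] ZMod n} (h : Coord e f α β) {l : List (ZMod n × ZMod n)}
    (hl : ∀ v ∈ l, β v = 1) :
    ∃ x : ℕ → ℕ, (∀ ν, x ν < n) ∧ ∀ k ≤ l.length,
      affineSeq e f k x = (l.take k : Multiset (ZMod n × ZMod n)) ∧
      ((∑ ν ∈ Finset.Icc 1 k, x ν : ℕ) : ZMod n) = α (l.take k : Multiset (ZMod n × ZMod n)).sum := by
  have : NeZero n := ⟨hn⟩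
  refine ⟨fun ν => (α (l.getD (ν - 1) f)).val, fun ν => ZMod.val_lt _, fun k hk => ?_⟩
  have h1 := map_Icc_getD l f hk
  have h2 : ∀ v ∈ (l.take k : Multiset (ZMod n × ZMod n)), (α v).val • e + f = v := fun v hv => by
    have h3 := hl v (List.mem_of_mem_take (mem_coe.1 hv))
    conv_rhs => rw [h.eq_comb v, h3, one_smul]
    rw [← Nat.cast_smul_eq_nsmul (ZMod n), ZMod.natCast_zmod_val]
  constructor
  · have h3 := congrArg (Multiset.map fun v => (α v).val • e + f) h1
    rw [Multiset.map_map, map_congr rfl h2, map_id'] at h3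
    exact h3
  · rw [map_sum_multiset, ← h1, Multiset.map_map, Nat.cast_sum]
    simp only [ZMod.natCast_zmod_val]
    rfl

theorem exists_preimage_blocks {G H : Type*} [DecidableEq G] [DecidableEq H] {f : G → H}
    (k : ℕ) {Bs : Multiset (Multiset H)} {U : Multiset G} (hk : card Bs = k)
    (hU : U.map f = Bs.join) :
    ∃ B : Fin k → Multiset G, U = ∑ t, B t ∧ ∀ t, (B t).map f ∈ Bs := by
  induction k generalizing Bs U with
  | zero =>
    rw [card_eq_zero] at hk
    subst hk
    exact ⟨fun _ => 0, by simpa using hU, fun t => t.elim0⟩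
  | succ k ih =>
    obtain ⟨X, hX⟩ := card_pos_iff_exists_mem.1 (show 0 < card Bs by omega)
    obtain ⟨Bs', rfl⟩ := exists_cons_of_mem hX
    rw [join_cons] at hU
    obtain ⟨V, hV, rfl⟩ := exists_le_of_le_map (hU.ge.trans' (Multiset.le_add_right X Bs'.join))
    obtain ⟨V', rfl⟩ := Multiset.le_iff_exists_add.1 hV
    rw [Multiset.map_add, add_right_inj] at hU
    obtain ⟨B, rfl, hB⟩ := ih (by simpa using hk) hU
    refine ⟨Fin.cons V B, by rw [Fin.sum_univ_succ]; simp, Fin.cases ?_ ?_⟩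
    · simp
    · intro t
      simpa using mem_cons_of_mem (hB t)

theorem Coord.isBasisPair (hn : 2 ≤ n) {e f : ZMod n × ZMod n}
    {α β : ZMod n × ZMod n →ₗ[ZMod n] ZMod n} (h : Coord e f α β) {H : Type*} [AddCommGroup H]
    (ψ : ZMod n × ZMod n →+ H) (hinj : Function.Injective ψ) (hsurj : Function.Surjective ψ) :
    IsBasisPair (ψ e) (ψ f) := by
  have : Fact (1 < n) := ⟨by omega⟩
  have : NeZero n := ⟨by omega⟩
  have hz : ∀ (a : ℤ) (v : ZMod n × ZMod n), a • v = (a : ZMod n) • v := fun a v =>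
    (Int.cast_smul_eq_zsmul (ZMod n) a v).symm
  have hind : ∀ a b : ℤ, a • ψ e + b • ψ f = 0 → a • ψ e = 0 ∧ b • ψ f = 0 := fun a b hab => by
    rw [← map_zsmul, ← map_zsmul, ← map_add, ← map_zero ψ] at hab
    have h1 := hinj hab
    rw [hz, hz] at h1
    have h2 := congrArg α h1
    have h3 := congrArg β h1
    simp only [map_add, map_smul, h.fst_left, h.fst_right, h.snd_left, h.snd_right, map_zero,
      smul_eq_mul, mul_one, mul_zero, add_zero, zero_add] at h2 h3
    rw [← map_zsmul, ← map_zsmul, hz, hz, h2, h3, zero_smul, zero_smul, map_zero]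
    exact ⟨rfl, rfl⟩
  refine ⟨fun h0 => ?_, fun h0 => ?_, hind, ?_, ?_⟩
  · have h1 := h.fst_left
    rw [hinj (h0.trans (map_zero ψ).symm), map_zero] at h1
    exact zero_ne_one h1
  · have h1 := h.snd_right
    rw [hinj (h0.trans (map_zero ψ).symm), map_zero] at h1
    exact zero_ne_one h1
  · rw [AddSubgroup.disjoint_def]
    intro x hx hx'
    obtain ⟨a, rfl⟩ := AddSubgroup.mem_zmultiples_iff.1 hx
    obtain ⟨b, hb⟩ := AddSubgroup.mem_zmultiples_iff.1 hx'
    exact (hind a (-b) (by rw [neg_smul, hb, add_neg_cancel])).1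
  · rw [codisjoint_iff, eq_top_iff]
    intro y _
    obtain ⟨v, rfl⟩ := hsurj y
    have h1 : v = (α v).val • e + (β v).val • f := by
      rw [← Nat.cast_smul_eq_nsmul (ZMod n), ← Nat.cast_smul_eq_nsmul (ZMod n),
        ZMod.natCast_zmod_val, ZMod.natCast_zmod_val]
      exact h.eq_comb v
    rw [h1, map_add, _root_.map_nsmul, _root_.map_nsmul]
    exact AddSubgroup.add_mem_sup (AddSubgroup.nsmul_mem_zmultiples _ _)
      (AddSubgroup.nsmul_mem_zmultiples _ _)

theorem map_affineSeq {G H : Type*} [AddCommGroup G] [AddCommGroup H] (ψ : G →+ H) (e f : G)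
    (k : ℕ) (x : ℕ → ℕ) : (affineSeq e f k x).map ψ = affineSeq (ψ e) (ψ f) k x := by
  rw [affineSeq, affineSeq, Multiset.map_map]
  exact map_congr rfl fun ν _ => by
    rw [Function.comp_apply, map_add, _root_.map_nsmul]

/-- The embedding of level `n` onto the multiples of `m`. -/
theorem exists_rangeIso (m n : ℕ) (hm : m ≠ 0)
    (φ : ZMod (m * n) × ZMod (m * n) →+ ZMod (m * n) × ZMod (m * n))
    (hφ : φ = nsmulAddMonoidHom m) :
    ∃ ψ : ZMod n × ZMod n →+ φ.range, Function.Injective ψ ∧ Function.Surjective ψ ∧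
      ∀ x, ψ (level (Dvd.intro_left m rfl) x) = φ.rangeRestrict x := by
  subst hφ
  have hval : ∀ x, embed rfl (level (Dvd.intro_left m rfl) x) =
      nsmulAddMonoidHom m x := embed_level (rfl : m * n = m * n)
  let ψ : ZMod n × ZMod n →+ (nsmulAddMonoidHom (α := ZMod (m * n) × ZMod (m * n)) m).range :=
    (embed rfl).codRestrict _ fun v => by
      obtain ⟨x, rfl⟩ := level_surjective (Dvd.intro_left m rfl) v
      exact ⟨x, (hval x).symm⟩
  have hψ : ∀ x, ψ (level (Dvd.intro_left m rfl) x) = (nsmulAddMonoidHom m).rangeRestrict x :=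
    fun x => Subtype.ext (hval x)
  refine ⟨ψ, fun x y hxy => embed_injective rfl hm (congrArg Subtype.val hxy), fun y => ?_, hψ⟩
  obtain ⟨x, rfl⟩ := AddMonoidHom.rangeRestrict_surjective _ y
  exact ⟨_, hψ x⟩

theorem filter_eq_add_filter_ne {α : Type*} [DecidableEq α] (T : Multiset α) (e : α) :
    T = replicate (T.count e) e + T.filter (fun v => v ≠ e) := by
  rw [← Multiset.filter_eq']
  exact (filter_add_not _ _).symm

/-- The shape of a zero-sum sequence of length `2n - 1` all of whose terms are `e` or affine. -/
theorem Coord.core_shape (hn : 2 ≤ n) {e f : ZMod n × ZMod n}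
    {α β : ZMod n × ZMod n →ₗ[ZMod n] ZMod n} (h : Coord e f α β)
    {W : Multiset (ZMod n × ZMod n)} (hs : W.sum = 0) (hc : card W = 2 * n - 1)
    (hW : ∀ v ∈ W, v = e ∨ β v = 1) :
    W.count e = n - 1 ∧ card (W.filter (fun v => v ≠ e)) = n ∧
      α (W.filter (fun v => v ≠ e)).sum = 1 := by
  have : Fact (1 < n) := ⟨by omega⟩
  have h1 := dvd_card_filter h hs hW
  have h2 := filter_eq_add_filter_ne W e
  have h3 := congrArg card h2
  rw [card_add, card_replicate, hc] at h3
  have h4 := congrArg α hs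
  rw [h2, sum_add, sum_replicate, map_add, apply_nsmul, h.fst_left, map_zero, mul_one] at h4
  obtain ⟨d, hd⟩ := h1
  have hd2 : d < 2 := by
    by_contra hge
    have : n * 2 ≤ n * d := Nat.mul_le_mul_left n (by omega)
    omega
  have hd0 : d ≠ 0 := by
    rintro rfl
    rw [mul_zero] at hd
    have h5 := card_eq_zero.1 hd
    have h6 : count e W = n + (n - 1) := by omega
    rw [h5, sum_zero, map_zero, add_zero, h6, Nat.cast_add, ZMod.natCast_self, zero_add,
      natCast_sub_self (by omega)] at h4
    simp at h4
  obtain rfl : d = 1 := by omega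
  have h6 : count e W = n - 1 := by omega
  refine ⟨h6, by omega, ?_⟩
  rw [h6, natCast_sub_self (by omega)] at h4
  push_cast at h4
  linear_combination h4

end ZeroSum
theorem proposition4p2 (m n : ℕ) (hm : 2 ≤ m) (hn : 2 ≤ n)
    (hB : ZeroSum.PropertyB n)
    (S : Multiset (ZMod (m * n) × ZMod (m * n)))
    (hS : ZeroSum.IsMinimalZeroSum S)
    (hcard : Multiset.card S = 2 * m * n - 1)
    (φ : ZMod (m * n) × ZMod (m * n) →+ ZMod (m * n) × ZMod (m * n))
    (hφ : φ = nsmulAddMonoidHom m) :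
    ∃ (W : Fin (2 * m - 2 + 1) → Multiset (ZMod (m * n) × ZMod (m * n)))
      (e₁ e₂ : φ.range) (x : ℕ → ℕ),
      ZeroSum.IsProductDecomposition m φ S W ∧
      ZeroSum.IsBasisPair e₁ e₂ ∧
      -- the form of `φ(W_0)`
      (W 0).map φ.rangeRestrict =
        Multiset.replicate (n - 1) e₁ + ZeroSum.affineSeq e₁ e₂ n x ∧
      (∀ ν ∈ Finset.Icc 1 n, x ν ∈ Finset.Icc 0 (n - 1)) ∧
      ∑ ν ∈ Finset.Icc 1 n, x ν ≡ 1 [MOD n] ∧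
      -- the form of `φ(W_i)` for `i ∈ [1, 2m-2]`
      (∀ i, i ≠ 0 →
        (W i).map φ.rangeRestrict = Multiset.replicate n e₁ ∨
        ∃ c : ℕ → ℕ,
          (W i).map φ.rangeRestrict = ZeroSum.affineSeq e₁ e₂ n c ∧
          (∀ ν ∈ Finset.Icc 1 n, c ν ∈ Finset.Icc 0 (n - 1)) ∧
          ∑ ν ∈ Finset.Icc 1 n, c ν ≡ 0 [MOD n]) ∧
      -- the form of `φ(S)`
      ∃ ℓ ∈ Finset.Icc 1 (2 * m - 1),
        S.map φ.rangeRestrict =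
          Multiset.replicate (ℓ * n - 1) e₁ +
            ZeroSum.affineSeq e₁ e₂ (2 * m * n - ℓ * n) x ∧
        ∀ ν ∈ Finset.Icc 1 (2 * m * n - ℓ * n), x ν ∈ Finset.Icc 0 (n - 1) := by
  have hM : m * n ≠ 0 := mul_ne_zero (by omega) (by omega)
  have hn0 : n ≠ 0 := by omega
  have hmn : m * n = n * m := mul_comm m n
  have hcard' : Multiset.card S = 2 * (m * n) - 1 := by rw [hcard, mul_assoc]
  obtain ⟨ψ, hinj, hsurj, hψ⟩ := ZeroSum.exists_rangeIso m n (by omega) φ hφ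
  have hgood := ZeroSum.isGood_level hmn hM hn hB hS hcard'
  have hns := ZeroSum.noShort_level hmn hM hS hcard'
  set π := ZeroSum.level (Dvd.intro m hmn.symm) with hπ
  set T := S.map π with hT
  obtain ⟨e, f, α, β, hco, hval⟩ := hgood
  have hTs : T.sum = 0 := by rw [hT, ← map_multiset_sum, hS.2.1, map_zero]
  have hTc : Multiset.card T + 1 = (2 * m - 2 + 2) * n := by
    rw [hT, Multiset.card_map, hcard', Nat.sub_add_cancel (by omega), Nat.sub_add_cancel (by omega),
      mul_assoc]
  have hψmap : ∀ U : Multiset (ZMod (m * n) × ZMod (m * n)),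
      U.map φ.rangeRestrict = (U.map π).map ψ := fun U => by
    rw [Multiset.map_map]
    exact Multiset.map_congr rfl fun x _ => (hψ x).symm
  have hker : ∀ U : Multiset (ZMod (m * n) × ZMod (m * n)), (U.map π).sum = 0 →
      U.sum ∈ φ.ker := fun U hU => by
    rw [← map_multiset_sum] at hU
    have h1 := hψ U.sum
    rw [show ZeroSum.level (Dvd.intro_left m rfl) U.sum = 0 from hU, map_zero] at h1
    exact (congrArg Subtype.val h1).symm
  -- the core and the blocks
  obtain ⟨V, hVT, hVs, hVc⟩ := ZeroSum.exists_core hn (2 * m - 2) hns hTs hTc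
  obtain ⟨W₀, hW₀, hW₀V⟩ := ZeroSum.exists_le_of_le_map hVT
  obtain ⟨U, rfl⟩ := Multiset.le_iff_exists_add.1 hW₀
  have hTeq : T = V + U.map π := by rw [hT, Multiset.map_add, hW₀V]
  have hUT : U.map π ≤ T := by rw [hTeq]; exact Multiset.le_add_left _ _
  have hUs : (U.map π).sum = 0 := by
    rw [hTeq, Multiset.sum_add, hVs, zero_add] at hTs
    exact hTs
  have hUc : Multiset.card (U.map π) = (2 * m - 2) * n := by
    rw [hTeq, Multiset.card_add, hVc, add_mul] at hTc
    omega
  obtain ⟨Bs, hBsc, hBsj, hBs⟩ := ZeroSum.exists_block_decomposition hn (2 * m - 2)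
    (hns.mono hUT) hUs hUc
  obtain ⟨B, hUB, hBmem⟩ := ZeroSum.exists_preimage_blocks (2 * m - 2) hBsc hBsj.symm
  have hBT : ∀ t, (B t).map π ≤ T := fun t => by
    refine (Multiset.map_le_map ?_).trans hUT
    rw [hUB]
    exact Finset.single_le_sum (f := B) (fun _ _ => Multiset.zero_le _) (Finset.mem_univ t)
  -- the terms outside the base
  have hVval : ∀ v ∈ V, v = e ∨ β v = 1 := fun v hv => hval v (Multiset.mem_of_le hVT hv)
  obtain ⟨hVe, hVf, hVα⟩ := hco.core_shape hn hVs hVc hVval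
  set F₀ := V.filter (fun v => v ≠ e) with hF₀
  set F₁ := (U.map π).filter (fun v => v ≠ e) with hF₁
  have hTF : T.filter (fun v => v ≠ e) = F₀ + F₁ := by rw [hTeq, Multiset.filter_add]
  have hlβ : ∀ v ∈ F₀.toList ++ F₁.toList, β v = 1 := fun v hv => by
    have hv' : v ∈ T.filter (fun v => v ≠ e) := by
      rw [hTF, Multiset.mem_add, ← Multiset.mem_toList, ← Multiset.mem_toList (s := F₁)]
      exact List.mem_append.1 hv
    exact (hval v (Multiset.mem_filter.1 hv').1).resolve_left (Multiset.mem_filter.1 hv').2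
  -- The affine terms of the core come first: the prefix of length `n` describes `φ(W₀)` and the
  -- whole list describes `φ(S)`.
  obtain ⟨x, hxlt, hx⟩ := hco.exists_affineSeq hn0 hlβ
  have hlen : (F₀.toList ++ F₁.toList).length = n + Multiset.card F₁ := by
    rw [List.length_append, Multiset.length_toList, Multiset.length_toList, hVf]
  have hIcc : ∀ y : ℕ → ℕ, (∀ ν, y ν < n) → ∀ ν, y ν ∈ Finset.Icc 0 (n - 1) := fun y hy ν =>
    Finset.mem_Icc.2 ⟨Nat.zero_le _, Nat.le_sub_one_of_lt (hy ν)⟩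
  obtain ⟨hx₀, hx₀s⟩ := hx n (by omega)
  rw [List.take_left' (by rw [Multiset.length_toList, hVf]), Multiset.coe_toList] at hx₀ hx₀s
  obtain ⟨hx₁, -⟩ := hx _ le_rfl
  rw [List.take_length, ← Multiset.coe_add, Multiset.coe_toList, Multiset.coe_toList, hlen] at hx₁
  refine ⟨Fin.cons W₀ B, ψ e, ψ f, x, ⟨?_, ?_, ?_⟩, hco.isBasisPair hn ψ hinj hsurj, ?_,
    fun ν _ => hIcc x hxlt ν, ?_, ?_, ?_⟩
  · rw [Fin.sum_univ_succ, hUB]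
    simp
  · refine Fin.cases ?_ fun t => ?_
    · exact hker _ (by rw [Fin.cons_zero, hW₀V, hVs])
    · exact hker _ (by rw [Fin.cons_succ]; exact (hBs _ (hBmem t)).1)
  · refine Fin.cases ?_ fun t => ?_
    · rw [Fin.cons_zero, ← Multiset.card_map π, hW₀V, hVc]
      omega
    · rw [Fin.cons_succ, ← Multiset.card_map π, (hBs _ (hBmem t)).2]
      omega
  · rw [Fin.cons_zero, hψmap, hW₀V, ZeroSum.filter_eq_add_filter_ne V e, hVe, Multiset.map_add,
      Multiset.map_replicate, ← hF₀, ← hx₀, ZeroSum.map_affineSeq]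
  · rw [← ZMod.natCast_eq_natCast_iff, hx₀s, hVα, Nat.cast_one]
  · refine Fin.cases (fun h0 => (h0 rfl).elim) fun t _ => ?_
    rw [Fin.cons_succ, hψmap]
    obtain ⟨hBts, hBtc⟩ := hBs _ (hBmem t)
    rcases ZeroSum.eq_replicate_or_forall_snd hco hBts hBtc
      (fun v hv => hval v (Multiset.mem_of_le (hBT t) hv)) with hrep | haff
    · exact Or.inl (by rw [hrep, Multiset.map_replicate])
    · refine Or.inr ?_
      obtain ⟨c, hclt, hc⟩ := hco.exists_affineSeq hn0 (l := ((B t).map π).toList)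
        (fun v hv => haff v (Multiset.mem_toList.1 hv))
      obtain ⟨hc₁, hc₂⟩ := hc n (by rw [Multiset.length_toList, hBtc])
      rw [List.take_of_length_le (by rw [Multiset.length_toList, hBtc]),
        Multiset.coe_toList] at hc₁ hc₂
      refine ⟨c, by rw [← hc₁, ZeroSum.map_affineSeq], fun ν _ => hIcc c hclt ν, ?_⟩
      rw [← ZMod.natCast_eq_natCast_iff, hc₂, hBts, map_zero, Nat.cast_zero]
  · obtain ⟨d, hd⟩ := ZeroSum.dvd_card_filter hco hTs hval
    rw [hTF, Multiset.card_add, hVf] at hd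
    have h1 := congrArg Multiset.card (ZeroSum.filter_eq_add_filter_ne T e)
    rw [Multiset.card_add, Multiset.card_replicate, hTF, Multiset.card_add, hVf, hd] at h1
    rw [Nat.sub_add_cancel (by omega)] at hTc
    have hd0 : 0 < d := Nat.pos_of_ne_zero (by rintro rfl; omega)
    have hd1 : d < 2 * m := by
      by_contra hge
      have : n * (2 * m) ≤ n * d := Nat.mul_le_mul_left n (by omega)
      rw [mul_comm n (2 * m)] at this
      omega
    -- `T` has `nd` affine terms, where `1 ≤ d` because the core contributes `n` of them and `d <
    -- 2m` because `|T| = 2mn - 1`.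
    obtain ⟨ℓ, hℓ⟩ : ∃ ℓ, 2 * m = ℓ + d := ⟨2 * m - d, by omega⟩
    have hℓn : 2 * m * n = ℓ * n + n * d := by rw [hℓ]; ring
    refine ⟨ℓ, Finset.mem_Icc.2 ⟨by omega, by omega⟩, ?_, fun ν _ => hIcc x hxlt ν⟩
    rw [show 2 * m * n - ℓ * n = n + Multiset.card F₁ by omega, hψmap,
      show Multiset.map π (W₀ + U) = T from rfl, ZeroSum.filter_eq_add_filter_ne T e, hTF, ← hx₁,
      Multiset.map_add, Multiset.map_replicate, ZeroSum.map_affineSeq,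
      show Multiset.count e T = ℓ * n - 1 by omega]
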